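/- **Theorem 1.1.** For an $n\times p$ real matrix $A$ with $p\le n$, let $\sigma_1(A)\ge\dots\ge\sigma_p(A)\ge 0$ be its singular values (the square roots of the eigenvalues of $A^{\mathrm T}A$, with multiplicity), and let $\|\cdot\|$ denote the Euclidean operator norm. Let $c_0>0$, $K\ge 1$, $L\ge 1$ and $m_4$ be given. Then there are constants $c,C>0$, depending only on $c_0,K,L,m_4$, such that the following holds. Let $\xi$ be a real random variable with $\mathbb E\,\xi=0$, $\operatorname{Var}\xi=1$ and $\mathbb E\,\xi^4\le m_4$; let $n,p$ be integers with $c_0 n\le p\le n$; let $M$ be a random $n\times p$ matrix whose entries are independent copies of $\xi$; and let $\Sigma$ be a deterministic $n\times n$ positive definite matrix with $\|\Sigma\|\le L^2$ and $\|\Sigma^{-1}\|\le L^2$. Let $\mathcal E_K$ be the event that $\|M\|\le K\sqrt n$ and $\sigma_p(M)\ne 0$. Then for all real $\alpha,\delta$ with $n^{-c}\le\alpha\le c$ and $\delta\ge n^{-c/\alpha}$, and for every $1\le i\le p-1$, $$\mathbb P\Big(\big\{\sigma_i^2(\Sigma^{1/2}M)-\sigma_{i+1}^2(\Sigma^{1/2}M)\le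 \sigma_{i+1}(\Sigma^{1/2}M)\,\delta\, n^{-1/2}\big\}\cap\mathcal E_K\Big)\le C\,\frac{\delta}{\sqrt\alpha}.$$ -/

import Mathlib

open MeasureTheory ProbabilityTheory
open scoped Matrix MatrixOrder Matrix.Norms.L2Operator

/-- The `(i+1)`-st largest singular value (the index `i` is zero-based) of a real `n × p` matrix `A`,
i.e. the square root of the `(i+1)`-st largest eigenvalue of `Aᵀ A`, with multiplicity. -/
noncomputable def matrixSingularValue {n p : ℕ} (A : Matrix (Fin n) (Fin p) ℝ) (i : ℕ) : ℝ :=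
  (Matrix.toEuclideanLin A).singularValues i

/-- The random matrix `M` on `(Ω, P)` has independent entries, each of them distributed as the
atom variable `ξ` on `(Ω₀, P₀)`. -/
structure HasIIDEntries {Ω₀ Ω : Type*} [MeasurableSpace Ω₀] [MeasurableSpace Ω]
    (P₀ : Measure Ω₀) (ξ : Ω₀ → ℝ) (P : Measure Ω) {n p : ℕ}
    (M : Ω → Matrix (Fin n) (Fin p) ℝ) : Prop where
  indep : iIndepFun (fun (e : Fin n × Fin p) (ω : Ω) => M ω e.1 e.2) P
  identDistrib : ∀ (i : Fin n) (j : Fin p), IdentDistrib (fun ω => M ω i j) ξ P P₀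

/-- The event that `‖M‖ ≤ K √n` in operator norm and the smallest singular value `σ_p(M)` of the
`n × p` matrix `M` is nonzero. -/
def goodEvent {Ω : Type*} {n p : ℕ} (M : Ω → Matrix (Fin n) (Fin p) ℝ) (K : ℝ) : Set Ω :=
  {ω | ‖M ω‖ ≤ K * √(n : ℝ) ∧ matrixSingularValue (M ω) (p - 1) ≠ 0}

/-!
# Gaps between the singular values of `Σ^{1/2} M`

Write `A = Σ^{1/2} M` and let `A_j` be `A` without column `j`. If `v` is a unit right singular vector of
`A` for `σ = σ_{i+1}(A)` and `w` is a unit left singular vector of `A_j` for `σ' = σ_i(A_j)`, then pairing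
`A Aᵀ = A_j A_jᵀ + X Xᵀ` (with `X` the column `j` of `A`) against `w` and `A v` gives
`σ |v j| |⟨w, X⟩| ≤ |σ' ^ 2 - σ ^ 2|`, and by interlacing `σ ≤ σ' ≤ σ_i(A)`
(`abs_mul_abs_dotProduct_col_le`, `singVal_succ_le_dropCol`, `singVal_dropCol_le`). A small gap thus makes
`|v j| |⟨Σ^{1/2} w, M_j⟩|` at most `δ / √n` for every `j`. The vector `y = Σ^{1/2} w` is independent of the
column `M_j`, so two facts finish the proof: `v` has a positive proportion of coordinates of order
`1 / √n`, and `y` has no arithmetic structure, so that `⟨y, M_j⟩` has small ball probability of order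
`δ / √α` (`smallBall_of_unstructured`). Markov's inequality over `j` combines them (`gap_cover`,
`measure_le_card_le`, `measure_gap_le`).

The only property of the entries that is used is that two independent copies differ by an amount in
`[1, R]` with probability at least `b` (`IsSpreadLaw`, from the fourth moment in `exists_isSpreadLaw`).
Small ball estimates come from bounding characteristic functions through the distance to the nearest
integer; the notion `Unstructured a I D g k` asks that this distance, summed over the coordinates in
`I`, is large at all frequencies up to `D`.

Both facts about singular vectors are proved for solutions of a symmetric system
`M z = σ B y`, `Mᵀ y = σ B' z` (`SingularSystem`), which covers right singular vectors of `A` and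
left singular vectors of `A_j`:

* `measure_nearSparse_le`: with overwhelming probability no solution is close to a sparse vector. For a
  fixed nearly sparse `z`, eliminating `y` leaves a quadratic relation that constrains the fresh columns
  of `M` outside the support; a net over nearly sparse vectors is small enough for a union bound.
* `measure_structured_le`: with overwhelming probability `y` is unstructured up to the scale
  `n ^ (β / α)`. Otherwise consider, along dyadic scales, the last scale `D` at which both `y` and `z` have
  an unstructured block of about `α n` coordinates (`exists_level`). One of the two vectors, say `y`, has
  all its blocks of spread coordinates structured at scale `2 D`; such vectors have a net that is smaller
  than the generic one by a factor `n ^ (-c n)` (`exists_net_structured`), whereas the unstructured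
  blocks give each equation outside of them probability about `1 / D` (`measure_level_le`). Since the
  equations nearly compensate the size of the generic nets, the gain decides.
-/

set_option linter.unusedSectionVars false

/-! ### Euclidean norms of coordinate vectors -/

/-- The Euclidean norm of a coordinate vector `v : ι → ℝ`. (The norm `‖v‖` of the function space
is the supremum norm.) -/
noncomputable def l2 {ι : Type*} [Fintype ι] (v : ι → ℝ) : ℝ := ‖WithLp.toLp 2 v‖

/-- The matrix `A` has Euclidean operator norm at most `B`. -/
def OpBound {ι κ : Type*} [Fintype ι] [Fintype κ] (A : Matrix ι κ ℝ) (B : ℝ) : Prop :=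
  ∀ v : κ → ℝ, l2 (A *ᵥ v) ≤ B * l2 v

section EuclideanNorm

variable {ι κ : Type*} [Fintype ι] [Fintype κ]

lemma l2_nonneg (v : ι → ℝ) : 0 ≤ l2 v := norm_nonneg _

lemma l2_sq (v : ι → ℝ) : l2 v ^ 2 = ∑ i, v i ^ 2 := by
  simp [l2, EuclideanSpace.norm_sq_eq]

lemma l2_sq_eq_dotProduct (v : ι → ℝ) : l2 v ^ 2 = v ⬝ᵥ v := by
  rw [l2_sq]
  simp [dotProduct, sq]

lemma l2_add_le (v w : ι → ℝ) : l2 (v + w) ≤ l2 v + l2 w := by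
  simpa [l2] using norm_add_le (WithLp.toLp 2 v) (WithLp.toLp 2 w)

lemma l2_sub_le (v w : ι → ℝ) : l2 (v - w) ≤ l2 v + l2 w := by
  simpa [l2] using norm_sub_le (WithLp.toLp 2 v) (WithLp.toLp 2 w)

lemma l2_sub_comm (v w : ι → ℝ) : l2 (v - w) = l2 (w - v) := by
  simpa [l2] using norm_sub_rev (WithLp.toLp 2 v) (WithLp.toLp 2 w)

lemma l2_smul (c : ℝ) (v : ι → ℝ) : l2 (c • v) = |c| * l2 v := by
  simp [l2, norm_smul]

lemma l2_zero : l2 (0 : ι → ℝ) = 0 := by simp [l2]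

lemma l2_eq_zero {v : ι → ℝ} : l2 v = 0 ↔ v = 0 := by
  simp [l2]

lemma l2_le_of_sq_le {v : ι → ℝ} {B : ℝ} (hB : 0 ≤ B) (h : ∑ i, v i ^ 2 ≤ B ^ 2) : l2 v ≤ B := by
  rw [← l2_sq] at h
  exact (sq_le_sq₀ (l2_nonneg v) hB).1 h

lemma abs_dotProduct_le (v w : ι → ℝ) : |v ⬝ᵥ w| ≤ l2 v * l2 w := by
  have h := abs_real_inner_le_norm (WithLp.toLp 2 w) (WithLp.toLp 2 v)
  simpa [l2, PiLp.inner_apply, dotProduct, mul_comm] using h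

lemma abs_le_l2 (v : ι → ℝ) (i : ι) : |v i| ≤ l2 v := by
  rw [← sq_le_sq₀ (abs_nonneg _) (l2_nonneg v), sq_abs, l2_sq]
  exact Finset.single_le_sum (f := fun i => v i ^ 2) (fun i _ => sq_nonneg _) (Finset.mem_univ i)

/-- Cauchy–Schwarz: the `ℓ¹` norm on a finite set of coordinates. -/
lemma sum_abs_le_sqrt_card_mul {ι : Type*} (s : Finset ι) (v : ι → ℝ) :
    ∑ i ∈ s, |v i| ≤ √(s.card) * √(∑ i ∈ s, v i ^ 2) := by
  have h := Real.sum_mul_le_sqrt_mul_sqrt s (fun _ => (1 : ℝ)) (fun i => |v i|)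
  simpa using h

lemma l2_abs_sub_le (v w : ι → ℝ) : l2 v - l2 w ≤ l2 (v - w) := by
  simpa [l2] using norm_sub_norm_le (WithLp.toLp 2 v) (WithLp.toLp 2 w)

lemma OpBound.mono {A : Matrix ι κ ℝ} {B B' : ℝ} (h : OpBound A B) (hB : B ≤ B') : OpBound A B' :=
  fun v => (h v).trans (mul_le_mul_of_nonneg_right hB (l2_nonneg v))

lemma OpBound.transpose {A : Matrix ι κ ℝ} {B : ℝ} (hB : 0 ≤ B) (h : OpBound A B) :
    OpBound Aᵀ B := by
  intro v
  rcases (l2_nonneg (Aᵀ *ᵥ v)).eq_or_lt with h0 | h0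
  · rw [← h0]
    exact mul_nonneg hB (l2_nonneg v)
  · have h2 := h (Aᵀ *ᵥ v)
    have h3 : l2 (Aᵀ *ᵥ v) ^ 2 = v ⬝ᵥ (A *ᵥ (Aᵀ *ᵥ v)) := by
      rw [l2_sq_eq_dotProduct, Matrix.dotProduct_mulVec v A, ← Matrix.mulVec_transpose]
    have h4 := (le_abs_self _).trans (abs_dotProduct_le v (A *ᵥ (Aᵀ *ᵥ v)))
    rw [← h3] at h4
    have h5 : l2 (Aᵀ *ᵥ v) * l2 (Aᵀ *ᵥ v) ≤ (B * l2 v) * l2 (Aᵀ *ᵥ v) := by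
      calc _ = l2 (Aᵀ *ᵥ v) ^ 2 := by ring
        _ ≤ _ := h4
        _ ≤ l2 v * (B * l2 (Aᵀ *ᵥ v)) := mul_le_mul_of_nonneg_left h2 (l2_nonneg v)
        _ = _ := by ring
    exact le_of_mul_le_mul_right h5 h0

end EuclideanNorm

/-! ### Small ball probabilities for weighted sums -/

/-- The distance from a real number to the nearest integer. -/
noncomputable def distInt (x : ℝ) : ℝ := |x - round x|

/-- Pairs of real numbers whose distance lies between `1` and `R`. -/
def pairWindow (R : ℝ) : Set (ℝ × ℝ) := {q | 1 ≤ |q.1 - q.2| ∧ |q.1 - q.2| ≤ R}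

/-- The law `μ` is spread: two independent samples of `μ` have distance between `1` and `R` with
probability at least `b`. This is the only property of the atom variable that the small ball
estimates use. -/
structure IsSpreadLaw (μ : Measure ℝ) (b R : ℝ) : Prop where
  b_pos : 0 < b
  one_le_R : 1 ≤ R
  le_prod : b ≤ (μ.prod μ).real (pairWindow R)

/-- The coordinates `a i`, `i ∈ I`, are arithmetically unstructured up to scale `D`: no multiple
`s • a` with `0 < s ≤ D` has `I`-coordinates within Euclidean distance `min (g * s) k` of an integer
vector. -/
def Unstructured {ι : Type*} (a : ι → ℝ) (I : Finset ι) (D g k : ℝ) : Prop :=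
  ∀ s : ℝ, 0 < s → s ≤ D → (min (g * s) k) ^ 2 ≤ ∑ i ∈ I, distInt (s * a i) ^ 2

/-- The weighted sum `∑ a i * y i` of independent variables with law `μ` has small ball function at
scale `τ` at most `ρ`, where the indicator of the ball is replaced by a Gaussian weight. -/
def SmallBall {ι : Type*} [Fintype ι] (μ : Measure ℝ) (a : ι → ℝ) (τ ρ : ℝ) : Prop :=
  ∀ c : ℝ, ∫⁻ y : ι → ℝ, ENNReal.ofReal (Real.exp (-(∑ i, a i * y i + c) ^ 2 / (2 * τ ^ 2)))
    ∂(Measure.pi fun _ => μ) ≤ ENNReal.ofReal ρ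

lemma distInt_nonneg (x : ℝ) : 0 ≤ distInt x := abs_nonneg _

lemma distInt_le_half (x : ℝ) : distInt x ≤ 1 / 2 := abs_sub_round x

lemma distInt_le (x : ℝ) (k : ℤ) : distInt x ≤ |x - k| := round_le x k

lemma distInt_eq_abs {x : ℝ} (h : |x| ≤ 1 / 2) : distInt x = |x| := by
  refine le_antisymm (by simpa using distInt_le x 0) ?_
  by_cases h0 : round x = 0
  · simp [distInt, h0]
  · have h1 : (1 : ℝ) ≤ |((round x : ℤ) : ℝ)| := by
      have := Int.one_le_abs h0
      exact_mod_cast this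
    have h2 : |((round x : ℤ) : ℝ)| ≤ distInt x + |x| := by
      have := abs_sub_abs_le_abs_sub ((round x : ℤ) : ℝ) x
      rw [abs_sub_comm] at this
      unfold distInt
      linarith
    linarith

lemma distInt_neg (x : ℝ) : distInt (-x) = distInt x := by
  apply le_antisymm
  · have := distInt_le (-x) (-round x)
    rw [Int.cast_neg, neg_sub_neg, abs_sub_comm] at this
    exact this
  · have := distInt_le x (-round (-x))
    rw [Int.cast_neg, sub_neg_eq_add] at this
    refine this.trans (le_of_eq ?_)
    unfold distInt
    rw [← abs_neg]
    congr 1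
    ring

lemma distInt_abs_mul (x y : ℝ) : distInt (|x| * y) = distInt (x * y) := by
  rcases abs_choice x with h | h
  · rw [h]
  · rw [h, neg_mul, distInt_neg]

lemma distInt_sub_le (x y : ℝ) : distInt x - |x - y| ≤ distInt y := by
  have h := distInt_le x (round y)
  have h2 := abs_sub_le x y (round y)
  unfold distInt at *
  linarith

lemma continuous_distInt : Continuous distInt := by
  refine continuous_iff_continuousAt.2 fun x => ?_
  rw [Metric.continuousAt_iff]
  intro ε hε
  refine ⟨ε, hε, fun {y} hy => ?_⟩
  rw [Real.dist_eq] at *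
  rw [abs_lt]
  have h1 := distInt_sub_le x y
  have h2 := distInt_sub_le y x
  rw [abs_sub_comm] at h1
  constructor <;> linarith

lemma measurable_distInt : Measurable distInt := continuous_distInt.measurable

lemma distInt_sq_le_one_sub_cos (x : ℝ) : 8 * distInt x ^ 2 ≤ 1 - Real.cos (2 * Real.pi * x) := by
  have h1 : Real.cos (2 * Real.pi * x) = Real.cos (2 * (Real.pi * distInt x)) := by
    have : Real.cos (2 * Real.pi * x) = Real.cos (2 * Real.pi * (x - round x)) := by
      rw [mul_sub, show 2 * Real.pi * (round x : ℝ) = (round x : ℤ) * (2 * Real.pi) by ring,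
        Real.cos_sub_int_mul_two_pi]
    rw [this, ← Real.cos_abs, abs_mul, abs_of_pos Real.two_pi_pos]
    unfold distInt
    ring_nf
  have h2 := Real.mul_le_sin (x := Real.pi * distInt x)
    (mul_nonneg Real.pi_pos.le (distInt_nonneg x))
    (by nlinarith [Real.pi_pos, distInt_le_half x])
  have h3 : 2 / Real.pi * (Real.pi * distInt x) = 2 * distInt x := by
    field_simp
  rw [h3] at h2
  rw [h1, Real.cos_two_mul, Real.cos_sq']
  nlinarith [distInt_nonneg x]

lemma measurableSet_pairWindow (R : ℝ) : MeasurableSet (pairWindow R) := by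
  have h : Measurable fun q : ℝ × ℝ => |q.1 - q.2| := by fun_prop
  exact (measurableSet_le measurable_const h).inter (measurableSet_le h measurable_const)

section CharFun

variable {μ : Measure ℝ} [IsProbabilityMeasure μ] {b R : ℝ}

lemma norm_charFun_sq (t : ℝ) :
    ‖charFun μ t‖ ^ 2 = ∫ q : ℝ × ℝ, Real.cos (t * (q.1 - q.2)) ∂(μ.prod μ) := by
  have h1 : ((‖charFun μ t‖ ^ 2 : ℝ) : ℂ) = charFun μ t * charFun μ (-t) := by
    rw [charFun_neg, RCLike.mul_conj]
    simp
  rw [charFun_apply_real, charFun_apply_real, ← integral_prod_mul] at h1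
  have h2 := congrArg Complex.re h1
  rw [Complex.ofReal_re] at h2
  rw [charFun_apply_real, h2]
  have hint : Integrable (fun q : ℝ × ℝ => Complex.exp (t * q.1 * Complex.I) *
      Complex.exp ((-t : ℝ) * q.2 * Complex.I)) (μ.prod μ) := by
    refine Integrable.of_bound (by fun_prop) 1 (ae_of_all _ fun q => ?_)
    rw [norm_mul]
    have e1 := Complex.norm_exp_ofReal_mul_I (t * q.1)
    have e2 := Complex.norm_exp_ofReal_mul_I (-t * q.2)
    push_cast at e1 e2 ⊢
    rw [e1, e2, one_mul]
  have h3 := integral_re hint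
  simp only [RCLike.re_to_complex] at h3
  rw [← h3]
  refine integral_congr_ae (ae_of_all _ fun q => ?_)
  simp only
  rw [← Complex.exp_add]
  have : (t : ℂ) * q.1 * Complex.I + ((-t : ℝ) : ℂ) * q.2 * Complex.I
      = ((t * (q.1 - q.2) : ℝ) : ℂ) * Complex.I := by
    push_cast; ring
  rw [this, Complex.exp_ofReal_mul_I_re]

lemma integrable_of_bounded_real {α : Type*} [MeasurableSpace α] {ν : Measure α}
    [IsFiniteMeasure ν] {f : α → ℝ} (hf : Measurable f) (C : ℝ) (h : ∀ x, |f x| ≤ C) :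
    Integrable f ν :=
  Integrable.of_bound hf.aestronglyMeasurable C (ae_of_all _ h)

lemma norm_charFun_le (s : ℝ) :
    ‖charFun μ (2 * Real.pi * s)‖ ≤
      Real.exp (-4 * ∫ q in pairWindow R, distInt (s * (q.1 - q.2)) ^ 2 ∂(μ.prod μ)) := by
  have hm : Measurable fun q : ℝ × ℝ => distInt (s * (q.1 - q.2)) ^ 2 :=
    (measurable_distInt.comp (by fun_prop)).pow_const 2
  have hb : ∀ q : ℝ × ℝ, |distInt (s * (q.1 - q.2)) ^ 2| ≤ 1 := fun q => by
    rw [abs_of_nonneg (sq_nonneg _)]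
    nlinarith [distInt_nonneg (s * (q.1 - q.2)), distInt_le_half (s * (q.1 - q.2))]
  have hi : Integrable (fun q : ℝ × ℝ => distInt (s * (q.1 - q.2)) ^ 2) (μ.prod μ) :=
    integrable_of_bounded_real hm 1 hb
  set E := ∫ q in pairWindow R, distInt (s * (q.1 - q.2)) ^ 2 ∂(μ.prod μ)
  have h1 : E ≤ ∫ q, distInt (s * (q.1 - q.2)) ^ 2 ∂(μ.prod μ) :=
    setIntegral_le_integral hi (ae_of_all _ fun q => sq_nonneg _)
  have h2 : ‖charFun μ (2 * Real.pi * s)‖ ^ 2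
      ≤ 1 - 8 * ∫ q, distInt (s * (q.1 - q.2)) ^ 2 ∂(μ.prod μ) := by
    rw [norm_charFun_sq, ← integral_const_mul]
    have : (1 : ℝ) = ∫ q : ℝ × ℝ, (1 : ℝ) ∂(μ.prod μ) := by simp
    rw [this, ← integral_sub (integrable_const _) (hi.const_mul 8)]
    refine integral_mono (integrable_of_bounded_real (by fun_prop) 1 fun q => Real.abs_cos_le_one _)
      ((integrable_const _).sub (hi.const_mul 8)) fun q => ?_
    have := distInt_sq_le_one_sub_cos (s * (q.1 - q.2))
    simp only [← mul_assoc] at this ⊢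
    linarith
  have h3 : ‖charFun μ (2 * Real.pi * s)‖ ^ 2 ≤ Real.exp (-4 * E) ^ 2 := by
    rw [← Real.exp_nat_mul]
    have := Real.add_one_le_exp (-(8 * E))
    push_cast
    rw [show 2 * (-4 * E) = -(8 * E) by ring]
    linarith
  exact (sq_le_sq₀ (norm_nonneg _) (Real.exp_pos _).le).1 h3

variable {ι : Type*} [Fintype ι]

/-- The Gaussian weight is the characteristic function of the standard Gaussian law, so the smoothed
small ball function is an average of values of the characteristic function of the sum. -/
lemma integral_exp_sq_le (a : ι → ℝ) (τ c : ℝ) :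
    ∫ y : ι → ℝ, Real.exp (-(∑ i, a i * y i + c) ^ 2 / (2 * τ ^ 2)) ∂(Measure.pi fun _ => μ)
      ≤ ∫ u, ∏ i, ‖charFun μ (u / τ * a i)‖ ∂(gaussianReal 0 1) := by
  have key : ∀ y : ι → ℝ,
      ((Real.exp (-(∑ i, a i * y i + c) ^ 2 / (2 * τ ^ 2)) : ℝ) : ℂ) =
        ∫ u, Complex.exp (((∑ i, a i * y i + c) / τ : ℝ) * u * Complex.I) ∂(gaussianReal 0 1) := by
    intro y
    rw [← charFun_apply_real, charFun_gaussianReal]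
    push_cast
    congr 1
    simp only [mul_zero, zero_mul, one_mul, zero_sub]
    rw [div_pow, div_div, neg_div, mul_comm]
  have hint : Integrable (Function.uncurry fun (y : ι → ℝ) (u : ℝ) =>
      Complex.exp (((∑ i, a i * y i + c) / τ : ℝ) * u * Complex.I))
      ((Measure.pi fun _ => μ).prod (gaussianReal 0 1)) := by
    refine Integrable.of_bound (Measurable.aestronglyMeasurable ?_) 1 (ae_of_all _ fun q => ?_)
    · unfold Function.uncurry
      fun_prop
    · have := Complex.norm_exp_ofReal_mul_I ((∑ i, a i * q.1 i + c) / τ * q.2)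
      rw [Complex.ofReal_mul] at this
      exact this.le
  have h1 : ((∫ y : ι → ℝ, Real.exp (-(∑ i, a i * y i + c) ^ 2 / (2 * τ ^ 2))
      ∂(Measure.pi fun _ => μ) : ℝ) : ℂ) = ∫ u, ∫ y : ι → ℝ,
        Complex.exp (((∑ i, a i * y i + c) / τ : ℝ) * u * Complex.I)
          ∂(Measure.pi fun _ => μ) ∂(gaussianReal 0 1) := by
    rw [← integral_integral_swap hint, ← integral_complex_ofReal]
    exact integral_congr_ae (ae_of_all _ key)
  have h2 : ∀ u : ℝ, ‖∫ y : ι → ℝ, Complex.exp (((∑ i, a i * y i + c) / τ : ℝ) * u * Complex.I)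
      ∂(Measure.pi fun _ => μ)‖ = ∏ i, ‖charFun μ (u / τ * a i)‖ := by
    intro u
    have : ∀ y : ι → ℝ, Complex.exp (((∑ i, a i * y i + c) / τ : ℝ) * u * Complex.I)
        = Complex.exp ((c / τ * u : ℝ) * Complex.I) *
          ∏ i, Complex.exp (((u / τ * a i : ℝ) : ℂ) * y i * Complex.I) := by
      intro y
      rw [← Complex.exp_sum, ← Complex.exp_add]
      congr 1
      push_cast
      rw [← Finset.sum_mul, add_div, Finset.sum_div, add_mul, Finset.sum_mul, add_mul,
        add_comm]
      congr 1
      congr 1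
      refine Finset.sum_congr rfl fun i _ => ?_
      ring
    simp_rw [this]
    rw [integral_const_mul, norm_mul, Complex.norm_exp_ofReal_mul_I, one_mul]
    rw [integral_fintype_prod_eq_prod (𝕜 := ℂ) (μ := fun _ : ι => μ)
      (fun i (t : ℝ) => Complex.exp (((u / τ * a i : ℝ) : ℂ) * t * Complex.I)), norm_prod]
    simp_rw [charFun_apply_real]
  have h3 := congrArg norm h1
  rw [Complex.norm_real, Real.norm_eq_abs] at h3
  refine (le_abs_self _).trans (h3.le.trans ((norm_integral_le_integral_norm _).trans ?_))
  simp_rw [h2]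
  exact le_rfl

end CharFun

section GaussianAverage

lemma gaussian_density_mul_exp (β x : ℝ) :
    gaussianPDFReal 0 1 x * Real.exp (-β * x ^ 2)
      = (√(2 * Real.pi))⁻¹ * Real.exp (-(1 / 2 + β) * x ^ 2) := by
  rw [gaussianPDFReal]
  simp only [NNReal.coe_one, mul_one, sub_zero]
  rw [mul_assoc, ← Real.exp_add]
  congr 2
  ring

lemma integral_exp_gaussian (β : ℝ) :
    ∫ x, Real.exp (-β * x ^ 2) ∂(gaussianReal 0 1) = (√(2 * Real.pi))⁻¹ * √(Real.pi / (1 / 2 + β)) := by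
  rw [integral_gaussianReal_eq_integral_smul one_ne_zero]
  simp_rw [smul_eq_mul, gaussian_density_mul_exp]
  rw [integral_const_mul, integral_gaussian]

lemma integrable_exp_gaussian {β : ℝ} (hβ : -(1 / 2) < β) :
    Integrable (fun x => Real.exp (-β * x ^ 2)) (gaussianReal 0 1) := by
  rw [gaussianReal_of_var_ne_zero _ one_ne_zero, integrable_withDensity_iff_integrable_smul' (by fun_prop)
    (ae_of_all _ fun x => gaussianPDF_lt_top)]
  have : (fun x => (gaussianPDF 0 1 x).toReal • Real.exp (-β * x ^ 2))
      = fun x => (√(2 * Real.pi))⁻¹ * Real.exp (-(1 / 2 + β) * x ^ 2) := by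
    funext x
    rw [toReal_gaussianPDF, smul_eq_mul, gaussian_density_mul_exp]
  rw [this]
  exact (integrable_exp_neg_mul_sq (by linarith)).const_mul _

lemma integral_exp_gaussian_le {β : ℝ} (hβ : 0 < β) :
    ∫ x, Real.exp (-β ^ 2 * x ^ 2) ∂(gaussianReal 0 1) ≤ 1 / β := by
  rw [integral_exp_gaussian (β ^ 2), ← Real.sqrt_inv, ← Real.sqrt_mul (by positivity)]
  apply Real.sqrt_le_iff.2
  refine ⟨by positivity, ?_⟩
  rw [div_pow, one_pow, show (2 * Real.pi)⁻¹ * (Real.pi / (1 / 2 + β ^ 2)) = 1 / (1 + 2 * β ^ 2) by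
    field_simp
    try ring]
  apply one_div_le_one_div_of_le (by positivity)
  nlinarith [sq_nonneg β]

lemma integral_exp_gaussian_quarter :
    ∫ x, Real.exp (1 / 4 * x ^ 2) ∂(gaussianReal 0 1) ≤ 2 := by
  have h := integral_exp_gaussian (-(1 / 4))
  simp only [neg_neg] at h
  rw [h, ← Real.sqrt_inv, ← Real.sqrt_mul (by positivity)]
  apply Real.sqrt_le_iff.2
  refine ⟨by norm_num, ?_⟩
  rw [show (2 * Real.pi)⁻¹ * (Real.pi / (1 / 2 + -(1 / 4))) = 2 by
    field_simp
    norm_num]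
  norm_num

end GaussianAverage

section SmallBallBounds

variable {μ : Measure ℝ} [IsProbabilityMeasure μ] {b R : ℝ} {ι : Type*} [Fintype ι]

/-- Jensen's inequality over the window of pairs: the product of characteristic functions is at most
an average, over pairs at distance between `1` and `R`, of exponentials of squared distances to the
integer lattice. -/
lemma prod_charFun_le (hμ : IsSpreadLaw μ b R) (a : ι → ℝ) (s : ℝ) :
    ∏ i, ‖charFun μ (2 * Real.pi * s * a i)‖ ≤
      ⨍ q in pairWindow R, Real.exp (-(4 * b) * ∑ i, distInt (s * a i * (q.1 - q.2)) ^ 2)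
        ∂(μ.prod μ) := by
  set W := pairWindow R
  have hW : b ≤ (μ.prod μ).real W := hμ.le_prod
  have hWpos : 0 < (μ.prod μ).real W := hμ.b_pos.trans_le hW
  have hm : ∀ i, Measurable fun q : ℝ × ℝ => distInt (s * a i * (q.1 - q.2)) ^ 2 := fun i =>
    (measurable_distInt.comp (by fun_prop)).pow_const 2
  have hb : ∀ i, ∀ q : ℝ × ℝ, |distInt (s * a i * (q.1 - q.2)) ^ 2| ≤ 1 := fun i q => by
    rw [abs_of_nonneg (sq_nonneg _)]
    nlinarith [distInt_nonneg (s * a i * (q.1 - q.2)), distInt_le_half (s * a i * (q.1 - q.2))]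
  have hi : ∀ i, IntegrableOn (fun q : ℝ × ℝ => distInt (s * a i * (q.1 - q.2)) ^ 2) W (μ.prod μ) :=
    fun i => (integrable_of_bounded_real (hm i) 1 (hb i))
  set f : ℝ × ℝ → ℝ := fun q => ∑ i, distInt (s * a i * (q.1 - q.2)) ^ 2 with hf
  have hf0 : ∀ q, 0 ≤ f q := fun q => Finset.sum_nonneg fun i _ => sq_nonneg _
  have hfm : Measurable f := Finset.measurable_sum _ fun i _ => hm i
  have hfi : IntegrableOn f W (μ.prod μ) := integrable_finsetSum _ fun i _ => hi i
  have h1 : ∏ i, ‖charFun μ (2 * Real.pi * s * a i)‖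
      ≤ Real.exp (-4 * ∫ q in W, f q ∂(μ.prod μ)) := by
    rw [hf, integral_finsetSum _ fun i _ => hi i, Finset.mul_sum, Real.exp_sum]
    refine Finset.prod_le_prod (fun i _ => norm_nonneg _) fun i _ => ?_
    rw [mul_assoc]
    exact norm_charFun_le _
  refine h1.trans ?_
  set w := (μ.prod μ).real W
  have h2 : -4 * ∫ q in W, f q ∂(μ.prod μ) = ⨍ q in W, -(4 * w) * f q ∂(μ.prod μ) := by
    rw [setAverage_eq, integral_const_mul, smul_eq_mul]
    change _ = w⁻¹ * _
    field_simp
  have hexp : ∀ c : ℝ, 0 ≤ c → IntegrableOn (fun q => Real.exp (-c * f q)) W (μ.prod μ) :=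
    fun c hc => integrable_of_bounded_real (by fun_prop) 1 fun q => by
      rw [abs_of_pos (Real.exp_pos _), Real.exp_le_one_iff]
      nlinarith [mul_nonneg hc (hf0 q)]
  rw [h2]
  have hW0 : (μ.prod μ) W ≠ 0 := fun h => by
    have : w = 0 := by simp [w, Measure.real, h]
    linarith
  refine (ConvexOn.map_set_average_le convexOn_exp Real.continuous_exp.continuousOn isClosed_univ hW0
    (measure_ne_top _ _) (ae_of_all _ fun q => Set.mem_univ _) (hfi.const_mul _)
    (hexp (4 * w) (by positivity))).trans ?_
  rw [setAverage_eq, setAverage_eq, smul_eq_mul, smul_eq_mul]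
  refine mul_le_mul_of_nonneg_left ?_ (by positivity)
  refine setIntegral_mono (hexp (4 * w) (by positivity)) (hexp (4 * b) (by linarith [hμ.b_pos])) fun q => ?_
  rw [Real.exp_le_exp]
  nlinarith [hf0 q]

/-- A bound for the Gaussian average of exponentials of squared lattice distances that is uniform
over dilations by factors in `[1, R]` bounds the small ball function. -/
lemma smallBall_of_uniform (hμ : IsSpreadLaw μ b R) (a : ι → ℝ) {τ ρ : ℝ}
    (h : ∀ r : ℝ, 1 ≤ r → r ≤ R →
      ∫ u, Real.exp (-(4 * b) * ∑ i, distInt (u / (2 * Real.pi * τ) * r * a i) ^ 2)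
        ∂(gaussianReal 0 1) ≤ ρ) : SmallBall μ a τ ρ := by
  intro c
  have hm : ∀ i, Measurable fun q : ℝ × (ℝ × ℝ) =>
      distInt (q.1 / (2 * Real.pi * τ) * a i * (q.2.1 - q.2.2)) ^ 2 := fun i =>
    (measurable_distInt.comp (by fun_prop)).pow_const 2
  have hm2 : Measurable fun q : ℝ × (ℝ × ℝ) => Real.exp (-(4 * b) *
      ∑ i, distInt (q.1 / (2 * Real.pi * τ) * a i * (q.2.1 - q.2.2)) ^ 2) := by
    have := Finset.measurable_sum Finset.univ fun i _ => hm i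
    fun_prop
  have hb2 : ∀ q : ℝ × (ℝ × ℝ), |Real.exp (-(4 * b) *
      ∑ i, distInt (q.1 / (2 * Real.pi * τ) * a i * (q.2.1 - q.2.2)) ^ 2)| ≤ 1 := fun q => by
    rw [abs_of_pos (Real.exp_pos _), Real.exp_le_one_iff]
    have : 0 ≤ ∑ i, distInt (q.1 / (2 * Real.pi * τ) * a i * (q.2.1 - q.2.2)) ^ 2 :=
      Finset.sum_nonneg fun i _ => sq_nonneg _
    nlinarith [hμ.b_pos, mul_nonneg hμ.b_pos.le this]
  set W := pairWindow R
  have hWpos : 0 < (μ.prod μ).real W := hμ.b_pos.trans_le hμ.le_prod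
  rw [← ofReal_integral_eq_lintegral_ofReal]
  rotate_left
  · refine integrable_of_bounded_real (by fun_prop) 1 fun y => ?_
    rw [abs_of_pos (Real.exp_pos _), Real.exp_le_one_iff, neg_div]
    exact neg_nonpos.2 (by positivity)
  · exact ae_of_all _ fun y => (Real.exp_pos _).le
  apply ENNReal.ofReal_le_ofReal
  refine (integral_exp_sq_le a τ c).trans ?_
  have h1 : ∀ u : ℝ, ∏ i, ‖charFun μ (u / τ * a i)‖ ≤
      ⨍ q in W, Real.exp (-(4 * b) * ∑ i, distInt (u / (2 * Real.pi * τ) * a i * (q.1 - q.2)) ^ 2)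
        ∂(μ.prod μ) := by
    intro u
    have := prod_charFun_le hμ a (u / (2 * Real.pi * τ))
    have e : 2 * Real.pi * (u / (2 * Real.pi * τ)) = u / τ := by
      rw [← div_div, mul_div_assoc', mul_div_cancel₀ _ Real.two_pi_pos.ne']
    rwa [e] at this
  have hcf : ∀ u : ℝ, |∏ i, ‖charFun μ (u / τ * a i)‖| ≤ 1 := fun u => by
    rw [abs_of_nonneg (Finset.prod_nonneg fun i _ => norm_nonneg _)]
    exact Finset.prod_le_one (fun i _ => norm_nonneg _) fun i _ => norm_charFun_le_one _
  have hint : Integrable (fun q : ℝ × (ℝ × ℝ) => Real.exp (-(4 * b) *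
      ∑ i, distInt (q.1 / (2 * Real.pi * τ) * a i * (q.2.1 - q.2.2)) ^ 2))
      ((gaussianReal 0 1).prod ((μ.prod μ).restrict W)) := integrable_of_bounded_real hm2 1 hb2
  calc ∫ u, ∏ i, ‖charFun μ (u / τ * a i)‖ ∂(gaussianReal 0 1)
      ≤ ∫ u, ⨍ q in W, Real.exp (-(4 * b) *
          ∑ i, distInt (u / (2 * Real.pi * τ) * a i * (q.1 - q.2)) ^ 2) ∂(μ.prod μ)
          ∂(gaussianReal 0 1) := by
        refine integral_mono (integrable_of_bounded_real ?_ 1 hcf) ?_ h1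
        · refine Finset.measurable_prod _ fun i _ => ?_
          have := measurable_charFun (μ := μ)
          fun_prop
        · simp_rw [setAverage_eq, smul_eq_mul]
          exact hint.integral_prod_left.const_mul _
    _ = ((μ.prod μ).real W)⁻¹ * ∫ q in W, ∫ u, Real.exp (-(4 * b) *
          ∑ i, distInt (u / (2 * Real.pi * τ) * a i * (q.1 - q.2)) ^ 2) ∂(gaussianReal 0 1)
          ∂(μ.prod μ) := by
        simp_rw [setAverage_eq, smul_eq_mul]
        rw [integral_const_mul]
        congr 1
        exact integral_integral_swap hint
    _ ≤ ((μ.prod μ).real W)⁻¹ * ∫ q in W, ρ ∂(μ.prod μ) := by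
        refine mul_le_mul_of_nonneg_left ?_ (by positivity)
        refine setIntegral_mono_on hint.integral_prod_right (integrable_const _)
          (measurableSet_pairWindow R) fun q hq => ?_
        refine le_trans (le_of_eq ?_) (h |q.1 - q.2| hq.1 hq.2)
        refine integral_congr_ae (ae_of_all _ fun u => ?_)
        simp only
        congr 2
        refine Finset.sum_congr rfl fun i _ => ?_
        rw [show u / (2 * Real.pi * τ) * |q.1 - q.2| * a i
          = |q.1 - q.2| * (u / (2 * Real.pi * τ) * a i) by ring, distInt_abs_mul]
        ring_nf
    _ = ρ := by
        rw [setIntegral_const, smul_eq_mul, ← mul_assoc, inv_mul_cancel₀ hWpos.ne', one_mul]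

/-- The constant below `1` that bounds the small ball function of a sum at constant scale. -/
noncomputable def smallBallConst (b R : ℝ) : ℝ :=
  ∫ u, (if |u| ≤ 1 then Real.exp (-(b / R ^ 2) * u ^ 2) else 1) ∂(gaussianReal 0 1)

lemma integrable_smallBallConst (hb : 0 ≤ b) :
    Integrable (fun u : ℝ => if |u| ≤ 1 then Real.exp (-(b / R ^ 2) * u ^ 2) else 1)
      (gaussianReal 0 1) := by
  refine integrable_of_bounded_real (Measurable.ite (measurableSet_le (by fun_prop) (by fun_prop))
    (by fun_prop) measurable_const) 1 fun u => ?_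
  split_ifs
  · rw [abs_of_pos (Real.exp_pos _), Real.exp_le_one_iff]
    have : 0 ≤ b / R ^ 2 * u ^ 2 := by positivity
    linarith
  · simp

lemma smallBallConst_pos (hb : 0 ≤ b) : 0 < smallBallConst b R := by
  unfold smallBallConst
  have hp : ∀ u : ℝ, 0 < (if |u| ≤ 1 then Real.exp (-(b / R ^ 2) * u ^ 2) else 1) := fun u => by
    split_ifs
    · exact Real.exp_pos _
    · exact one_pos
  rw [integral_pos_iff_support_of_nonneg (fun u => (hp u).le) (integrable_smallBallConst hb)]
  have : Function.support (fun u : ℝ => if |u| ≤ 1 then Real.exp (-(b / R ^ 2) * u ^ 2) else 1)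
      = Set.univ := by
    ext u
    simpa using (hp u).ne'
  rw [this]
  simp

lemma smallBallConst_lt_one (hb : 0 < b) (hR : 0 < R) : smallBallConst b R < 1 := by
  have hi := integrable_smallBallConst (R := R) hb.le
  have h : 0 < ∫ u, (1 - (if |u| ≤ 1 then Real.exp (-(b / R ^ 2) * u ^ 2) else 1))
      ∂(gaussianReal 0 1) := by
    have hexp : ∀ u : ℝ, Real.exp (-(b / R ^ 2) * u ^ 2) ≤ 1 := fun u => by
      rw [Real.exp_le_one_iff]
      have : 0 ≤ b / R ^ 2 * u ^ 2 := by positivity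
      linarith
    rw [integral_pos_iff_support_of_nonneg]
    · refine lt_of_lt_of_le ?_ (measure_mono (s := Set.Ioo (0 : ℝ) 1) fun u hu => ?_)
      · rw [pos_iff_ne_zero]
        intro h0
        have := gaussianReal_absolutelyContinuous' 0 one_ne_zero h0
        simp at this
      · have hu1 : |u| ≤ 1 := by rw [abs_of_pos hu.1]; exact hu.2.le
        rw [Function.mem_support, if_pos hu1]
        have : Real.exp (-(b / R ^ 2) * u ^ 2) < 1 := by
          rw [Real.exp_lt_one_iff]
          have h3 : 0 < b / R ^ 2 * u ^ 2 := by have := hu.1; positivity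
          linarith
        linarith
    · intro u
      simp only [Pi.zero_apply]
      split_ifs
      · linarith [hexp u]
      · simp
    · exact (integrable_const _).sub hi
  rw [integral_sub (integrable_const _) hi] at h
  simp only [integral_const, probReal_univ, smul_eq_mul, mul_one] at h
  unfold smallBallConst
  linarith

/-- At a scale comparable to the Euclidean norm of the weights, the small ball function is bounded
away from `1`. -/
lemma smallBall_const (hμ : IsSpreadLaw μ b R) (a : ι → ℝ) {h : ℝ} (hh : 0 < h) (ha : h ≤ l2 a) :
    SmallBall μ a (h * R / Real.pi) (smallBallConst b R) := by
  have hR : 0 < R := one_pos.trans_le hμ.one_le_R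
  have hA : 0 < l2 a := hh.trans_le ha
  have main : SmallBall μ a (l2 a * R / Real.pi) (smallBallConst b R) := by
    refine smallBall_of_uniform hμ a fun r hr1 hr2 => ?_
    unfold smallBallConst
    have hsum : ∀ u : ℝ, 0 ≤ ∑ i, distInt (u / (2 * Real.pi * (l2 a * R / Real.pi)) * r * a i) ^ 2 :=
      fun u => Finset.sum_nonneg fun i _ => sq_nonneg _
    have hle : ∀ u : ℝ, Real.exp (-(4 * b) *
        ∑ i, distInt (u / (2 * Real.pi * (l2 a * R / Real.pi)) * r * a i) ^ 2) ≤ 1 := fun u => by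
      rw [Real.exp_le_one_iff]
      nlinarith [mul_nonneg hμ.b_pos.le (hsum u)]
    refine integral_mono (integrable_of_bounded_real ?_ 1 fun u => ?_)
      (integrable_smallBallConst hμ.b_pos.le) fun u => ?_
    · have : ∀ i, Measurable fun u =>
          distInt (u / (2 * Real.pi * (l2 a * R / Real.pi)) * r * a i) ^ 2 := fun i =>
        (measurable_distInt.comp (by fun_prop)).pow_const 2
      have := Finset.measurable_sum Finset.univ fun i _ => this i
      fun_prop
    · rw [abs_of_pos (Real.exp_pos _)]
      exact hle u
    · simp only
      split_ifs with hu
      · rw [Real.exp_le_exp]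
        have e : ∀ i, u / (2 * Real.pi * (l2 a * R / Real.pi)) * r * a i
            = u * (r / R) * (a i / l2 a) / 2 := fun i => by
          field_simp
        have hrR : r / R ≤ 1 := (div_le_one hR).2 hr2
        have hrR0 : 1 / R ≤ r / R := div_le_div_of_nonneg_right hr1 hR.le
        have hR0 : 0 < 1 / R := by positivity
        have hd : ∀ i, distInt (u / (2 * Real.pi * (l2 a * R / Real.pi)) * r * a i) ^ 2
            = u ^ 2 * (r / R) ^ 2 / (4 * l2 a ^ 2) * a i ^ 2 := fun i => by
          rw [e, distInt_eq_abs, sq_abs]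
          · field_simp
            try ring
          · have h1 : |a i / l2 a| ≤ 1 := by
              rw [abs_div, abs_of_pos hA]
              exact (div_le_one hA).2 (abs_le_l2 a i)
            rw [abs_div, abs_mul, abs_mul, abs_of_pos (show (0 : ℝ) < 2 by norm_num),
              abs_of_pos (hR0.trans_le hrR0)]
            have h2 : |u| * (r / R) ≤ 1 := mul_le_one₀ hu (hR0.trans_le hrR0).le hrR
            have h3 : |u| * (r / R) * |a i / l2 a| ≤ 1 := mul_le_one₀ h2 (abs_nonneg _) h1
            linarith
        simp_rw [hd]
        rw [← Finset.mul_sum, ← l2_sq]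
        have h5 : -(4 * b) * (u ^ 2 * (r / R) ^ 2 / (4 * l2 a ^ 2) * l2 a ^ 2)
            = -(b * (u ^ 2 * (r / R) ^ 2)) := by
          field_simp
        rw [h5]
        have h6 : (1 / R) ^ 2 ≤ (r / R) ^ 2 := pow_le_pow_left₀ hR0.le hrR0 2
        have h7 : b / R ^ 2 * u ^ 2 = b * (u ^ 2 * (1 / R) ^ 2) := by field_simp
        have h8 : b * (u ^ 2 * (1 / R) ^ 2) ≤ b * (u ^ 2 * (r / R) ^ 2) :=
          mul_le_mul_of_nonneg_left (mul_le_mul_of_nonneg_left h6 (sq_nonneg u)) hμ.b_pos.le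
        linarith
      · exact hle u
  intro c
  refine le_trans (lintegral_mono fun y => ENNReal.ofReal_le_ofReal ?_) (main c)
  rw [Real.exp_le_exp, neg_div, neg_div, neg_le_neg_iff]
  refine div_le_div_of_nonneg_left (sq_nonneg _) (by have := Real.pi_pos; positivity) ?_
  have hp : h * R / Real.pi ≤ l2 a * R / Real.pi :=
    div_le_div_of_nonneg_right (mul_le_mul_of_nonneg_right ha hR.le) Real.pi_pos.le
  have hp0 : 0 < h * R / Real.pi := by have := Real.pi_pos; positivity
  nlinarith

/-- Small ball bound for weights that are arithmetically unstructured up to scale `D`. -/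
lemma smallBall_of_unstructured (hμ : IsSpreadLaw μ b R) (a : ι → ℝ) {D g k τ : ℝ}
    (hD : 0 < D) (hg : 0 < g) (hτ : 0 < τ) (ha : Unstructured a Finset.univ D g k) :
    SmallBall μ a τ (4 * τ / (√b * g) + Real.exp (-(4 * b) * k ^ 2)
      + 2 * Real.exp (-(τ * D / R) ^ 2)) := by
  have hR : 0 < R := one_pos.trans_le hμ.one_le_R
  have hb := hμ.b_pos
  have hpi := Real.pi_pos
  refine smallBall_of_uniform hμ a fun r hr1 hr2 => ?_
  set β := √b * g / (Real.pi * τ) with hβ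
  have hβ0 : 0 < β := by positivity
  set T := 2 * Real.pi * τ * D / R with hT
  have hT0 : 0 < T := by positivity
  -- Frequencies up to `D` give the first or the second term, according to which argument of the minimum
  -- in `Unstructured` is smaller; beyond `D` the third term is at least `1`.
  have hpt : ∀ u : ℝ, Real.exp (-(4 * b) * ∑ i, distInt (u / (2 * Real.pi * τ) * r * a i) ^ 2)
      ≤ Real.exp (-β ^ 2 * u ^ 2) + Real.exp (-(4 * b) * k ^ 2)
        + Real.exp (-T ^ 2 / 4) * Real.exp (1 / 4 * u ^ 2) := by
    intro u
    have hsum : 0 ≤ ∑ i, distInt (u / (2 * Real.pi * τ) * r * a i) ^ 2 :=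
      Finset.sum_nonneg fun i _ => sq_nonneg _
    have hle1 : Real.exp (-(4 * b) * ∑ i, distInt (u / (2 * Real.pi * τ) * r * a i) ^ 2) ≤ 1 := by
      rw [Real.exp_le_one_iff]
      nlinarith [mul_nonneg hb.le hsum]
    have hp1 := Real.exp_pos (-β ^ 2 * u ^ 2)
    have hp2 := Real.exp_pos (-(4 * b) * k ^ 2)
    have hp3 := mul_pos (Real.exp_pos (-T ^ 2 / 4)) (Real.exp_pos (1 / 4 * u ^ 2))
    rcases eq_or_ne u 0 with hu | hu
    · have : Real.exp (-β ^ 2 * u ^ 2) = 1 := by simp [hu]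
      linarith
    set s := |u| / (2 * Real.pi * τ) * r with hs
    have hs0 : 0 < s := by have := abs_pos.2 hu; positivity
    have hss : ∀ i, distInt (u / (2 * Real.pi * τ) * r * a i) = distInt (s * a i) := fun i => by
      have e1 : u / (2 * Real.pi * τ) * r * a i = u * (r * a i / (2 * Real.pi * τ)) := by ring
      have e2 : s * a i = |u| * (r * a i / (2 * Real.pi * τ)) := by rw [hs]; ring
      rw [e1, e2, distInt_abs_mul]
    by_cases hsD : s ≤ D
    · have h1 := ha s hs0 hsD
      simp_rw [hss]
      rcases le_total (g * s) k with hk | hk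
      · rw [min_eq_left hk] at h1
        have : Real.exp (-(4 * b) * ∑ i, distInt (s * a i) ^ 2) ≤ Real.exp (-β ^ 2 * u ^ 2) := by
          rw [Real.exp_le_exp]
          have h2 : β ^ 2 * u ^ 2 ≤ 4 * b * (g * s) ^ 2 := by
            have e3 : 4 * b * (g * s) ^ 2 = β ^ 2 * u ^ 2 * r ^ 2 := by
              rw [hs, hβ]
              have h4 : √b ^ 2 = b := Real.sq_sqrt hb.le
              have h5 : |u| ^ 2 = u ^ 2 := sq_abs u
              field_simp
              rw [h4, h5]
              ring
            rw [e3]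
            have h6 : 1 ≤ r ^ 2 := one_le_pow₀ hr1
            have h7 : 0 ≤ β ^ 2 * u ^ 2 := by positivity
            nlinarith
          nlinarith
        linarith
      · rw [min_eq_right hk] at h1
        have : Real.exp (-(4 * b) * ∑ i, distInt (s * a i) ^ 2) ≤ Real.exp (-(4 * b) * k ^ 2) := by
          rw [Real.exp_le_exp]
          nlinarith
        linarith
    · rw [not_le] at hsD
      have hu2 : T ≤ |u| := by
        rw [hT, div_le_iff₀ hR]
        rw [hs, div_mul_eq_mul_div, lt_div_iff₀ (by positivity)] at hsD
        have : |u| * r ≤ |u| * R := mul_le_mul_of_nonneg_left hr2 (abs_nonneg u)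
        nlinarith
      have h3 : 1 ≤ Real.exp (-T ^ 2 / 4) * Real.exp (1 / 4 * u ^ 2) := by
        rw [← Real.exp_add, Real.one_le_exp_iff]
        have : T ^ 2 ≤ u ^ 2 := by
          rw [← sq_abs u]
          exact pow_le_pow_left₀ hT0.le hu2 2
        linarith
      linarith
  have hi1 := integrable_exp_gaussian (β := β ^ 2) (by nlinarith)
  have hi3 : Integrable (fun u : ℝ => Real.exp (1 / 4 * u ^ 2)) (gaussianReal 0 1) := by
    simpa using integrable_exp_gaussian (β := -(1 / 4)) (by norm_num)
  have hdm : ∀ i, Measurable fun u => distInt (u / (2 * Real.pi * τ) * r * a i) ^ 2 := fun i =>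
    (measurable_distInt.comp (by fun_prop)).pow_const 2
  have hdm2 := Finset.measurable_sum Finset.univ fun i _ => hdm i
  calc _ ≤ ∫ u, (Real.exp (-β ^ 2 * u ^ 2) + Real.exp (-(4 * b) * k ^ 2)
        + Real.exp (-T ^ 2 / 4) * Real.exp (1 / 4 * u ^ 2)) ∂(gaussianReal 0 1) := by
        refine integral_mono (integrable_of_bounded_real (by fun_prop) 1 fun u => ?_)
          ((hi1.add (integrable_const _)).add (hi3.const_mul _)) hpt
        rw [abs_of_pos (Real.exp_pos _), Real.exp_le_one_iff]
        have hsum : 0 ≤ ∑ i, distInt (u / (2 * Real.pi * τ) * r * a i) ^ 2 :=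
          Finset.sum_nonneg fun i _ => sq_nonneg _
        nlinarith [mul_nonneg hb.le hsum]
    _ = ∫ u, Real.exp (-β ^ 2 * u ^ 2) ∂(gaussianReal 0 1) + Real.exp (-(4 * b) * k ^ 2)
        + Real.exp (-T ^ 2 / 4) * ∫ u, Real.exp (1 / 4 * u ^ 2) ∂(gaussianReal 0 1) := by
        have hi2 : Integrable (fun u : ℝ => Real.exp (-β ^ 2 * u ^ 2) + Real.exp (-(4 * b) * k ^ 2))
          (gaussianReal 0 1) := hi1.add (integrable_const _)
        rw [integral_add hi2 (hi3.const_mul _),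
          integral_add hi1 (integrable_const _), integral_const_mul]
        simp
    _ ≤ _ := by
        have h1 := integral_exp_gaussian_le hβ0
        have h2 : 1 / β ≤ 4 * τ / (√b * g) := by
          rw [hβ, one_div_div]
          refine div_le_div_of_nonneg_right ?_ (by positivity)
          nlinarith [Real.pi_le_four]
        have h3 : Real.exp (-T ^ 2 / 4) * ∫ u, Real.exp (1 / 4 * u ^ 2) ∂(gaussianReal 0 1)
            ≤ 2 * Real.exp (-(τ * D / R) ^ 2) := by
          rw [mul_comm]
          refine mul_le_mul integral_exp_gaussian_quarter ?_ (Real.exp_pos _).le (by norm_num)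
          rw [Real.exp_le_exp]
          have e : T ^ 2 / 4 = Real.pi ^ 2 * (τ * D / R) ^ 2 := by rw [hT]; field_simp; ring
          have h4 : 1 ≤ Real.pi ^ 2 := one_le_pow₀ (by linarith [Real.pi_gt_three])
          have h5 : 0 ≤ (τ * D / R) ^ 2 := sq_nonneg _
          nlinarith
        linarith

end SmallBallBounds

/-! ### Tensorization over disjoint families of coordinates -/

section Tensorization

variable {δ : Type*} [Fintype δ] [DecidableEq δ] {μ : Measure ℝ} [IsProbabilityMeasure μ]

/-- If each factor `g r` involves none of the fresh coordinates `F s`, `s ≠ r`, and has conditional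
expectation at most `B` given the coordinates outside `F r`, then the expectation of the product is
at most `B` to the number of factors. -/
lemma lintegral_prod_le_pow {ρ : Type*} (S : Finset ρ) (F : ρ → Finset δ)
    (g : ρ → (δ → ℝ) → ENNReal) (B : ENNReal) (hg : ∀ r ∈ S, Measurable (g r))
    (hF : ∀ r ∈ S, ∀ s ∈ S, r ≠ s → Disjoint (F r) (F s))
    (hdep : ∀ r ∈ S, ∀ s ∈ S, r ≠ s → ∀ x y, g r (Function.updateFinset x (F s) y) = g r x)
    (hB : ∀ r ∈ S, ∀ x, (∫⋯∫⁻_F r, g r ∂fun _ => μ) x ≤ B) :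
    ∫⁻ x, ∏ r ∈ S, g r x ∂(Measure.pi fun _ => μ) ≤ B ^ S.card := by
  classical
  have key : ∀ S' ⊆ S, ∀ x, (∫⋯∫⁻_S'.biUnion F, (fun x => ∏ r ∈ S', g r x) ∂fun _ => μ) x
      ≤ B ^ S'.card := by
    intro S'
    induction S' using Finset.induction_on with
    | empty => intro _ x; simp
    | insert a S' ha ih =>
      intro hS x
      have haS : a ∈ S := hS (Finset.mem_insert_self _ _)
      have hS' : S' ⊆ S := fun r hr => hS (Finset.mem_insert_of_mem hr)
      have hm : ∀ T ⊆ S, Measurable fun x => ∏ r ∈ T, g r x := fun T hT =>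
        Finset.measurable_prod _ fun r hr => hg r (hT hr)
      have hdis : Disjoint (S'.biUnion F) (F a) := by
        rw [Finset.disjoint_biUnion_left]
        intro r hr
        exact hF r (hS' hr) a haS fun h => ha (h ▸ hr)
      rw [Finset.biUnion_insert, Finset.union_comm, lmarginal_union _ _ (hm _ hS) hdis]
      have h1 : ∀ z, (∫⋯∫⁻_F a, (fun x => ∏ r ∈ insert a S', g r x) ∂fun _ => μ) z
          ≤ B * ∏ r ∈ S', g r z := by
        intro z
        have : ∀ y, ∏ r ∈ insert a S', g r (Function.updateFinset z (F a) y)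
            = g a (Function.updateFinset z (F a) y) * ∏ r ∈ S', g r z := by
          intro y
          rw [Finset.prod_insert ha]
          congr 1
          refine Finset.prod_congr rfl fun r hr => ?_
          exact hdep r (hS' hr) a haS (fun h => ha (h ▸ hr)) z y
        simp only [lmarginal, this]
        have hm1 : Measurable fun y => g a (Function.updateFinset z (F a) y) :=
          (hg a haS).comp measurable_updateFinset
        rw [lintegral_mul_const _ hm1]
        exact mul_le_mul_left (hB a haS z) _
      calc _ ≤ (∫⋯∫⁻_S'.biUnion F, (fun z => B * ∏ r ∈ S', g r z) ∂fun _ => μ) x :=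
            lmarginal_mono (fun z => h1 z) x
        _ = B * (∫⋯∫⁻_S'.biUnion F, (fun z => ∏ r ∈ S', g r z) ∂fun _ => μ) x := by
            simp only [lmarginal]
            have hm1 : Measurable fun y => ∏ r ∈ S', g r (Function.updateFinset x (S'.biUnion F) y) :=
              (hm _ hS').comp measurable_updateFinset
            rw [lintegral_const_mul _ hm1]
        _ ≤ B * B ^ S'.card := by gcongr; exact ih hS' x
        _ = B ^ (insert a S').card := by rw [Finset.card_insert_of_notMem ha, pow_succ']
  have h := lintegral_le_of_lmarginal_le (μ := fun _ : δ => μ) (S.biUnion F)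
    (f := fun x => ∏ r ∈ S, g r x) (g := fun _ => B ^ S.card)
    (Finset.measurable_prod _ fun r hr => hg r hr) measurable_const
    (by
      intro x
      refine (key S subset_rfl x).trans ?_
      simp [lmarginal])
  simpa using h

/-- The Gaussian weight of an affine form, integrated over a set of fresh coordinates, is controlled
by the small ball function of the coefficients at these coordinates. -/
lemma lmarginal_exp_le {F : Finset δ} {a : δ → ℝ} {τ ρ : ℝ}
    (h : SmallBall μ (fun e : F => a e) τ ρ) {ℓ : (δ → ℝ) → ℝ} (x : δ → ℝ)
    (hℓ : ∃ c : ℝ, ∀ y : F → ℝ, ℓ (Function.updateFinset x F y) = ∑ e : F, a e * y e + c) :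
    (∫⋯∫⁻_F, (fun x => ENNReal.ofReal (Real.exp (-(ℓ x) ^ 2 / (2 * τ ^ 2)))) ∂fun _ => μ) x
      ≤ ENNReal.ofReal ρ := by
  obtain ⟨c, hc⟩ := hℓ
  simp only [lmarginal, hc]
  exact h c

/-- Chernoff bound for a sum of squares of forms with conditionally small Gaussian weights. -/
lemma measure_sum_sq_le {ρ : Type*} (S : Finset ρ) (F : ρ → Finset δ)
    (ℓ : ρ → (δ → ℝ) → ℝ) (G : Set (δ → ℝ)) (hG : MeasurableSet G) {τ E B : ℝ} (hτ : 0 < τ)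
    (hg : ∀ r ∈ S, Measurable (ℓ r))
    (hF : ∀ r ∈ S, ∀ s ∈ S, r ≠ s → Disjoint (F r) (F s))
    (hdep : ∀ r ∈ S, ∀ s ∈ S, r ≠ s → ∀ x y, ℓ r (Function.updateFinset x (F s) y) = ℓ r x)
    (hdepG : ∀ s ∈ S, ∀ x y, Function.updateFinset x (F s) y ∈ G ↔ x ∈ G)
    (hB : ∀ r ∈ S, ∀ x ∈ G, (∫⋯∫⁻_F r, (fun x => ENNReal.ofReal
      (Real.exp (-(ℓ r x) ^ 2 / (2 * τ ^ 2)))) ∂fun _ => μ) x ≤ ENNReal.ofReal B)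
    (hB0 : 0 ≤ B) :
    (Measure.pi fun _ => μ) {x | x ∈ G ∧ ∑ r ∈ S, ℓ r x ^ 2 ≤ E}
      ≤ ENNReal.ofReal (Real.exp (E / (2 * τ ^ 2)) * B ^ S.card) := by
  classical
  set g : ρ → (δ → ℝ) → ENNReal := fun r =>
    G.indicator fun x => ENNReal.ofReal (Real.exp (-(ℓ r x) ^ 2 / (2 * τ ^ 2))) with hgdef
  have hgm : ∀ r ∈ S, Measurable (g r) := fun r hr => by
    have := hg r hr
    exact Measurable.indicator (by fun_prop) hG
  have h1 := lintegral_prod_le_pow (μ := μ) S F g (ENNReal.ofReal B) hgm hF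
    (by
      intro r hr s hs hrs x y
      simp only [hgdef, Set.indicator, hdepG s hs x y, hdep r hr s hs hrs x y])
    (by
      intro r hr x
      by_cases hx : x ∈ G
      · refine le_trans (le_of_eq ?_) (hB r hr x hx)
        simp only [lmarginal, hgdef, Set.indicator, hdepG r hr x, hx, if_true]
      · simp only [lmarginal, hgdef, Set.indicator, hdepG r hr x, hx, if_false]
        simp)
  calc (Measure.pi fun _ => μ) {x | x ∈ G ∧ ∑ r ∈ S, ℓ r x ^ 2 ≤ E}
      ≤ (Measure.pi fun _ => μ) {x | ENNReal.ofReal (Real.exp (-(E / (2 * τ ^ 2))))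
          ≤ ∏ r ∈ S, g r x} := by
        refine measure_mono fun x hx => ?_
        obtain ⟨hxG, hxE⟩ := hx
        have : ∏ r ∈ S, g r x = ENNReal.ofReal (Real.exp (-(∑ r ∈ S, ℓ r x ^ 2) / (2 * τ ^ 2))) := by
          simp only [hgdef, Set.indicator, hxG, if_true]
          rw [← ENNReal.ofReal_prod_of_nonneg fun r _ => (Real.exp_pos _).le, ← Real.exp_sum,
            ← Finset.sum_div, Finset.sum_neg_distrib]
        rw [Set.mem_ofPred_eq, this]
        apply ENNReal.ofReal_le_ofReal
        rw [Real.exp_le_exp, neg_div, neg_le_neg_iff]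
        exact div_le_div_of_nonneg_right hxE (by positivity)
    _ ≤ (∫⁻ x, ∏ r ∈ S, g r x ∂(Measure.pi fun _ => μ))
          / ENNReal.ofReal (Real.exp (-(E / (2 * τ ^ 2)))) :=
        meas_ge_le_lintegral_div (Finset.measurable_prod _ hgm).aemeasurable
          (by simpa using Real.exp_pos _) ENNReal.ofReal_ne_top
    _ ≤ ENNReal.ofReal B ^ S.card / ENNReal.ofReal (Real.exp (-(E / (2 * τ ^ 2)))) :=
        ENNReal.div_le_div_right h1 _
    _ = _ := by
        rw [← ENNReal.ofReal_pow hB0, ← ENNReal.ofReal_div_of_pos (Real.exp_pos _), Real.exp_neg,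
          div_inv_eq_mul, mul_comm]

end Tensorization

/-! ### Counting integer vectors -/

section Counting

/-- Counting by exponential weights: integer vectors with total weight at most `T`. -/
lemma card_le_exp_mul_prod {ι : Type*} [Fintype ι] (A : Finset (ι → ℤ))
    (w : ι → ℤ → ℝ) (T : ℝ) (s : ι → ℝ)
    (hA : ∀ r ∈ A, ∑ i, w i (r i) ≤ T)
    (hs : ∀ i, ∀ N : ℕ, ∑ k ∈ Finset.Icc (-(N : ℤ)) N, Real.exp (-w i k) ≤ s i) :
    (A.card : ℝ) ≤ Real.exp T * ∏ i, s i := by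
  classical
  obtain ⟨N, hN⟩ : ∃ N : ℕ, A ⊆ Fintype.piFinset fun _ : ι => Finset.Icc (-(N : ℤ)) N := by
    refine ⟨∑ r ∈ A, ∑ i, (r i).natAbs, fun r hr => ?_⟩
    rw [Fintype.mem_piFinset]
    intro i
    have h1 : (r i).natAbs ≤ ∑ i, (r i).natAbs :=
      Finset.single_le_sum (f := fun i => (r i).natAbs) (fun _ _ => Nat.zero_le _)
        (Finset.mem_univ i)
    have h2 : ∑ i, (r i).natAbs ≤ ∑ r ∈ A, ∑ i, (r i).natAbs :=
      Finset.single_le_sum (f := fun r : ι → ℤ => ∑ i, (r i).natAbs)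
        (fun _ _ => Nat.zero_le _) hr
    rw [Finset.mem_Icc]
    omega
  have h1 : (A.card : ℝ) * Real.exp (-T) ≤ ∑ r ∈ A, Real.exp (-∑ i, w i (r i)) := by
    rw [← nsmul_eq_mul]
    refine Finset.card_nsmul_le_sum _ _ _ fun r hr => ?_
    rw [Real.exp_le_exp]
    linarith [hA r hr]
  have h2 : ∑ r ∈ A, Real.exp (-∑ i, w i (r i)) ≤ ∏ i, s i := by
    calc _ ≤ ∑ r ∈ Fintype.piFinset fun _ : ι => Finset.Icc (-(N : ℤ)) N,
            Real.exp (-∑ i, w i (r i)) :=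
          Finset.sum_le_sum_of_subset_of_nonneg hN fun _ _ _ => (Real.exp_pos _).le
      _ = ∏ i, ∑ k ∈ Finset.Icc (-(N : ℤ)) N, Real.exp (-w i k) := by
          rw [Finset.prod_univ_sum]
          refine Finset.sum_congr rfl fun r _ => ?_
          rw [← Finset.sum_neg_distrib, Real.exp_sum]
      _ ≤ _ := Finset.prod_le_prod
          (fun i _ => Finset.sum_nonneg fun _ _ => (Real.exp_pos _).le) fun i _ => hs i N
  have h3 := h1.trans h2
  rw [Real.exp_neg, ← div_eq_mul_inv, div_le_iff₀ (Real.exp_pos _)] at h3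
  linarith

lemma sum_exp_neg_le (s : ℝ) (hs : 0 < s) (N : ℕ) :
    ∑ j ∈ Finset.range N, Real.exp (-(s * (j + 1))) ≤ 1 / s := by
  set q := Real.exp (-s) with hq
  have hq1 : q < 1 := by rw [hq, Real.exp_lt_one_iff]; linarith
  have hq0 : 0 < q := Real.exp_pos _
  have h1 : ∀ j ∈ Finset.range N, Real.exp (-(s * (j + 1))) = q * q ^ j := fun j _ => by
    rw [hq, ← Real.exp_nat_mul, ← Real.exp_add]
    congr 1
    ring
  rw [Finset.sum_congr rfl h1, ← Finset.mul_sum, geom_sum_eq hq1.ne]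
  have h2 : (q ^ N - 1) / (q - 1) ≤ 1 / (1 - q) := by
    rw [← neg_div_neg_eq, neg_sub, neg_sub]
    refine div_le_div_of_nonneg_right ?_ (by linarith)
    linarith [pow_pos hq0 N]
  have h3 : q * (s + 1) ≤ 1 := by
    have := Real.add_one_le_exp s
    have h4 : q * Real.exp s = 1 := by rw [hq, ← Real.exp_add]; simp
    nlinarith
  calc q * ((q ^ N - 1) / (q - 1)) ≤ q * (1 / (1 - q)) := by gcongr
    _ ≤ 1 / s := by
      rw [mul_one_div, div_le_div_iff₀ (by linarith) hs]
      linarith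

lemma sum_Icc_exp_neg_abs_le {s : ℝ} (hs : 0 < s) (N : ℕ) :
    ∑ k ∈ Finset.Icc (-(N : ℤ)) N with k ≠ 0, Real.exp (-(s * |(k : ℝ)|)) ≤ 2 / s := by
  classical
  have hsub : (Finset.Icc (-(N : ℤ)) N).filter (· ≠ 0) ⊆
      (Finset.range N).image (fun j : ℕ => (j + 1 : ℤ)) ∪
        (Finset.range N).image (fun j : ℕ => (-(j + 1) : ℤ)) := by
    intro k hk
    rw [Finset.mem_filter, Finset.mem_Icc] at hk
    rw [Finset.mem_union, Finset.mem_image, Finset.mem_image]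
    rcases lt_or_gt_of_ne hk.2 with h | h
    · right
      exact ⟨(-k - 1).toNat, by rw [Finset.mem_range]; omega, by omega⟩
    · left
      exact ⟨(k - 1).toNat, by rw [Finset.mem_range]; omega, by omega⟩
  refine (Finset.sum_le_sum_of_subset_of_nonneg hsub fun _ _ _ => (Real.exp_pos _).le).trans ?_
  have hunion : ∀ (A B : Finset ℤ) (f : ℤ → ℝ), (∀ k, 0 ≤ f k) →
      ∑ k ∈ A ∪ B, f k ≤ ∑ k ∈ A, f k + ∑ k ∈ B, f k := fun A B f hf => by
    rw [← Finset.sum_union_inter]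
    have : 0 ≤ ∑ k ∈ A ∩ B, f k := Finset.sum_nonneg fun k _ => hf k
    linarith
  refine (hunion _ _ _ fun _ => (Real.exp_pos _).le).trans ?_
  rw [Finset.sum_image (fun a _ b _ h => by simpa using h),
    Finset.sum_image (fun a _ b _ h => by simpa using h)]
  have e1 : ∀ j : ℕ, |(((j : ℤ) + 1 : ℤ) : ℝ)| = j + 1 := fun j => by
    push_cast
    exact abs_of_pos (by positivity)
  have e2 : ∀ j : ℕ, |((-((j : ℤ) + 1) : ℤ) : ℝ)| = j + 1 := fun j => by
    push_cast
    rw [abs_neg]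
    exact abs_of_pos (by positivity)
  simp_rw [e1, e2]
  have := sum_exp_neg_le s hs N
  rw [show (2 : ℝ) / s = 1 / s + 1 / s by ring]
  linarith

/-- Integer vectors in a weighted `ℓ¹` ball. -/
lemma card_weighted_l1_le {ι : Type*} [Fintype ι] (A : Finset (ι → ℤ)) (s : ι → ℝ)
    (hs : ∀ i, 0 < s i) (T : ℝ) (hA : ∀ r ∈ A, ∑ i, s i * |(r i : ℝ)| ≤ T) :
    (A.card : ℝ) ≤ Real.exp T * ∏ i, (1 + 2 / s i) := by
  classical
  refine card_le_exp_mul_prod A (fun i k => s i * |(k : ℝ)|) T _ hA fun i N => ?_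
  have h0 : (0 : ℤ) ∈ Finset.Icc (-(N : ℤ)) N := by rw [Finset.mem_Icc]; omega
  rw [← Finset.add_sum_erase _ _ h0, ← Finset.filter_ne']
  have := sum_Icc_exp_neg_abs_le (hs i) N
  simp only [Int.cast_zero, abs_zero, mul_zero, neg_zero, Real.exp_zero]
  linarith

/-- Sparse integer vectors in an `ℓ¹` ball, counted with parameters `s, u > 0`. -/
lemma card_sparse_l1_le {ι : Type*} [Fintype ι] [DecidableEq ι] (A : Finset (ι → ℤ)) {s u T k : ℝ}
    (hs : 0 < s) (hu : 0 < u) (hu1 : u ≤ 1)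
    (hA : ∀ r ∈ A, ∑ i, |(r i : ℝ)| ≤ T)
    (hk : ∀ r ∈ A, (((Finset.univ.filter fun i => r i ≠ 0).card : ℕ) : ℝ) ≤ k) :
    (A.card : ℝ) ≤ Real.exp (s * T + k * (1 / u - 1) + 2 * u / s * Fintype.card ι) := by
  have hlog : 0 ≤ -Real.log u := by
    have := Real.log_nonpos hu.le hu1
    linarith
  have hlog2 : -Real.log u ≤ 1 / u - 1 := by
    have := Real.log_le_sub_one_of_pos (inv_pos.2 hu)
    rw [Real.log_inv] at this
    rw [one_div]
    exact this
  have h := card_le_exp_mul_prod A (fun i m => s * |(m : ℝ)| + if m = 0 then 0 else -Real.log u)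
    (s * T + k * (1 / u - 1)) (fun _ => 1 + 2 * u / s)
    (by
      intro r hr
      rw [Finset.sum_add_distrib, ← Finset.mul_sum]
      have h1 := mul_le_mul_of_nonneg_left (hA r hr) hs.le
      have h2 : ∑ i, (if r i = 0 then 0 else -Real.log u)
          = ((Finset.univ.filter fun i => r i ≠ 0).card : ℝ) * (-Real.log u) := by
        rw [← nsmul_eq_mul, ← Finset.sum_const, Finset.sum_filter]
        refine Finset.sum_congr rfl fun i _ => ?_
        by_cases h0 : r i = 0 <;> simp [h0]
      have h3 := hk r hr
      have h4 : ((Finset.univ.filter fun i => r i ≠ 0).card : ℝ) * (-Real.log u)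
          ≤ k * (1 / u - 1) := mul_le_mul h3 hlog2 hlog ((Nat.cast_nonneg _).trans h3)
      rw [h2]
      linarith)
    (by
      intro i N
      have h0 : (0 : ℤ) ∈ Finset.Icc (-(N : ℤ)) N := by rw [Finset.mem_Icc]; omega
      rw [← Finset.add_sum_erase _ _ h0, ← Finset.filter_ne']
      have h1 := sum_Icc_exp_neg_abs_le hs N
      have h2 : ∑ m ∈ Finset.Icc (-(N : ℤ)) N with m ≠ 0,
          Real.exp (-(s * |(m : ℝ)| + if m = 0 then 0 else -Real.log u))
          = u * ∑ m ∈ Finset.Icc (-(N : ℤ)) N with m ≠ 0, Real.exp (-(s * |(m : ℝ)|)) := by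
        rw [Finset.mul_sum]
        refine Finset.sum_congr rfl fun m hm => ?_
        rw [Finset.mem_filter] at hm
        rw [if_neg hm.2, neg_add, neg_neg, Real.exp_add, Real.exp_log hu, mul_comm]
      rw [h2]
      simp only [Int.cast_zero, abs_zero, mul_zero, if_true, add_zero, neg_zero, Real.exp_zero]
      have h3 := mul_le_mul_of_nonneg_left h1 hu.le
      rw [show 2 * u / s = u * (2 / s) by ring]
      linarith)
  refine h.trans ?_
  rw [Real.exp_add (s * T + k * (1 / u - 1))]
  refine mul_le_mul_of_nonneg_left ?_ (Real.exp_pos _).le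
  rw [Finset.prod_const, Finset.card_univ, mul_comm (2 * u / s) (Fintype.card ι : ℝ),
    Real.exp_nat_mul]
  refine pow_le_pow_left₀ (by positivity) ?_ _
  have := Real.add_one_le_exp (2 * u / s)
  linarith

end Counting

/-! ### Random matrices as points of a product space -/

section RandomMatrix

variable {ι κ : Type*} [Fintype ι] [Fintype κ] [DecidableEq ι] [DecidableEq κ]
  {μ : Measure ℝ} [IsProbabilityMeasure μ] {b R : ℝ}

/-- The matrix with entries `x (i, j)`. -/
def entryMatrix {ι κ : Type*} (x : ι × κ → ℝ) : Matrix ι κ ℝ := Matrix.of fun i j => x (i, j)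

/-- Coefficients of the linear form `x ↦ (M z) i` for the matrix `M` with entries `x`. -/
def rowForm {ι κ : Type*} [DecidableEq ι] (z : κ → ℝ) (i : ι) : ι × κ → ℝ := fun e =>
  if e.1 = i then z e.2 else 0

/-- Coefficients of the linear form `x ↦ (Mᵀ y) j` for the matrix `M` with entries `x`. -/
def colForm {ι κ : Type*} [DecidableEq κ] (y : ι → ℝ) (j : κ) : ι × κ → ℝ := fun e =>
  if e.2 = j then y e.1 else 0

lemma entryMatrix_mulVec (x : ι × κ → ℝ) (z : κ → ℝ) (i : ι) :
    (entryMatrix x *ᵥ z) i = ∑ e, rowForm z i e * x e := by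
  rw [Fintype.sum_prod_type]
  simp [rowForm, entryMatrix, Matrix.mulVec, dotProduct, mul_comm, ite_mul, Finset.sum_ite_irrel]

lemma entryMatrix_transpose_mulVec (x : ι × κ → ℝ) (y : ι → ℝ) (j : κ) :
    ((entryMatrix x)ᵀ *ᵥ y) j = ∑ e, colForm y j e * x e := by
  rw [Fintype.sum_prod_type]
  simp [colForm, entryMatrix, Matrix.mulVec, dotProduct, mul_comm]

lemma updateFinset_apply_of_notMem {δ : Type*} [DecidableEq δ] (x : δ → ℝ) {F : Finset δ}
    (y : F → ℝ) {e : δ} (he : e ∉ F) : Function.updateFinset x F y e = x e := by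
  simp [Function.updateFinset, he]

lemma sum_mul_updateFinset {δ : Type*} [Fintype δ] [DecidableEq δ] (A x : δ → ℝ) (F : Finset δ)
    (y : F → ℝ) :
    ∑ e, A e * Function.updateFinset x F y e = ∑ e : F, A e * y e + ∑ e ∈ Fᶜ, A e * x e := by
  rw [← Finset.sum_add_sum_compl F]
  congr 1
  · rw [← Finset.sum_coe_sort F]
    refine Finset.sum_congr rfl fun e _ => ?_
    simp [Function.updateFinset]
  · refine Finset.sum_congr rfl fun e he => ?_
    rw [Finset.mem_compl] at he
    rw [updateFinset_apply_of_notMem x y he]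

/-- Chernoff bound for a family of affine forms, each having its own set of fresh coordinates. -/
lemma measure_sum_sq_affine_le {δ ρ : Type*} [Fintype δ] [DecidableEq δ] (S : Finset ρ)
    (F : ρ → Finset δ) (A : ρ → δ → ℝ) (u : ρ → ℝ) {τ E B : ℝ} (hτ : 0 < τ) (hB0 : 0 ≤ B)
    (hF : ∀ r ∈ S, ∀ s ∈ S, r ≠ s → Disjoint (F r) (F s))
    (hA : ∀ r ∈ S, ∀ s ∈ S, r ≠ s → ∀ e ∈ F s, A r e = 0)
    (hB : ∀ r ∈ S, SmallBall μ (fun e : F r => A r e) τ B) :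
    (Measure.pi fun _ : δ => μ) {x | ∑ r ∈ S, (∑ e, A r e * x e - u r) ^ 2 ≤ E}
      ≤ ENNReal.ofReal (Real.exp (E / (2 * τ ^ 2)) * B ^ S.card) := by
  have h := measure_sum_sq_le (μ := μ) S F (fun r x => ∑ e, A r e * x e - u r) Set.univ
    MeasurableSet.univ (E := E) hτ (fun r _ => by fun_prop) hF
    (by
      intro r hr s hs hrs x y
      congr 1
      refine Finset.sum_congr rfl fun e _ => ?_
      by_cases he : e ∈ F s
      · rw [hA r hr s hs hrs e he, zero_mul, zero_mul]
      · rw [updateFinset_apply_of_notMem x y he])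
    (fun _ _ _ _ => by simp)
    (fun r hr x _ => lmarginal_exp_le (hB r hr) x
      ⟨∑ e ∈ (F r)ᶜ, A r e * x e - u r, fun y => by rw [sum_mul_updateFinset]; ring⟩) hB0
  simpa using h

lemma sum_rowForm_sq (z : κ → ℝ) (i : ι) (J : Finset κ) (f : ℝ → ℝ) :
    ∑ e : ({i} ×ˢ J : Finset (ι × κ)), f (rowForm z i e) = ∑ j ∈ J, f (z j) := by
  rw [Finset.sum_coe_sort ({i} ×ˢ J : Finset (ι × κ)) fun e => f (rowForm z i e), Finset.sum_product]
  simp [rowForm]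

lemma sum_colForm_sq (y : ι → ℝ) (j : κ) (I : Finset ι) (f : ℝ → ℝ) :
    ∑ e : (I ×ˢ {j} : Finset (ι × κ)), f (colForm y j e) = ∑ i ∈ I, f (y i) := by
  rw [Finset.sum_coe_sort (I ×ˢ {j} : Finset (ι × κ)) fun e => f (colForm y j e), Finset.sum_product]
  simp [colForm]

lemma continuous_entryMatrix_mulVec (z : κ → ℝ) :
    Continuous fun x : ι × κ → ℝ => entryMatrix x *ᵥ z := by
  refine continuous_pi fun i => ?_
  simp_rw [entryMatrix_mulVec]
  fun_prop

lemma continuous_l2 : Continuous (l2 : (ι → ℝ) → ℝ) := by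
  unfold l2
  exact continuous_norm.comp (PiLp.continuous_toLp 2 _)

/-- A fixed vector of norm at least `h` is mapped by the random matrix to a vector of small norm only
with exponentially small probability. -/
lemma measure_mulVec_small_le (hμ : IsSpreadLaw μ b R) {z : κ → ℝ} {h E : ℝ} (hh : 0 < h)
    (hz : h ≤ l2 z) :
    (Measure.pi fun _ : ι × κ => μ) {x | l2 (entryMatrix x *ᵥ z) ^ 2 ≤ E}
      ≤ ENNReal.ofReal (Real.exp (E / (2 * (h * R / Real.pi) ^ 2))
          * smallBallConst b R ^ Fintype.card ι) := by
  have hR : 0 < R := one_pos.trans_le hμ.one_le_R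
  have hpi := Real.pi_pos
  have h1 := measure_sum_sq_affine_le (μ := μ) (Finset.univ : Finset ι)
    (fun i => ({i} ×ˢ Finset.univ : Finset (ι × κ))) (fun i => rowForm z i) (fun _ => 0)
    (τ := h * R / Real.pi) (E := E) (B := smallBallConst b R) (by positivity)
    (smallBallConst_pos hμ.b_pos.le).le
    (fun r _ s _ hrs => by
      rw [Finset.disjoint_left]
      intro e he hes
      simp only [Finset.mem_product, Finset.mem_singleton, Finset.mem_univ, and_true] at he hes
      exact hrs (he.symm.trans hes))
    (fun r _ s _ hrs e he => by
      simp only [Finset.mem_product, Finset.mem_singleton, Finset.mem_univ, and_true] at he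
      simp only [rowForm]
      rw [if_neg]
      rw [he]
      exact hrs.symm)
    (fun i _ => smallBall_const hμ _ hh (by
      refine hz.trans (le_of_eq ?_)
      rw [← sq_eq_sq₀ (l2_nonneg _) (l2_nonneg _), l2_sq, l2_sq]
      exact (sum_rowForm_sq z i Finset.univ (fun t => t ^ 2)).symm))
  rw [Finset.card_univ] at h1
  refine le_trans (measure_mono fun x hx => ?_) h1
  rw [Set.mem_ofPred_eq, l2_sq] at hx
  simpa only [Set.mem_ofPred_eq, sub_zero, ← entryMatrix_mulVec] using hx

/-- For a fixed vector `z` supported in `J`, the columns outside `J` are independent of `M z`, so the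
vector `Mᵀ G M z` is close to a prescribed one outside `J` only with small probability. -/
lemma measure_quadratic_small_le (hμ : IsSpreadLaw μ b R) {z : κ → ℝ} {J : Finset κ}
    (hzJ : ∀ j ∉ J, z j = 0) {h g E E' : ℝ} (hh : 0 < h) (hg : 0 < g) (hE' : 0 < E')
    (hz : h ≤ l2 z) (G : Matrix ι ι ℝ) (hG : ∀ v, g * l2 v ≤ l2 (G *ᵥ v)) (v : κ → ℝ) :
    (Measure.pi fun _ : ι × κ => μ) {x | ∑ j ∈ Jᶜ,
        (((entryMatrix x)ᵀ *ᵥ (G *ᵥ (entryMatrix x *ᵥ z))) j - v j) ^ 2 ≤ E}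
      ≤ ENNReal.ofReal (Real.exp (E' ^ 2 / (2 * (h * R / Real.pi) ^ 2))
          * smallBallConst b R ^ Fintype.card ι)
        + ENNReal.ofReal (Real.exp (E / (2 * (g * E' * R / Real.pi) ^ 2))
          * smallBallConst b R ^ (Jᶜ).card) := by
  have hR : 0 < R := one_pos.trans_le hμ.one_le_R
  have hpi := Real.pi_pos
  set w : (ι × κ → ℝ) → ι → ℝ := fun x => G *ᵥ (entryMatrix x *ᵥ z) with hw
  have hwc : Continuous w := by
    have h1 := continuous_entryMatrix_mulVec (ι := ι) z
    refine continuous_pi fun i => ?_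
    simp only [hw, Matrix.mulVec, dotProduct] at h1 ⊢
    have h2 : ∀ i', Continuous fun x : ι × κ → ℝ => ∑ j, entryMatrix x i' j * z j :=
      fun i' => (continuous_pi_iff.1 h1) i'
    fun_prop
  have hwdep : ∀ j ∉ J, ∀ x (y : (Finset.univ ×ˢ {j} : Finset (ι × κ)) → ℝ),
      w (Function.updateFinset x _ y) = w x := by
    intro j hj x y
    simp only [hw]
    congr 1
    funext i
    rw [entryMatrix_mulVec, entryMatrix_mulVec]
    refine Finset.sum_congr rfl fun e _ => ?_
    by_cases he : e.2 = j
    · have : rowForm z i e = 0 := by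
        simp only [rowForm]
        rw [he, hzJ j hj, ite_self]
      rw [this, zero_mul, zero_mul]
    · rw [updateFinset_apply_of_notMem x y (by
          simpa only [Finset.mem_product, Finset.mem_singleton, Finset.mem_univ, true_and] using he)]
  have h1 := measure_mulVec_small_le (ι := ι) hμ hh hz (E := E' ^ 2)
  have h2 := measure_sum_sq_le (μ := μ) (Jᶜ)
    (fun j => (Finset.univ ×ˢ {j} : Finset (ι × κ)))
    (fun j x => ((entryMatrix x)ᵀ *ᵥ w x) j - v j) {x | g * E' ≤ l2 (w x)}
    (measurableSet_le measurable_const (continuous_l2.comp hwc).measurable)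
    (τ := g * E' * R / Real.pi) (E := E) (B := smallBallConst b R) (by positivity)
    (fun j _ => by
      simp_rw [entryMatrix_transpose_mulVec, colForm]
      have : ∀ i, Measurable fun x => w x i := fun i => ((continuous_apply i).comp hwc).measurable
      refine Measurable.sub_const (Finset.measurable_sum _ fun e _ => ?_) _
      refine Measurable.mul ?_ (measurable_pi_apply e)
      split_ifs
      · exact this _
      · exact measurable_const)
    (fun r _ s _ hrs => by
      rw [Finset.disjoint_left]
      intro e he hes
      simp only [Finset.mem_product, Finset.mem_singleton, Finset.mem_univ, true_and] at he hes
      exact hrs (he.symm.trans hes))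
    (fun r hr s hs hrs x y => by
      rw [Finset.mem_compl] at hr hs
      rw [hwdep s hs, entryMatrix_transpose_mulVec, entryMatrix_transpose_mulVec]
      congr 1
      refine Finset.sum_congr rfl fun e _ => ?_
      by_cases he : e.2 = s
      · have : colForm (w x) r e = 0 := by
          simp only [colForm]
          rw [if_neg]
          rw [he]
          exact hrs.symm
        rw [this, zero_mul, zero_mul]
      · rw [updateFinset_apply_of_notMem x y (by
          simpa only [Finset.mem_product, Finset.mem_singleton, Finset.mem_univ, true_and] using he)])
    (fun s hs x y => by
      rw [Finset.mem_compl] at hs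
      rw [Set.mem_ofPred_eq, Set.mem_ofPred_eq, hwdep s hs])
    (fun j hj x hx => by
      rw [Finset.mem_compl] at hj
      refine lmarginal_exp_le (a := colForm (w x) j) (smallBall_const hμ _ (by positivity) ?_) x
        ⟨-v j, fun y => ?_⟩
      · refine le_trans hx (le_of_eq ?_)
        rw [← sq_eq_sq₀ (l2_nonneg _) (l2_nonneg _), l2_sq, l2_sq]
        exact (sum_colForm_sq (w x) j Finset.univ (fun t => t ^ 2)).symm
      · rw [hwdep j hj, entryMatrix_transpose_mulVec, sum_mul_updateFinset, sub_eq_add_neg]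
        congr 1
        rw [add_eq_left]
        refine Finset.sum_eq_zero fun e he => ?_
        simp only [Finset.mem_compl, Finset.mem_product, Finset.mem_singleton, Finset.mem_univ,
          true_and] at he
        simp [colForm, he])
    (smallBallConst_pos hμ.b_pos.le).le
  refine le_trans (measure_mono fun x hx => ?_) ((measure_union_le _ _).trans (add_le_add h1 h2))
  by_cases hx2 : l2 (entryMatrix x *ᵥ z) ^ 2 ≤ E' ^ 2
  · exact Or.inl hx2
  · refine Or.inr ⟨?_, hx⟩
    rw [not_le, sq_lt_sq₀ hE'.le (l2_nonneg _)] at hx2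
    exact (mul_le_mul_of_nonneg_left hx2.le hg.le).trans (hG _)

end RandomMatrix

/-! ### Singular pairs are not close to sparse vectors -/

/-- The equations satisfied by a pair of singular vectors. The invertible matrices `B` and `B'` make
room for a deterministic covariance and keep the equations symmetric under transposition. -/
structure SingularSystem {ι κ : Type*} [Fintype ι] [Fintype κ] (M : Matrix ι κ ℝ)
    (B : Matrix ι ι ℝ) (B' : Matrix κ κ ℝ) (y : ι → ℝ) (z : κ → ℝ) (σ : ℝ) : Prop where
  left : M *ᵥ z = σ • (B *ᵥ y)
  right : Mᵀ *ᵥ y = σ • (B' *ᵥ z)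

/-- The vector `z` is within Euclidean distance `ε` of a vector with at most `k` nonzero
coordinates. -/
def NearSparse {κ : Type*} [Fintype κ] [DecidableEq κ] (z : κ → ℝ) (k ε : ℝ) : Prop :=
  ∃ J : Finset κ, (J.card : ℝ) ≤ k ∧ ∑ j ∈ Jᶜ, z j ^ 2 ≤ ε ^ 2

section Compressible

lemma measure_biUnion_le_ofReal {α β : Type*} [MeasurableSpace α] {ν : Measure α} (S : Finset β)
    (E : β → Set α) (B : ℝ) (h : ∀ p ∈ S, ν (E p) ≤ ENNReal.ofReal B) :
    ν (⋃ p ∈ S, E p) ≤ ENNReal.ofReal (S.card * B) := by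
  refine (measure_biUnion_finset_le _ _).trans ((Finset.sum_le_card_nsmul _ _ _ h).trans ?_)
  rw [nsmul_eq_mul, ENNReal.ofReal_mul (Nat.cast_nonneg _), ENNReal.ofReal_natCast]

lemma finite_weighted_l1 {ι : Type*} [Fintype ι] (s : ι → ℝ) (hs : ∀ i, 0 < s i) (T : ℝ) :
    {r : ι → ℤ | ∑ i, s i * |(r i : ℝ)| ≤ T}.Finite := by
  classical
  refine Set.Finite.subset (Fintype.piFinset fun i => Finset.Icc (-⌈T / s i⌉) ⌈T / s i⌉).finite_toSet
    fun r hr => ?_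
  rw [Finset.mem_coe, Fintype.mem_piFinset]
  intro i
  have h1 : s i * |(r i : ℝ)| ≤ T :=
    (Finset.single_le_sum (f := fun i => s i * |(r i : ℝ)|)
      (fun j _ => mul_nonneg (hs j).le (abs_nonneg _)) (Finset.mem_univ i)).trans hr
  have h2 : |(r i : ℝ)| ≤ (⌈T / s i⌉ : ℤ) := by
    refine le_trans ?_ (Int.le_ceil _)
    rw [le_div_iff₀ (hs i)]
    linarith
  rw [abs_le] at h2
  rw [Finset.mem_Icc]
  exact ⟨by exact_mod_cast h2.1, by exact_mod_cast h2.2⟩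

lemma abs_sub_mul_round_le {h : ℝ} (hh : 0 < h) (x : ℝ) : |x - h * round (x / h)| ≤ h / 2 := by
  have h1 := abs_sub_round (x / h)
  have h2 : x - h * round (x / h) = h * (x / h - round (x / h)) := by field_simp
  rw [h2, abs_mul, abs_of_pos hh]
  nlinarith

lemma abs_round_div_le {h : ℝ} (hh : 0 < h) (x : ℝ) : |(round (x / h) : ℝ)| ≤ |x| / h + 1 / 2 := by
  have h1 := abs_sub_round (x / h)
  have h2 := abs_sub_abs_le_abs_sub ((round (x / h) : ℤ) : ℝ) (x / h)
  rw [abs_sub_comm] at h2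
  rw [abs_div, abs_of_pos hh] at h2
  linarith

/-- A nearly sparse vector is close to a sparse vector with coordinates in a lattice. -/
lemma NearSparse.exists_lattice {κ : Type*} [Fintype κ] [DecidableEq κ] {z : κ → ℝ}
    {n η ε L : ℝ} (hn : 0 < n) (hκ : (Fintype.card κ : ℝ) ≤ n) (hη : 0 < η) (hη1 : η ≤ 1)
    (hε : 0 < ε) (hεL : ε ≤ L) (hL : l2 z ≤ L) (hz : NearSparse z (η * n) ε) :
    ∃ r : κ → ℤ, (((Finset.univ.filter fun j => r j ≠ 0).card : ℕ) : ℝ) ≤ η * n ∧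
      ∑ j, |(r j : ℝ)| ≤ 2 * √η * L * n / ε ∧
      l2 (z - fun j => ε / √n * (r j : ℝ)) ≤ 2 * ε := by
  obtain ⟨J, hJ, hzJ⟩ := hz
  have hsn : 0 < √n := Real.sqrt_pos.2 hn
  have hn2 : √n ^ 2 = n := Real.sq_sqrt hn.le
  set h := ε / √n with hh
  have hh0 : 0 < h := by positivity
  set r : κ → ℤ := fun j => if j ∈ J then round (z j / h) else 0 with hr
  refine ⟨r, ?_, ?_, ?_⟩
  · refine le_trans ?_ hJ
    have : (Finset.univ.filter fun j => r j ≠ 0) ⊆ J := fun j hj => by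
      rw [Finset.mem_filter] at hj
      by_contra hjJ
      exact hj.2 (by simp [hr, hjJ])
    exact_mod_cast Finset.card_le_card this
  · have h1 : ∑ j, |(r j : ℝ)| = ∑ j ∈ J, |(round (z j / h) : ℝ)| := by
      rw [← Finset.sum_subset (Finset.subset_univ J)]
      · refine Finset.sum_congr rfl fun j hj => ?_
        simp [hr, hj]
      · intro j _ hj
        simp [hr, hj]
    have h2 : ∑ j ∈ J, |(round (z j / h) : ℝ)| ≤ (∑ j ∈ J, |z j|) / h + J.card / 2 := by
      refine (Finset.sum_le_sum fun j _ => abs_round_div_le hh0 (z j)).trans (le_of_eq ?_)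
      rw [Finset.sum_add_distrib, ← Finset.sum_div, Finset.sum_const, nsmul_eq_mul]
      ring
    have h3 : ∑ j ∈ J, |z j| ≤ √(η * n) * L := by
      refine (sum_abs_le_sqrt_card_mul J z).trans ?_
      have : √(∑ i ∈ J, z i ^ 2) ≤ L := by
        refine Real.sqrt_le_iff.2 ⟨(l2_nonneg z).trans hL, ?_⟩
        calc ∑ i ∈ J, z i ^ 2 ≤ ∑ i, z i ^ 2 :=
              Finset.sum_le_univ_sum_of_nonneg fun i => sq_nonneg _
          _ = l2 z ^ 2 := (l2_sq z).symm
          _ ≤ L ^ 2 := pow_le_pow_left₀ (l2_nonneg z) hL 2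
      exact mul_le_mul (Real.sqrt_le_sqrt hJ) this (Real.sqrt_nonneg _) (Real.sqrt_nonneg _)
    rw [Real.sqrt_mul hη.le] at h3
    have hs1 : √η ≤ 1 := Real.sqrt_le_one.2 hη1
    have hs2 : √η ^ 2 = η := Real.sq_sqrt hη.le
    have hs0 : 0 < √η := Real.sqrt_pos.2 hη
    have h4 : (∑ j ∈ J, |z j|) / h ≤ √η * L * n / ε := by
      rw [hh, div_div_eq_mul_div]
      refine div_le_div_of_nonneg_right ?_ hε.le
      calc (∑ j ∈ J, |z j|) * √n ≤ (√η * √n * L) * √n := mul_le_mul_of_nonneg_right h3 hsn.le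
        _ = √η * L * √n ^ 2 := by ring
        _ = _ := by rw [hn2]
    have h5 : (J.card : ℝ) / 2 ≤ √η * L * n / ε := by
      rw [le_div_iff₀ hε]
      have h6 : η * n ≤ √η * n := by nlinarith
      have h7 : (J.card : ℝ) / 2 ≤ √η * n := by
        have : (0 : ℝ) ≤ J.card := Nat.cast_nonneg _
        linarith
      calc (J.card : ℝ) / 2 * ε ≤ √η * n * ε := mul_le_mul_of_nonneg_right h7 hε.le
        _ ≤ √η * n * L := mul_le_mul_of_nonneg_left hεL (by positivity)
        _ = _ := by ring
    rw [h1]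
    calc _ ≤ √η * L * n / ε + √η * L * n / ε := by linarith
      _ = _ := by ring
  · refine l2_le_of_sq_le (by positivity) ?_
    rw [← Finset.sum_add_sum_compl J]
    have h1 : ∑ j ∈ J, (z - fun j => h * (r j : ℝ)) j ^ 2 ≤ ε ^ 2 := by
      calc ∑ j ∈ J, (z - fun j => h * (r j : ℝ)) j ^ 2 ≤ ∑ j ∈ J, h ^ 2 := by
            refine Finset.sum_le_sum fun j hj => ?_
            simp only [Pi.sub_apply, hr, hj, if_true]
            rw [← sq_abs]
            have := abs_sub_mul_round_le hh0 (z j)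
            exact pow_le_pow_left₀ (abs_nonneg _) (by linarith) 2
        _ = J.card * h ^ 2 := by rw [Finset.sum_const, nsmul_eq_mul]
        _ ≤ n * h ^ 2 := by
            refine mul_le_mul_of_nonneg_right (le_trans ?_ hκ) (sq_nonneg _)
            exact_mod_cast Finset.card_le_univ J
        _ = ε ^ 2 := by
            rw [hh, div_pow, hn2]
            field_simp
    have h2 : ∑ j ∈ Jᶜ, (z - fun j => h * (r j : ℝ)) j ^ 2 ≤ ε ^ 2 := by
      refine le_trans (le_of_eq ?_) hzJ
      refine Finset.sum_congr rfl fun j hj => ?_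
      rw [Finset.mem_compl] at hj
      simp [hr, hj]
    nlinarith [sq_nonneg ε]

section Bounds

variable {ι κ : Type*} [Fintype ι] [Fintype κ] [DecidableEq ι] [DecidableEq κ]
  {M : Matrix ι κ ℝ} {B G : Matrix ι ι ℝ} {B' : Matrix κ κ ℝ} {y : ι → ℝ} {z : κ → ℝ}
  {σ K L B₀ n : ℝ}

lemma le_l2_mulVec_of_mul_eq_one (hGB : G * B = 1) (hG : OpBound G B₀) (hB₀ : 0 < B₀) (v : ι → ℝ) :
    B₀⁻¹ * l2 v ≤ l2 (B *ᵥ v) := by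
  have h := hG (B *ᵥ v)
  rw [Matrix.mulVec_mulVec, hGB, Matrix.one_mulVec] at h
  rw [inv_mul_le_iff₀ hB₀]
  exact h

lemma SingularSystem.sigma_le (hs : SingularSystem M B B' y z σ) (hM : OpBound M (K * √n))
    (hGB : G * B = 1) (hG : OpBound G B₀) (hB₀ : 0 < B₀) (hL : 0 < L) (hK : 0 ≤ K) (hσ : 0 < σ)
    (hy : L⁻¹ ≤ l2 y) (hz : l2 z ≤ L) : σ ≤ K * L ^ 2 * B₀ * √n := by
  have h1 := hM z
  rw [hs.left, l2_smul, abs_of_pos hσ] at h1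
  have h2 := le_l2_mulVec_of_mul_eq_one hGB hG hB₀ y
  have h3 : B₀⁻¹ * L⁻¹ ≤ l2 (B *ᵥ y) :=
    (mul_le_mul_of_nonneg_left hy (inv_pos.2 hB₀).le).trans h2
  have h4 : σ * (B₀⁻¹ * L⁻¹) ≤ K * √n * L :=
    (mul_le_mul_of_nonneg_left h3 hσ.le).trans
      (h1.trans (mul_le_mul_of_nonneg_left hz (by positivity)))
  have h5 : σ = σ * (B₀⁻¹ * L⁻¹) * (B₀ * L) := by field_simp
  rw [h5]
  calc _ ≤ K * √n * L * (B₀ * L) := mul_le_mul_of_nonneg_right h4 (by positivity)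
    _ = _ := by ring

/-- Eliminating the left vector from the singular system, for an approximate right vector. -/
lemma SingularSystem.l2_quadratic_le (hs : SingularSystem M B B' y z σ)
    (hM : OpBound M (K * √n)) (hGB : G * B = 1) (hG : OpBound G B₀) (hB' : OpBound B' B₀)
    (hB₀ : 0 ≤ B₀) (hK : 0 ≤ K) (hn : 0 ≤ n) {Λ lam ε : ℝ} {z' : κ → ℝ} (hΛ : σ ^ 2 ≤ Λ * n)
    (hzz : l2 (z - z') ≤ 2 * ε) (hlam : |σ ^ 2 - lam| ≤ ε * n) (hz' : l2 z' ≤ 2 * L) (hΛ0 : 0 ≤ Λ)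
    (hε : 0 ≤ ε) :
    l2 (Mᵀ *ᵥ (G *ᵥ (M *ᵥ z')) - lam • (B' *ᵥ z'))
      ≤ B₀ * (2 * K ^ 2 + 2 * Λ + 2 * L) * (ε * n) := by
  have hq : Mᵀ *ᵥ (G *ᵥ (M *ᵥ z)) = σ ^ 2 • (B' *ᵥ z) := by
    rw [hs.left, Matrix.mulVec_smul, Matrix.mulVec_mulVec, hGB, Matrix.one_mulVec,
      Matrix.mulVec_smul, hs.right, smul_smul, sq]
  have hdec : Mᵀ *ᵥ (G *ᵥ (M *ᵥ z')) - lam • (B' *ᵥ z')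
      = (σ ^ 2 • (B' *ᵥ (z - z')) + (σ ^ 2 - lam) • (B' *ᵥ z'))
        - Mᵀ *ᵥ (G *ᵥ (M *ᵥ (z - z'))) := by
    simp only [Matrix.mulVec_sub, hq, smul_sub, sub_smul]
    abel
  rw [hdec]
  have hKn : 0 ≤ K * √n := by positivity
  have h1 : l2 (Mᵀ *ᵥ (G *ᵥ (M *ᵥ (z - z')))) ≤ K ^ 2 * n * B₀ * (2 * ε) := by
    calc _ ≤ K * √n * l2 (G *ᵥ (M *ᵥ (z - z'))) := hM.transpose hKn _
      _ ≤ K * √n * (B₀ * (K * √n * (2 * ε))) := by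
        refine mul_le_mul_of_nonneg_left ?_ hKn
        refine (hG _).trans (mul_le_mul_of_nonneg_left ?_ hB₀)
        exact (hM _).trans (mul_le_mul_of_nonneg_left hzz hKn)
      _ = K ^ 2 * (√n) ^ 2 * B₀ * (2 * ε) := by ring
      _ = _ := by rw [Real.sq_sqrt hn]
  have h2 : l2 (σ ^ 2 • (B' *ᵥ (z - z'))) ≤ Λ * n * (B₀ * (2 * ε)) := by
    rw [l2_smul, abs_of_nonneg (sq_nonneg _)]
    refine mul_le_mul hΛ ?_ (l2_nonneg _) (by positivity)
    exact (hB' _).trans (mul_le_mul_of_nonneg_left hzz hB₀)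
  have h3 : l2 ((σ ^ 2 - lam) • (B' *ᵥ z')) ≤ ε * n * (B₀ * (2 * L)) := by
    rw [l2_smul]
    refine mul_le_mul hlam ?_ (l2_nonneg _) (by positivity)
    exact (hB' _).trans (mul_le_mul_of_nonneg_left hz' hB₀)
  calc _ ≤ (Λ * n * (B₀ * (2 * ε)) + ε * n * (B₀ * (2 * L))) + K ^ 2 * n * B₀ * (2 * ε) :=
        (l2_sub_le _ _).trans (add_le_add ((l2_add_le _ _).trans (add_le_add h2 h3)) h1)
    _ = _ := by ring

end Bounds

set_option maxHeartbeats 800000 in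
/-- With overwhelming probability, no right vector of the singular system is nearly sparse. -/
theorem measure_nearSparse_le {b R c₀ K L B₀ : ℝ} (hb : 0 < b) (hR : 1 ≤ R) (hc₀ : 0 < c₀)
    (hK : 1 ≤ K) (hL : 1 ≤ L) (hB₀ : 1 ≤ B₀) :
    ∃ η ε c : ℝ, ∃ n₀ : ℕ, 0 < η ∧ η ≤ 1 ∧ 0 < ε ∧ ε ≤ 1 ∧ 0 < c ∧ ∀ n : ℕ, n₀ ≤ n →
      ∀ (ι κ : Type) [Fintype ι] [Fintype κ] [DecidableEq ι] [DecidableEq κ],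
      c₀ * n ≤ Fintype.card ι → c₀ * n ≤ Fintype.card κ → Fintype.card κ ≤ n →
      ∀ (μ : Measure ℝ) [IsProbabilityMeasure μ], IsSpreadLaw μ b R →
      ∀ (B G : Matrix ι ι ℝ) (B' : Matrix κ κ ℝ), G * B = 1 → OpBound G B₀ → OpBound B B₀ →
        OpBound B' B₀ →
      (Measure.pi fun _ : ι × κ => μ) {x | OpBound (entryMatrix x) (K * √n) ∧ ∃ y z σ, 0 < σ ∧
        SingularSystem (entryMatrix x) B B' y z σ ∧ L⁻¹ ≤ l2 y ∧ L⁻¹ ≤ l2 z ∧ l2 z ≤ L ∧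
        NearSparse z (η * n) ε} ≤ ENNReal.ofReal (Real.exp (-c * n)) := by
  have hpi := Real.pi_pos
  have hR0 : 0 < R := by linarith
  have hq0 := smallBallConst_pos (R := R) hb.le
  have hq1 := smallBallConst_lt_one hb hR0
  set q := smallBallConst b R with hq
  set t := -Real.log q with ht
  have ht0 : 0 < t := by
    have := Real.log_neg hq0 hq1
    linarith
  have hqt : ∀ N : ℕ, q ^ N = Real.exp (-(t * N)) := fun N => by
    rw [ht, neg_mul, neg_neg, mul_comm, Real.exp_nat_mul, Real.exp_log hq0]
  set Λ := (K * L ^ 2 * B₀) ^ 2 with hΛ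
  have hΛ0 : 0 ≤ Λ := sq_nonneg _
  set C2 := B₀ * (2 * K ^ 2 + 2 * Λ + 2 * L) with hC2
  have hC20 : 0 < C2 := by positivity
  set h := (2 * L)⁻¹ with hh
  have hh0 : 0 < h := by positivity
  set a := (B₀⁻¹ * R / Real.pi) ^ 2 * (t * (h * R / Real.pi) ^ 2 * c₀) with ha
  have ha0 : 0 < a := by positivity
  -- `ε` is chosen so that the discretization error is negligible for the small ball estimate.
  set ε := min (1 / (4 * L)) (√(a * t * c₀) / (2 * C2)) with hε
  have hε0 : 0 < ε := lt_min (by positivity) (by positivity)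
  have hεL : ε ≤ 1 / (4 * L) := min_le_left _ _
  have hε1 : ε ≤ 1 := hεL.trans (by rw [div_le_one (by positivity)]; linarith)
  have hε2 : (C2 * ε) ^ 2 ≤ a * t * c₀ / 4 := by
    have h1 : C2 * ε ≤ √(a * t * c₀) / 2 := by
      have := mul_le_mul_of_nonneg_left (min_le_right (1 / (4 * L)) (√(a * t * c₀) / (2 * C2))) hC20.le
      refine this.trans (le_of_eq ?_)
      field_simp
    calc (C2 * ε) ^ 2 ≤ (√(a * t * c₀) / 2) ^ 2 := pow_le_pow_left₀ (by positivity) h1 2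
      _ = _ := by rw [div_pow, Real.sq_sqrt (by positivity)]; norm_num
  -- `θ = √η` is chosen so that the number of sparse lattice vectors is at most `exp (t c₀ n / 16)`.
  set θ := min 1 (min (c₀ / 2) (t * c₀ * ε / (80 * L))) with hθ
  have hθ0 : 0 < θ := lt_min one_pos (lt_min (by positivity) (by positivity))
  have hθ1 : θ ≤ 1 := min_le_left _ _
  have hθ2 : θ ≤ c₀ / 2 := (min_le_right _ _).trans (min_le_left _ _)
  have hθ3 : θ ≤ t * c₀ * ε / (80 * L) := (min_le_right _ _).trans (min_le_right _ _)
  set N₀ := 2 * (Λ / ε + 2) with hN₀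
  have hN₀0 : 0 < N₀ := by positivity
  refine ⟨θ ^ 2, ε, t * c₀ / 8, ⌈N₀ * 16 / (t * c₀)⌉₊ + 1, by positivity, pow_le_one₀ hθ0.le hθ1, hε0,
    hε1, by positivity, ?_⟩
  clear_value q t Λ C2 h a ε θ N₀
  intro n hn ι κ _ _ _ _ hι hκ hκn μ _ hμ B G B' hGB hG hB hB'
  have hn1 : 1 ≤ n := le_trans (Nat.le_add_left _ _) hn
  have hn0 : (0 : ℝ) < n := by exact_mod_cast hn1
  have hκn' : (Fintype.card κ : ℝ) ≤ n := by exact_mod_cast hκn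
  have hB₀0 : 0 < B₀ := by linarith
  have hsq : √(θ ^ 2) = θ := Real.sqrt_sq hθ0.le
  have hsn : √(n : ℝ) ^ 2 = n := Real.sq_sqrt hn0.le
  set T := 2 * θ * L * n / ε with hT
  set A : Finset (κ → ℤ) := (finite_weighted_l1 (fun _ : κ => (1 : ℝ)) (fun _ => one_pos)
    T).toFinset.filter fun r =>
      (((Finset.univ.filter fun j => r j ≠ 0).card : ℕ) : ℝ) ≤ θ ^ 2 * n ∧
        h ≤ l2 (fun j => ε / √n * (r j : ℝ)) with hA
  set Λs : Finset ℕ := Finset.range (⌊Λ / ε⌋₊ + 2) with hΛs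
  -- The event attached to one point of the net.
  set Ev : (κ → ℤ) × ℕ → Set (ι × κ → ℝ) := fun p => {x |
    ∑ j ∈ (Finset.univ.filter fun j => p.1 j ≠ 0)ᶜ,
      (((entryMatrix x)ᵀ *ᵥ (G *ᵥ (entryMatrix x *ᵥ fun j => ε / √n * (p.1 j : ℝ)))) j
        - (ε * n * p.2 : ℝ) * (B' *ᵥ fun j => ε / √n * (p.1 j : ℝ)) j) ^ 2
      ≤ (C2 * (ε * n)) ^ 2} with hEv
  clear_value T A Λs Ev
  have hcover : {x | OpBound (entryMatrix x) (K * √n) ∧ ∃ y z σ, 0 < σ ∧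
        SingularSystem (entryMatrix x) B B' y z σ ∧ L⁻¹ ≤ l2 y ∧ L⁻¹ ≤ l2 z ∧ l2 z ≤ L ∧
        NearSparse z (θ ^ 2 * n) ε} ⊆ ⋃ p ∈ A ×ˢ Λs, Ev p := by
    rintro x ⟨hM, y, z, σ, hσ, hsys, hy, hz, hzL, hsp⟩
    have h4L : 1 / (4 * L) ≤ L := by
      rw [div_le_iff₀ (by positivity)]
      have := one_le_mul_of_one_le_of_one_le hL hL
      linarith
    obtain ⟨r, hr1, hr2, hr3⟩ := hsp.exists_lattice hn0 hκn' (by positivity) (pow_le_one₀ hθ0.le hθ1)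
      hε0 (hεL.trans h4L) hzL
    rw [hsq] at hr2
    have hσle := hsys.sigma_le hM hGB hG hB₀0 (by linarith) (by linarith) hσ hy hzL
    have hσ2 : σ ^ 2 ≤ Λ * n := by
      calc σ ^ 2 ≤ (K * L ^ 2 * B₀ * √n) ^ 2 := pow_le_pow_left₀ hσ.le hσle 2
        _ = Λ * √(n : ℝ) ^ 2 := by rw [hΛ]; ring
        _ = _ := by rw [hsn]
    set z' : κ → ℝ := fun j => ε / √n * (r j : ℝ) with hz'
    have h2ε : 2 * ε ≤ h := by
      rw [hh]
      calc 2 * ε ≤ 2 * (1 / (4 * L)) := by linarith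
        _ = _ := by field_simp; norm_num
    have hz'l : h ≤ l2 z' := by
      have h1 := l2_abs_sub_le z z'
      have h2 : L⁻¹ = h + h := by rw [hh]; field_simp; norm_num
      linarith
    have hz'u : l2 z' ≤ 2 * L := by
      have h1 := l2_abs_sub_le z' z
      rw [l2_sub_comm] at h1
      have h2 : h ≤ 1 := by
        rw [hh]
        exact inv_le_one_of_one_le₀ (by linarith)
      linarith
    set k := ⌊σ ^ 2 / (ε * n)⌋₊ with hk
    have hεn : 0 < ε * n := by positivity
    have hk1 : |σ ^ 2 - ε * n * k| ≤ ε * n := by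
      have h1 := Nat.floor_le (show 0 ≤ σ ^ 2 / (ε * n) by positivity)
      have h2 := Nat.lt_floor_add_one (σ ^ 2 / (ε * n))
      rw [le_div_iff₀ hεn] at h1
      rw [div_lt_iff₀ hεn] at h2
      rw [abs_le]
      constructor <;> linarith
    have hk2 : k ∈ Λs := by
      rw [hΛs, Finset.mem_range]
      have : k ≤ ⌊Λ / ε⌋₊ := by
        refine Nat.floor_le_floor ?_
        rw [div_le_div_iff₀ hεn hε0]
        have := mul_le_mul_of_nonneg_right hσ2 hε0.le
        linarith
      omega
    have hq2 := hsys.l2_quadratic_le hM hGB hG hB' hB₀0.le (by linarith) hn0.le hσ2 hr3 hk1 hz'u hΛ0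
      hε0.le
    simp only [Set.mem_iUnion]
    refine ⟨(r, k), ?_, ?_⟩
    · rw [Finset.mem_product]
      refine ⟨?_, hk2⟩
      rw [hA, Finset.mem_filter, Set.Finite.mem_toFinset]
      refine ⟨?_, hr1, hz'l⟩
      simpa [hT] using hr2
    · rw [hEv, Set.mem_ofPred_eq, hC2]
      refine le_trans ?_ (pow_le_pow_left₀ (l2_nonneg _) hq2 2)
      rw [l2_sq]
      exact Finset.sum_le_univ_sum_of_nonneg fun i => sq_nonneg _
  have hbound : ∀ p ∈ A ×ˢ Λs, (Measure.pi fun _ : ι × κ => μ) (Ev p)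
      ≤ ENNReal.ofReal (2 * Real.exp (-(t * c₀ / 4 * n))) := by
    intro p hp
    rw [Finset.mem_product, hA, Finset.mem_filter, Set.Finite.mem_toFinset] at hp
    obtain ⟨⟨-, hp1, hp2⟩, -⟩ := hp
    set J := Finset.univ.filter fun j => p.1 j ≠ 0 with hJ
    set E' := √(t * (h * R / Real.pi) ^ 2 * c₀ * n) with hE'
    have hE'2 : E' ^ 2 = t * (h * R / Real.pi) ^ 2 * c₀ * n := Real.sq_sqrt (by positivity)
    have hE'0 : 0 < E' := Real.sqrt_pos.2 (by positivity)
    have hmain := measure_quadratic_small_le (ι := ι) hμ (J := J)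
      (z := fun j => ε / √n * (p.1 j : ℝ)) (h := h) (g := B₀⁻¹) (E := (C2 * (ε * n)) ^ 2) (E' := E')
      (by
        intro j hj
        have : p.1 j = 0 := by simpa [hJ] using hj
        simp [this])
      hh0 (inv_pos.2 hB₀0) hE'0 hp2 G
      (fun v => le_l2_mulVec_of_mul_eq_one (mul_eq_one_comm.1 hGB) hB hB₀0 v)
      (fun j => (ε * n * p.2 : ℝ) * (B' *ᵥ fun j => ε / √n * (p.1 j : ℝ)) j)
    rw [← hq] at hmain
    rw [hEv]
    refine hmain.trans ?_
    rw [two_mul (Real.exp _), ENNReal.ofReal_add (Real.exp_pos _).le (Real.exp_pos _).le]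
    refine add_le_add (ENNReal.ofReal_le_ofReal ?_) (ENNReal.ofReal_le_ofReal ?_)
    · rw [hqt, ← Real.exp_add, Real.exp_le_exp, hE'2]
      have e1 : t * (h * R / Real.pi) ^ 2 * c₀ * n / (2 * (h * R / Real.pi) ^ 2) = t * c₀ * n / 2 := by
        field_simp
      rw [e1]
      have := mul_le_mul_of_nonneg_left hι ht0.le
      have h5 : 0 < t * c₀ * n := by positivity
      linarith
    · rw [hqt, ← Real.exp_add, Real.exp_le_exp]
      have e1 : (B₀⁻¹ * E' * R / Real.pi) ^ 2 = a * n := by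
        rw [ha, show B₀⁻¹ * E' * R / Real.pi = (B₀⁻¹ * R / Real.pi) * E' by ring, mul_pow, hE'2]
        ring
      have e2 : (C2 * (ε * n)) ^ 2 / (2 * (B₀⁻¹ * E' * R / Real.pi) ^ 2) ≤ t * c₀ * n / 8 := by
        rw [e1, div_le_iff₀ (by positivity)]
        calc (C2 * (ε * n)) ^ 2 = (C2 * ε) ^ 2 * n ^ 2 := by ring
          _ ≤ a * t * c₀ / 4 * n ^ 2 := mul_le_mul_of_nonneg_right hε2 (sq_nonneg _)
          _ = _ := by ring
      have e3 : c₀ * n / 2 ≤ ((Jᶜ).card : ℝ) := by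
        have h6 : (J.card : ℝ) + ((Jᶜ).card : ℝ) = Fintype.card κ := by
          exact_mod_cast Finset.card_add_card_compl J
        have h7 : θ ^ 2 * n ≤ c₀ / 2 * n := by
          refine mul_le_mul_of_nonneg_right ?_ hn0.le
          have := mul_le_of_le_one_right hθ0.le hθ1
          rw [sq]
          linarith
        linarith
      have := mul_le_mul_of_nonneg_left e3 ht0.le
      have h5 : 0 < t * c₀ * n := by positivity
      linarith
  have hcardA : (A.card : ℝ) ≤ Real.exp (t * c₀ / 16 * n) := by
    set s := ε / L with hs
    have hs0 : 0 < s := by positivity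
    have hs1 : s ≤ 1 := by
      rw [hs, div_le_one (by linarith)]
      linarith
    have h1 := card_sparse_l1_le A (s := s) (u := s * θ) (T := T) (k := θ ^ 2 * n) hs0 (by positivity)
      (mul_le_one₀ hs1 hθ0.le hθ1)
      (fun r hr => by
        rw [hA, Finset.mem_filter, Set.Finite.mem_toFinset] at hr
        simpa using hr.1)
      (fun r hr => by
        rw [hA, Finset.mem_filter] at hr
        exact hr.2.1)
    refine h1.trans ?_
    rw [Real.exp_le_exp]
    have e1 : s * T = 2 * θ * n := by rw [hs, hT]; field_simp
    have e2 : θ ^ 2 * n * (1 / (s * θ) - 1) ≤ θ * n / s := by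
      have : θ ^ 2 * n * (1 / (s * θ) - 1) = θ * n / s - θ ^ 2 * n := by field_simp
      rw [this]
      have : 0 ≤ θ ^ 2 * n := by positivity
      linarith
    have e3 : 2 * (s * θ) / s * (Fintype.card κ : ℝ) ≤ 2 * θ * n := by
      rw [show 2 * (s * θ) / s = 2 * θ by field_simp]
      exact mul_le_mul_of_nonneg_left hκn' (by positivity)
    have e4 : θ * n ≤ θ * n / s := by
      rw [le_div_iff₀ hs0]
      exact mul_le_of_le_one_right (by positivity) hs1
    have e5 : 5 * (θ * n / s) ≤ t * c₀ / 16 * n := by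
      rw [hs, div_div_eq_mul_div]
      have : θ * (80 * L) ≤ t * c₀ * ε := (le_div_iff₀ (by positivity)).1 hθ3
      rw [mul_div_assoc', div_le_iff₀ hε0]
      have := mul_le_mul_of_nonneg_right this hn0.le
      linarith
    linarith
  have hcardΛ : 2 * (Λs.card : ℝ) ≤ Real.exp (t * c₀ / 16 * n) := by
    rw [hΛs, Finset.card_range]
    have h1 := Nat.floor_le (show 0 ≤ Λ / ε by positivity)
    have h2 : N₀ * 16 / (t * c₀) ≤ n := by
      refine (Nat.le_ceil _).trans ?_
      exact_mod_cast (Nat.le_succ _).trans hn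
    have h3 : N₀ ≤ t * c₀ / 16 * n := by
      rw [div_le_iff₀ (by positivity)] at h2
      linarith
    have h4 := Real.add_one_le_exp (t * c₀ / 16 * n)
    push_cast
    rw [hN₀] at h3
    linarith
  calc _ ≤ (Measure.pi fun _ : ι × κ => μ) (⋃ p ∈ A ×ˢ Λs, Ev p) := measure_mono hcover
    _ ≤ ENNReal.ofReal ((A ×ˢ Λs).card * (2 * Real.exp (-(t * c₀ / 4 * n)))) :=
        measure_biUnion_le_ofReal _ _ _ hbound
    _ ≤ _ := by
        apply ENNReal.ofReal_le_ofReal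
        rw [Finset.card_product, Nat.cast_mul]
        calc (A.card * Λs.card : ℝ) * (2 * Real.exp (-(t * c₀ / 4 * n)))
            = A.card * (2 * Λs.card) * Real.exp (-(t * c₀ / 4 * n)) := by ring
          _ ≤ Real.exp (t * c₀ / 16 * n) * Real.exp (t * c₀ / 16 * n)
              * Real.exp (-(t * c₀ / 4 * n)) := by gcongr
          _ = _ := by
            rw [← Real.exp_add, ← Real.exp_add]
            congr 1
            ring

end Compressible

/-! ### Spread coordinates and arithmetic structure -/

section Spread

variable {ι : Type*} [Fintype ι] [DecidableEq ι]

/-- A vector that is not nearly sparse has a proportional number of coordinates of order `n ^ (-1/2)`. -/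
lemma exists_spread {z : ι → ℝ} {n η ε L : ℝ} (hn : 0 < n) (hι : (Fintype.card ι : ℝ) ≤ n)
    (hη : 0 < η) (hε : 0 < ε) (hL : 0 < L) (hz : l2 z ≤ L) (hsp : ¬ NearSparse z (η * n) ε) :
    ∃ S : Finset ι, ε ^ 2 / (2 * (L / √η) ^ 2) * n ≤ S.card ∧
      ∀ i ∈ S, ε / 2 / √n ≤ |z i| ∧ |z i| ≤ L / √η / √n := by
  set c₂ := L / √η with hc₂
  have hsη : √η ^ 2 = η := Real.sq_sqrt hη.le
  have hsn : √n ^ 2 = n := Real.sq_sqrt hn.le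
  have hsη0 : 0 < √η := Real.sqrt_pos.2 hη
  have hsn0 : 0 < √n := Real.sqrt_pos.2 hn
  have hc₂0 : 0 < c₂ := by positivity
  set J := Finset.univ.filter fun i => c₂ / √n < |z i| with hJ
  have hJc : (J.card : ℝ) ≤ η * n := by
    have h1 : (J.card : ℝ) * (c₂ / √n) ^ 2 ≤ L ^ 2 := by
      calc (J.card : ℝ) * (c₂ / √n) ^ 2 = ∑ i ∈ J, (c₂ / √n) ^ 2 := by
            rw [Finset.sum_const, nsmul_eq_mul]
        _ ≤ ∑ i ∈ J, z i ^ 2 := by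
            refine Finset.sum_le_sum fun i hi => ?_
            rw [hJ, Finset.mem_filter] at hi
            rw [← sq_abs (z i)]
            exact pow_le_pow_left₀ (by positivity) hi.2.le 2
        _ ≤ ∑ i, z i ^ 2 := Finset.sum_le_univ_sum_of_nonneg fun i => sq_nonneg _
        _ = l2 z ^ 2 := (l2_sq z).symm
        _ ≤ L ^ 2 := pow_le_pow_left₀ (l2_nonneg z) hz 2
    have h2 : (c₂ / √n) ^ 2 = L ^ 2 / (η * n) := by
      rw [div_pow, hc₂, div_pow, hsη, hsn, div_div]
    rw [h2, mul_div_assoc', div_le_iff₀ (by positivity), mul_comm] at h1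
    exact le_of_mul_le_mul_left h1 (by positivity)
  have hlarge : ε ^ 2 < ∑ i ∈ Jᶜ, z i ^ 2 := by
    by_contra h
    exact hsp ⟨J, hJc, not_lt.1 h⟩
  set S := (Jᶜ).filter fun i => ε / 2 / √n ≤ |z i| with hS
  refine ⟨S, ?_, fun i hi => ?_⟩
  · have h1 : ∑ i ∈ Jᶜ with ¬ (ε / 2 / √n ≤ |z i|), z i ^ 2 ≤ ε ^ 2 / 4 := by
      calc _ ≤ ∑ i ∈ Jᶜ with ¬ (ε / 2 / √n ≤ |z i|), (ε / 2 / √n) ^ 2 := by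
            refine Finset.sum_le_sum fun i hi => ?_
            rw [Finset.mem_filter, not_le] at hi
            rw [← sq_abs (z i)]
            exact pow_le_pow_left₀ (abs_nonneg _) hi.2.le 2
        _ ≤ n * (ε / 2 / √n) ^ 2 := by
            rw [Finset.sum_const, nsmul_eq_mul]
            refine mul_le_mul_of_nonneg_right (le_trans ?_ hι) (sq_nonneg _)
            exact_mod_cast Finset.card_le_univ _
        _ = ε ^ 2 / 4 := by
            rw [div_pow, hsn]
            field_simp
            norm_num
    have h2 : ∑ i ∈ S, z i ^ 2 ≤ S.card * (c₂ / √n) ^ 2 := by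
      rw [← nsmul_eq_mul, ← Finset.sum_const]
      refine Finset.sum_le_sum fun i hi => ?_
      rw [hS, Finset.mem_filter, Finset.mem_compl, hJ, Finset.mem_filter, not_and, not_lt] at hi
      rw [← sq_abs (z i)]
      exact pow_le_pow_left₀ (abs_nonneg _) (hi.1 (Finset.mem_univ _)) 2
    rw [← Finset.sum_filter_add_sum_filter_not _ (fun i => ε / 2 / √n ≤ |z i|), ← hS] at hlarge
    have h3 : ε ^ 2 / 2 ≤ S.card * (c₂ / √n) ^ 2 := by nlinarith [sq_nonneg ε]
    rw [div_pow, hsn, mul_div_assoc', le_div_iff₀ hn] at h3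
    rw [div_mul_eq_mul_div, div_le_iff₀ (by positivity)]
    linarith
  · rw [hS, Finset.mem_filter, Finset.mem_compl, hJ, Finset.mem_filter, not_and, not_lt] at hi
    exact ⟨hi.2, hi.1 (Finset.mem_univ _)⟩

lemma Unstructured.anti {a : ι → ℝ} {I : Finset ι} {D D' g k : ℝ} (h : Unstructured a I D g k)
    (hD : D' ≤ D) : Unstructured a I D' g k := fun s hs hsD => h s hs (hsD.trans hD)

/-- Spread coordinates are unstructured up to a scale of order `√n`. -/
lemma unstructured_of_spread {a : ι → ℝ} {I : Finset ι} {n c₁ c₂ k : ℝ} (hn : 0 < n) (hc₁ : 0 < c₁)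
    (hc₂ : 0 < c₂) (hk : 0 ≤ k) (ha : ∀ i ∈ I, c₁ / √n ≤ |a i| ∧ |a i| ≤ c₂ / √n) :
    Unstructured a I (√n / (2 * c₂)) (c₁ * √(I.card / n)) k := by
  intro s hs hsD
  have hsn0 : 0 < √n := Real.sqrt_pos.2 hn
  have h1 : ∀ i ∈ I, (s * (c₁ / √n)) ^ 2 ≤ distInt (s * a i) ^ 2 := by
    intro i hi
    obtain ⟨hi1, hi2⟩ := ha i hi
    have h2 : |s * a i| ≤ 1 / 2 := by
      rw [abs_mul, abs_of_pos hs]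
      calc s * |a i| ≤ √n / (2 * c₂) * (c₂ / √n) := mul_le_mul hsD hi2 (abs_nonneg _) (by positivity)
        _ = 1 / 2 := by field_simp
    rw [distInt_eq_abs h2, abs_mul, abs_of_pos hs]
    exact pow_le_pow_left₀ (by positivity) (mul_le_mul_of_nonneg_left hi1 hs.le) 2
  calc (min (c₁ * √(I.card / n) * s) k) ^ 2 ≤ (c₁ * √(I.card / n) * s) ^ 2 :=
        pow_le_pow_left₀ (le_min (by positivity) hk) (min_le_left _ _) 2
    _ = ∑ i ∈ I, (s * (c₁ / √n)) ^ 2 := by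
        rw [Finset.sum_const, nsmul_eq_mul, mul_pow, mul_pow, Real.sq_sqrt (by positivity), mul_pow,
          div_pow, Real.sq_sqrt hn.le]
        ring
    _ ≤ _ := Finset.sum_le_sum h1

/-- Unstructured vectors remain so, with worse parameters, under small perturbations. -/
lemma Unstructured.perturb {a a' : ι → ℝ} {I : Finset ι} {D g k : ℝ}
    (h : Unstructured a I D g k) (hD : 0 < D) (hg : 0 < g) (hk : 0 < k) (hkD : k ≤ 2 * g * D)
    (ha : l2 (a - a') ≤ k / (4 * D)) : Unstructured a' I D (g / 2) (k / 2) := by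
  intro s hs hsD
  have hmin : min (g / 2 * s) (k / 2) = min (g * s) k / 2 := by
    rcases le_total (g * s) k with h1 | h1
    · rw [min_eq_left h1, min_eq_left (by linarith)]; ring
    · rw [min_eq_right h1, min_eq_right (by linarith)]
  have hmin0 : 0 < min (g * s) k := lt_min (by positivity) hk
  -- Minkowski's inequality for the distances to the lattice
  set f : ι → ℝ := fun i => if i ∈ I then distInt (s * a i) else 0 with hf
  set f' : ι → ℝ := fun i => if i ∈ I then distInt (s * a' i) else 0 with hf'
  have hfs : l2 f ^ 2 = ∑ i ∈ I, distInt (s * a i) ^ 2 := by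
    rw [l2_sq, ← Finset.sum_subset (Finset.subset_univ I)]
    · exact Finset.sum_congr rfl fun i hi => by simp [hf, hi]
    · intro i _ hi; simp [hf, hi]
  have hfs' : l2 f' ^ 2 = ∑ i ∈ I, distInt (s * a' i) ^ 2 := by
    rw [l2_sq, ← Finset.sum_subset (Finset.subset_univ I)]
    · exact Finset.sum_congr rfl fun i hi => by simp [hf', hi]
    · intro i _ hi; simp [hf', hi]
  have hdiff : l2 (f - f') ≤ s * l2 (a - a') := by
    refine l2_le_of_sq_le (mul_nonneg hs.le (l2_nonneg _)) ?_
    rw [mul_pow, l2_sq, Finset.mul_sum]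
    refine Finset.sum_le_sum fun i _ => ?_
    rw [← sq_abs, ← mul_pow, ← sq_abs (s * _)]
    refine pow_le_pow_left₀ (abs_nonneg _) ?_ 2
    simp only [Pi.sub_apply, hf, hf']
    split_ifs
    · have h1 := distInt_sub_le (s * a i) (s * a' i)
      have h2 := distInt_sub_le (s * a' i) (s * a i)
      rw [abs_sub_comm] at h2
      rw [mul_sub, abs_le]
      constructor <;> linarith
    · rw [sub_zero, abs_zero]
      exact abs_nonneg _
  have h1 : min (g * s) k ≤ l2 f := by
    rw [← sq_le_sq₀ hmin0.le (l2_nonneg _), hfs]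
    exact h s hs hsD
  have h2 : s * l2 (a - a') ≤ min (g * s) k / 2 := by
    have h3 : s * l2 (a - a') ≤ s * (k / (4 * D)) := mul_le_mul_of_nonneg_left ha hs.le
    have h4 : k / (4 * D) ≤ g / 2 := by rw [div_le_iff₀ (by positivity)]; linarith
    have h5 : s * (k / (4 * D)) ≤ g * s / 2 := by nlinarith
    have h6 : s * (k / (4 * D)) ≤ k / 2 := by
      calc s * (k / (4 * D)) ≤ D * (k / (4 * D)) := mul_le_mul_of_nonneg_right hsD (by positivity)
        _ = k / 4 := by field_simp
        _ ≤ k / 2 := by linarith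
    rw [le_div_iff₀ two_pos]
    refine le_min ?_ ?_ <;> linarith
  have h3 := l2_abs_sub_le f f'
  rw [hmin, ← hfs']
  refine pow_le_pow_left₀ (by positivity) ?_ 2
  linarith

/-- A block of spread coordinates that is structured at scale `2 * D` is close to a rational vector with
a denominator `θ` of order at most `D`. -/
lemma exists_rational_of_not_unstructured {a : ι → ℝ} {I : Finset ι} {n c₁ c₂ D k : ℝ} (hn : 0 < n)
    (hI : (I.card : ℝ) ≤ n) (hc₁ : 0 < c₁) (hc₂ : 0 < c₂) (hk : 0 ≤ k) (hck : c₂ ≤ k)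
    (ha : ∀ i ∈ I, c₁ / √n ≤ |a i| ∧ |a i| ≤ c₂ / √n)
    (h : ¬ Unstructured a I (2 * D) (c₁ * √(I.card / n)) k) :
    ∃ θ : ℕ, √n / (2 * c₂) ≤ θ ∧ (θ : ℝ) ≤ 2 * D + 1 ∧ ∃ p : ι → ℤ,
      (∀ i ∈ I, |(p i : ℝ)| ≤ 2 * c₂ * θ / √n) ∧
      ∑ i ∈ I, (a i - p i / θ) ^ 2 ≤ (2 * k / θ) ^ 2 := by
  have hsn0 : 0 < √n := Real.sqrt_pos.2 hn
  unfold Unstructured at h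
  push Not at h
  obtain ⟨s, hs, hsD, hlt⟩ := h
  have hs2 : √n / (2 * c₂) < s := by
    by_contra hcon
    exact absurd hlt (not_lt.2 (unstructured_of_spread hn hc₁ hc₂ hk ha s hs (not_lt.1 hcon)))
  have hθ1 : s ≤ ⌈s⌉₊ := Nat.le_ceil s
  have hθ2 : (⌈s⌉₊ : ℝ) < s + 1 := Nat.ceil_lt_add_one hs.le
  have hθ0 : (0 : ℝ) < ⌈s⌉₊ := hs.trans_le hθ1
  -- Replacing the frequency `s` by an integer `θ` changes `s • a` on `I` by at most `c₂ ≤ k`, because the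
  -- coordinates are at most `c₂ / √n`.
  refine ⟨⌈s⌉₊, hs2.le.trans hθ1, by linarith, fun i => round (s * a i), fun i hi => ?_, ?_⟩
  · have h1 := abs_sub_round (s * a i)
    have h2 := abs_sub_abs_le_abs_sub ((round (s * a i) : ℤ) : ℝ) (s * a i)
    rw [abs_sub_comm] at h2
    have h3 : |s * a i| ≤ ⌈s⌉₊ * (c₂ / √n) := by
      rw [abs_mul, abs_of_pos hs]
      exact mul_le_mul hθ1 (ha i hi).2 (abs_nonneg _) (by positivity)
    have h4 : 1 / 2 ≤ ⌈s⌉₊ * (c₂ / √n) := by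
      calc 1 / 2 = √n / (2 * c₂) * (c₂ / √n) := by field_simp
        _ ≤ _ := mul_le_mul_of_nonneg_right (hs2.le.trans hθ1) (by positivity)
    calc |((round (s * a i) : ℤ) : ℝ)| ≤ 2 * (⌈s⌉₊ * (c₂ / √n)) := by linarith
      _ = _ := by ring
  · set θ : ℝ := (⌈s⌉₊ : ℝ)
    set u : ι → ℝ := fun i => if i ∈ I then s * a i - round (s * a i) else 0 with hu
    set v : ι → ℝ := fun i => if i ∈ I then (θ - s) * a i else 0 with hv
    have hu2 : l2 u ≤ k := by
      refine l2_le_of_sq_le hk ?_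
      rw [← Finset.sum_subset (Finset.subset_univ I)]
      · refine le_trans (le_of_eq ?_) (hlt.le.trans ?_)
        · refine Finset.sum_congr rfl fun i hi => ?_
          simp only [hu, hi, if_true]
          rw [distInt, sq_abs]
        · exact pow_le_pow_left₀ (le_min (by positivity) hk) (min_le_right _ _) 2
      · intro i _ hi; simp [hu, hi]
    have hv2 : l2 v ≤ k := by
      refine (l2_le_of_sq_le hc₂.le ?_).trans hck
      rw [← Finset.sum_subset (Finset.subset_univ I)]
      · calc ∑ i ∈ I, v i ^ 2 ≤ ∑ i ∈ I, (c₂ / √n) ^ 2 := by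
              refine Finset.sum_le_sum fun i hi => ?_
              simp only [hv, hi, if_true]
              rw [← sq_abs, abs_mul]
              refine pow_le_pow_left₀ (by positivity) ?_ 2
              have : |θ - s| ≤ 1 := by rw [abs_le]; constructor <;> linarith
              calc |θ - s| * |a i| ≤ 1 * (c₂ / √n) :=
                    mul_le_mul this (ha i hi).2 (abs_nonneg _) zero_le_one
                _ = _ := one_mul _
          _ ≤ n * (c₂ / √n) ^ 2 := by
              rw [Finset.sum_const, nsmul_eq_mul]
              exact mul_le_mul_of_nonneg_right hI (sq_nonneg _)
          _ = c₂ ^ 2 := by rw [div_pow, Real.sq_sqrt hn.le]; field_simp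
      · intro i _ hi; simp [hv, hi]
    have huv : l2 (u + v) ≤ 2 * k := (l2_add_le u v).trans (by linarith)
    have hsum : ∑ i ∈ I, (a i - round (s * a i) / θ) ^ 2 = l2 (u + v) ^ 2 / θ ^ 2 := by
      rw [l2_sq, ← Finset.sum_subset (Finset.subset_univ I), Finset.sum_div]
      · refine Finset.sum_congr rfl fun i hi => ?_
        simp only [Pi.add_apply, hu, hv, hi, if_true]
        field_simp
        ring
      · intro i _ hi; simp [hu, hv, hi]
    rw [hsum, div_pow]
    exact div_le_div_of_nonneg_right (pow_le_pow_left₀ (l2_nonneg _) huv 2) (by positivity)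

end Spread

/-! ### Nets for structured vectors -/

section Nets

variable {ι : Type*} [Fintype ι] [DecidableEq ι]

/-- The coordinates of color `a` in a partial coloring `χ`. -/
def colorClass {ι : Type*} [Fintype ι] {q : ℕ} (χ : ι → Option (Fin q)) (a : Fin q) : Finset ι :=
  Finset.univ.filter fun i => χ i = some a

lemma sum_eq_sum_colorClass {q : ℕ} (χ : ι → Option (Fin q)) (f : ι → ℝ) :
    ∑ i, f i = ∑ i with χ i = none, f i + ∑ a, ∑ i ∈ colorClass χ a, f i := by
  rw [← Finset.sum_fiberwise Finset.univ χ f, Fintype.sum_option]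
  rfl

lemma card_colored {q m : ℕ} (χ : ι → Option (Fin q)) (hm : ∀ a, (colorClass χ a).card = m) :
    (Finset.univ.filter fun i => χ i ≠ none).card = q * m := by
  have h := Finset.card_eq_sum_card_fiberwise (f := χ) (s := Finset.univ.filter fun i => χ i ≠ none)
    (t := Finset.univ.image (some : Fin q → Option (Fin q))) (by
      intro i hi
      rw [Finset.mem_coe, Finset.mem_filter] at hi
      obtain ⟨a, ha⟩ := Option.ne_none_iff_exists'.1 hi.2
      rw [Finset.mem_coe, ha]
      exact Finset.mem_image_of_mem _ (Finset.mem_univ _))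
  rw [h, Finset.sum_image (fun a _ b _ hab => Option.some.inj hab)]
  have : ∀ a : Fin q, ((Finset.univ.filter fun i => χ i ≠ none).filter fun i => χ i = some a).card
      = m := by
    intro a
    rw [← hm a, Finset.filter_filter]
    congr 1
    ext i
    simp only [Finset.mem_filter, Finset.mem_univ, true_and, colorClass]
    constructor
    · exact fun h => h.2
    · exact fun h => ⟨by rw [h]; exact Option.some_ne_none a, h⟩
  simp [this]

/-- Net for vectors whose blocks are close to rational vectors with given denominators `θ a`. A block
coordinate costs a factor of order `D / √m`, every other coordinate a factor of order `D`. -/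
lemma exists_net_of_denominators {q m : ℕ} {n D k L c₂ : ℝ} (χ : ι → Option (Fin q)) (θ : Fin q → ℕ)
    (hn : 0 < n) (hι : (Fintype.card ι : ℝ) ≤ n) (hm : ∀ a, (colorClass χ a).card = m) (hm1 : 1 ≤ m)
    (hmn : (m : ℝ) ≤ n) (hD : 1 ≤ D) (hk : 1 ≤ k) (hL : 1 ≤ L) (hc₂ : 1 ≤ c₂)
    (hθ1 : ∀ a, √n / (2 * c₂) ≤ θ a) (hθ2 : ∀ a, (θ a : ℝ) ≤ 2 * D + 1) :
    ∃ N : Finset (ι → ℝ), (N.card : ℝ) ≤ Real.exp (2 * n) *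
        ((630 * c₂ * L * D) ^ Fintype.card ι * (1 / √m) ^ (q * m)) ∧
      ∀ y : ι → ℝ, l2 y ≤ L →
        (∀ a, ∃ p : ι → ℤ, (∀ i ∈ colorClass χ a, |(p i : ℝ)| ≤ 2 * c₂ * θ a / √n) ∧
          ∑ i ∈ colorClass χ a, (y i - p i / θ a) ^ 2 ≤ (2 * k / θ a) ^ 2) →
        ∃ y' ∈ N, l2 (y - y') ≤ k / (4 * D) := by
  classical
  have hsn0 : 0 < √n := Real.sqrt_pos.2 hn
  have hsn2 : √n ^ 2 = n := Real.sq_sqrt hn.le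
  have hm0 : (0 : ℝ) < m := by exact_mod_cast hm1
  have hsm0 : 0 < √(m : ℝ) := Real.sqrt_pos.2 hm0
  have hsm2 : √(m : ℝ) ^ 2 = m := Real.sq_sqrt hm0.le
  have hsmn : √(m : ℝ) ≤ √n := Real.sqrt_le_sqrt hmn
  have hD0 : 0 < D := by linarith
  have hk0 : 0 < k := by linarith
  have hθ0 : ∀ a, (0 : ℝ) < θ a := fun a => lt_of_lt_of_le (by positivity) (hθ1 a)
  -- The net consists of the vectors `p / θ a + h r` on the block `a` and `h r` outside of the blocks, with
  -- integer `p` and `r`. Rounding to the lattice of mesh `h` moves a vector by at most `h √n / 2`, which is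
  -- `k / (4 D)`.
  set h := k / (2 * D * √n) with hh
  have hh0 : 0 < h := by positivity
  -- weights of the lattice correction, and the box containing the numerators
  set s : ι → ℝ := fun i => (χ i).elim (1 / (3 * L * D)) fun a => √(m : ℝ) / √n * θ a / (6 * D) with hs
  have hs0 : ∀ i, 0 < s i := by
    intro i
    simp only [hs]
    cases hi : χ i with
    | none => simp only [Option.elim]; positivity
    | some a => simp only [Option.elim]; have := hθ0 a; positivity
  set P : Finset (ι → ℤ) := Fintype.piFinset fun i => (χ i).elim {0} fun a =>
    Finset.Icc (-⌊2 * c₂ * θ a / √n⌋) ⌊2 * c₂ * θ a / √n⌋ with hP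
  set Q : Finset (ι → ℤ) := (finite_weighted_l1 s hs0 (2 * n)).toFinset with hQ
  set V : (ι → ℤ) × (ι → ℤ) → ι → ℝ := fun pr i =>
    (pr.1 i : ℝ) / ((χ i).elim 1 θ : ℕ) + h * pr.2 i with hV
  refine ⟨(P ×ˢ Q).image V, ?_, ?_⟩
  · have h1 : (((P ×ˢ Q).image V).card : ℝ) ≤ P.card * Q.card := by
      exact_mod_cast Finset.card_image_le.trans (Finset.card_product P Q).le
    have h2 : (Q.card : ℝ) ≤ Real.exp (2 * n) * ∏ i, (1 + 2 / s i) :=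
      card_weighted_l1_le Q s hs0 (2 * n) fun r hr => by
        rw [hQ, Set.Finite.mem_toFinset] at hr
        exact hr
    have h3 : (P.card : ℝ) = ∏ i, (((χ i).elim {0} fun a =>
        Finset.Icc (-⌊2 * c₂ * θ a / √n⌋) ⌊2 * c₂ * θ a / √n⌋ : Finset ℤ).card : ℝ) := by
      rw [hP, Fintype.card_piFinset]
      push_cast
      rfl
    have h4 : ∀ i, (((χ i).elim {0} fun a =>
        Finset.Icc (-⌊2 * c₂ * θ a / √n⌋) ⌊2 * c₂ * θ a / √n⌋ : Finset ℤ).card : ℝ) * (1 + 2 / s i)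
        ≤ (630 * c₂ * L * D) * (if χ i ≠ none then 1 / √m else 1) := by
      intro i
      simp only [hs]
      cases hi : χ i with
      | none =>
        simp only [Option.elim, Finset.card_singleton, Nat.cast_one, one_mul, ne_eq,
          not_true_eq_false, if_false, mul_one]
        rw [div_div_eq_mul_div, div_one]
        have h5 : 1 ≤ L * D := one_le_mul_of_one_le_of_one_le hL hD
        have h6 : L * D ≤ c₂ * (L * D) := le_mul_of_one_le_left (by linarith) hc₂
        linarith
      | some a =>
        simp only [Option.elim, ne_eq, reduceCtorEq, not_false_eq_true, if_true]
        have ht0 := hθ0 a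
        set w := 2 * c₂ * θ a / √n with hw
        have hw1 : 1 ≤ w := by
          rw [hw, le_div_iff₀ hsn0, one_mul]
          have := (div_le_iff₀ (by positivity)).1 (hθ1 a)
          linarith
        have h5 : ((Finset.Icc (-⌊w⌋) ⌊w⌋).card : ℝ) ≤ 3 * w := by
          rw [Int.card_Icc]
          have h6 : (0 : ℤ) ≤ ⌊w⌋ := Int.floor_nonneg.2 (by linarith)
          have h7 : ((⌊w⌋ + 1 - -⌊w⌋).toNat : ℝ) = 2 * (⌊w⌋ : ℝ) + 1 := by
            have : ((⌊w⌋ + 1 - -⌊w⌋).toNat : ℤ) = 2 * ⌊w⌋ + 1 := by omega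
            exact_mod_cast this
          rw [h7]
          have := Int.floor_le w
          linarith
        have h6 : 1 + 2 / (√(m : ℝ) / √n * θ a / (6 * D)) ≤ 15 * D * √n / (√(m : ℝ) * θ a) := by
          have h7 : 2 / (√(m : ℝ) / √n * θ a / (6 * D)) = 12 * D * √n / (√(m : ℝ) * θ a) := by
            field_simp
            norm_num
          have h8 : 1 ≤ 3 * D * √n / (√(m : ℝ) * θ a) := by
            rw [le_div_iff₀ (by positivity), one_mul]
            calc √(m : ℝ) * θ a ≤ √n * (3 * D) :=
                  mul_le_mul hsmn ((hθ2 a).trans (by linarith)) ht0.le hsn0.le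
              _ = _ := by ring
          rw [h7]
          calc 1 + 12 * D * √n / (√(m : ℝ) * θ a)
              ≤ 3 * D * √n / (√(m : ℝ) * θ a) + 12 * D * √n / (√(m : ℝ) * θ a) := by linarith
            _ = _ := by ring
        calc _ ≤ 3 * w * (15 * D * √n / (√(m : ℝ) * θ a)) :=
              mul_le_mul h5 h6 (by positivity) (by positivity)
          _ = 90 * c₂ * D * (1 / √m) := by rw [hw]; field_simp; norm_num
          _ ≤ 630 * c₂ * L * D * (1 / √m) := by
            refine mul_le_mul_of_nonneg_right ?_ (by positivity)
            have h9 : c₂ * D ≤ L * (c₂ * D) := le_mul_of_one_le_left (by positivity) hL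
            have h10 : 0 < c₂ * D := by positivity
            linarith
    calc _ ≤ (P.card : ℝ) * Q.card := h1
      _ ≤ P.card * (Real.exp (2 * n) * ∏ i, (1 + 2 / s i)) :=
          mul_le_mul_of_nonneg_left h2 (Nat.cast_nonneg _)
      _ = Real.exp (2 * n) * ∏ i, ((((χ i).elim {0} fun a =>
        Finset.Icc (-⌊2 * c₂ * θ a / √n⌋) ⌊2 * c₂ * θ a / √n⌋ : Finset ℤ).card : ℝ) *
          (1 + 2 / s i)) := by
          rw [h3, Finset.prod_mul_distrib]
          ring
      _ ≤ Real.exp (2 * n) * ∏ i, ((630 * c₂ * L * D) * (if χ i ≠ none then 1 / √m else 1)) := by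
          refine mul_le_mul_of_nonneg_left (Finset.prod_le_prod (fun i _ => ?_) fun i _ => h4 i)
            (Real.exp_pos _).le
          have := hs0 i
          positivity
      _ = _ := by
          rw [Finset.prod_mul_distrib, Finset.prod_const, Finset.card_univ, Finset.prod_ite,
            Finset.prod_const, Finset.prod_const_one, mul_one, card_colored χ hm]
  · intro y hy hstr
    choose p hp1 hp2 using hstr
    set p' : ι → ℤ := fun i => (χ i).elim 0 fun a => p a i with hp'
    set e : ι → ℝ := fun i => y i - (p' i : ℝ) / ((χ i).elim 1 θ : ℕ) with he
    set r : ι → ℤ := fun i => round (e i / h) with hr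
    have hcol : ∀ a, ∀ i ∈ colorClass χ a, χ i = some a := fun a i hi => by
      rw [colorClass, Finset.mem_filter] at hi
      exact hi.2
    refine ⟨V (p', r), Finset.mem_image_of_mem _ (Finset.mem_product.2 ⟨?_, ?_⟩), ?_⟩
    · rw [hP, Fintype.mem_piFinset]
      intro i
      simp only [hp']
      cases hi : χ i with
      | none => simp [Option.elim]
      | some a =>
        simp only [Option.elim]
        have h1 := hp1 a i (by simp [colorClass, hi])
        rw [abs_le] at h1
        rw [Finset.mem_Icc]
        refine ⟨?_, Int.le_floor.2 h1.2⟩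
        rw [neg_le]
        apply Int.le_floor.2
        push_cast
        linarith
    · rw [hQ, Set.Finite.mem_toFinset]
      change ∑ i, s i * |(r i : ℝ)| ≤ 2 * n
      rw [sum_eq_sum_colorClass χ]
      have hnone : ∑ i with χ i = none, s i * |(r i : ℝ)| ≤ n := by
        calc ∑ i with χ i = none, s i * |(r i : ℝ)|
            ≤ ∑ i with χ i = none, (1 / (3 * L * D)) * (|y i| / h + 1 / 2) := by
              refine Finset.sum_le_sum fun i hi => ?_
              rw [Finset.mem_filter] at hi
              simp only [hs, hr, he, hp', hi.2, Option.elim]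
              refine mul_le_mul_of_nonneg_left ?_ (by positivity)
              have := abs_round_div_le hh0 (y i - ((0 : ℤ) : ℝ) / ((1 : ℕ) : ℝ))
              simpa using this
          _ ≤ ∑ i, (1 / (3 * L * D)) * (|y i| / h + 1 / 2) :=
              Finset.sum_le_univ_sum_of_nonneg fun i => by positivity
          _ = (1 / (3 * L * D)) * ((∑ i, |y i|) / h + Fintype.card ι / 2) := by
              rw [← Finset.mul_sum, Finset.sum_add_distrib, Finset.sum_div, Finset.sum_const,
                Finset.card_univ, nsmul_eq_mul, mul_one_div]
          _ ≤ (1 / (3 * L * D)) * (√n * L / h + n / 2) := by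
              refine mul_le_mul_of_nonneg_left ?_ (by positivity)
              have h1 := sum_abs_le_sqrt_card_mul Finset.univ y
              rw [← l2_sq, Real.sqrt_sq (l2_nonneg y), Finset.card_univ] at h1
              have h2 : ∑ i, |y i| ≤ √n * L := h1.trans
                (mul_le_mul (Real.sqrt_le_sqrt hι) hy (l2_nonneg _) (Real.sqrt_nonneg _))
              have h3 := div_le_div_of_nonneg_right h2 hh0.le
              linarith
          _ = 2 * n / (3 * k) + n / (6 * (L * D)) := by
              rw [hh]
              field_simp
              rw [hsn2]
              ring
          _ ≤ n := by
              have h1 : 2 * n / (3 * k) ≤ 2 * n / 3 :=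
                div_le_div_of_nonneg_left (by positivity) (by norm_num) (by linarith)
              have h5 : 1 ≤ L * D := one_le_mul_of_one_le_of_one_le hL hD
              have h2 : n / (6 * (L * D)) ≤ n / 6 :=
                div_le_div_of_nonneg_left (by positivity) (by norm_num) (by linarith)
              linarith
      have hblock : ∀ a, ∑ i ∈ colorClass χ a, s i * |(r i : ℝ)| ≤ m := by
        intro a
        have ht0 := hθ0 a
        have h2 := sum_abs_le_sqrt_card_mul (colorClass χ a) fun i => y i - p a i / θ a
        have h3 : √(∑ i ∈ colorClass χ a, (y i - p a i / θ a) ^ 2) ≤ 2 * k / θ a :=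
          Real.sqrt_le_iff.2 ⟨by positivity, hp2 a⟩
        rw [hm a] at h2
        have h4 := h2.trans (mul_le_mul_of_nonneg_left h3 hsm0.le)
        calc ∑ i ∈ colorClass χ a, s i * |(r i : ℝ)|
            ≤ ∑ i ∈ colorClass χ a, √(m : ℝ) / √n * θ a / (6 * D) *
                (|y i - p a i / θ a| / h + 1 / 2) := by
              refine Finset.sum_le_sum fun i hi => ?_
              simp only [hs, hr, he, hp', hcol a i hi, Option.elim]
              exact mul_le_mul_of_nonneg_left (abs_round_div_le hh0 _) (by positivity)
          _ = √(m : ℝ) / √n * θ a / (6 * D) *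
                ((∑ i ∈ colorClass χ a, |y i - p a i / θ a|) / h + m / 2) := by
              rw [← Finset.mul_sum, Finset.sum_add_distrib, Finset.sum_div, Finset.sum_const,
                hm a, nsmul_eq_mul, mul_one_div]
          _ ≤ √(m : ℝ) / √n * θ a / (6 * D) * (√(m : ℝ) * (2 * k / θ a) / h + m / 2) := by
              refine mul_le_mul_of_nonneg_left ?_ (by positivity)
              have h5 := div_le_div_of_nonneg_right h4 hh0.le
              linarith
          _ = √(m : ℝ) ^ 2 * (2 / 3) + √(m : ℝ) / √n * (θ a / D) / 12 * m := by
              rw [hh]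
              field_simp
              ring
          _ ≤ m * (2 / 3) + 1 * 3 / 12 * m := by
              rw [hsm2]
              have h5 : √(m : ℝ) / √n ≤ 1 := (div_le_one hsn0).2 hsmn
              have h6 : θ a / D ≤ 3 := by
                rw [div_le_iff₀ hD0]
                linarith [hθ2 a]
              have h7 : √(m : ℝ) / √n * (θ a / D) ≤ 1 * 3 :=
                mul_le_mul h5 h6 (by positivity) zero_le_one
              have h8 := mul_le_mul_of_nonneg_right h7 hm0.le
              linarith
          _ ≤ m := by linarith
      have htot : ∑ a, ∑ i ∈ colorClass χ a, s i * |(r i : ℝ)| ≤ n := by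
        calc _ ≤ ∑ a : Fin q, (m : ℝ) := Finset.sum_le_sum fun a _ => hblock a
          _ = ((q * m : ℕ) : ℝ) := by simp
          _ ≤ Fintype.card ι := by
              rw [← card_colored χ hm]
              exact_mod_cast Finset.card_le_univ _
          _ ≤ n := hι
      linarith
    · have hround : ∀ i, |(y - V (p', r)) i| ≤ h / 2 := by
        intro i
        have : (y - V (p', r)) i = e i - h * round (e i / h) := by
          simp only [Pi.sub_apply, hV, hr, he]
          ring
        rw [this]
        exact abs_sub_mul_round_le hh0 _
      refine l2_le_of_sq_le (by positivity) ?_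
      calc ∑ i, (y - V (p', r)) i ^ 2 ≤ ∑ i : ι, (h / 2) ^ 2 := by
            refine Finset.sum_le_sum fun i _ => ?_
            rw [← sq_abs]
            exact pow_le_pow_left₀ (abs_nonneg _) (hround i) 2
        _ = Fintype.card ι * (h / 2) ^ 2 := by
            rw [Finset.sum_const, Finset.card_univ, nsmul_eq_mul]
        _ ≤ n * (h / 2) ^ 2 := mul_le_mul_of_nonneg_right hι (sq_nonneg _)
        _ = (k / (4 * D)) ^ 2 := by
            have : n * (h / 2) ^ 2 = (√n * (h / 2)) ^ 2 := by rw [mul_pow, hsn2]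
            rw [this, hh]
            congr 1
            field_simp
            norm_num

/-- Blocks of `m` spread coordinates of `y`, all of which are structured at scale `2 * D`. -/
def StructuredBlocks {ι : Type*} [Fintype ι] (y : ι → ℝ) (q m : ℕ) (n D k c₁ c₂ : ℝ) : Prop :=
  ∃ χ : ι → Option (Fin q), ∀ a, (colorClass χ a).card = m ∧
    (∀ i ∈ colorClass χ a, c₁ / √n ≤ |y i| ∧ |y i| ≤ c₂ / √n) ∧
    ¬ Unstructured y (colorClass χ a) (2 * D) (c₁ * √(m / n)) k

/-- Net for the vectors with structured blocks. -/
lemma exists_net_structured {q m : ℕ} {n D k L c₁ c₂ : ℝ} (hn : 0 < n)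
    (hι : (Fintype.card ι : ℝ) ≤ n) (hm1 : 1 ≤ m) (hmn : (m : ℝ) ≤ n) (hD : 1 ≤ D) (hk : 1 ≤ k)
    (hL : 1 ≤ L) (hc₁ : 0 < c₁) (hc₂ : 1 ≤ c₂) (hck : c₂ ≤ k) :
    ∃ N : Finset (ι → ℝ), (N.card : ℝ) ≤ (q + 1) ^ Fintype.card ι * (4 * D) ^ q *
        (Real.exp (2 * n) * ((630 * c₂ * L * D) ^ Fintype.card ι * (1 / √m) ^ (q * m))) ∧
      ∀ y : ι → ℝ, l2 y ≤ L → StructuredBlocks y q m n D k c₁ c₂ →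
        ∃ y' ∈ N, l2 (y - y') ≤ k / (4 * D) := by
  classical
  have hD0 : 0 < D := by linarith
  set Bd := Real.exp (2 * n) * ((630 * c₂ * L * D) ^ Fintype.card ι * (1 / √m) ^ (q * m)) with hBd
  have hBd0 : 0 ≤ Bd := by positivity
  set Θ : Finset (Fin q → ℕ) := Fintype.piFinset fun _ => Finset.range (⌊2 * D + 1⌋₊ + 1) with hΘ
  set X : Finset ((ι → Option (Fin q)) × (Fin q → ℕ)) := Finset.univ ×ˢ Θ with hX
  have key : ∀ x : (ι → Option (Fin q)) × (Fin q → ℕ), ∃ N : Finset (ι → ℝ), (N.card : ℝ) ≤ Bd ∧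
      ((∀ a, (colorClass x.1 a).card = m) → (∀ a, √n / (2 * c₂) ≤ x.2 a) →
        (∀ a, (x.2 a : ℝ) ≤ 2 * D + 1) → ∀ y : ι → ℝ, l2 y ≤ L →
        (∀ a, ∃ p : ι → ℤ, (∀ i ∈ colorClass x.1 a, |(p i : ℝ)| ≤ 2 * c₂ * x.2 a / √n) ∧
          ∑ i ∈ colorClass x.1 a, (y i - p i / x.2 a) ^ 2 ≤ (2 * k / x.2 a) ^ 2) →
        ∃ y' ∈ N, l2 (y - y') ≤ k / (4 * D)) := by
    intro x
    by_cases hx : (∀ a, (colorClass x.1 a).card = m) ∧ (∀ a, √n / (2 * c₂) ≤ x.2 a) ∧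
        (∀ a, (x.2 a : ℝ) ≤ 2 * D + 1)
    · obtain ⟨N, hN1, hN2⟩ := exists_net_of_denominators x.1 x.2 hn hι hx.1 hm1 hmn hD hk hL hc₂
        hx.2.1 hx.2.2
      exact ⟨N, hN1, fun _ _ _ => hN2⟩
    · refine ⟨∅, by simpa using hBd0, fun h1 h2 h3 => absurd ⟨h1, h2, h3⟩ hx⟩
  choose N hN1 hN2 using key
  refine ⟨X.biUnion N, ?_, ?_⟩
  · have h1 : ((X.biUnion N).card : ℝ) ≤ ∑ x ∈ X, ((N x).card : ℝ) := by
      exact_mod_cast Finset.card_biUnion_le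
    have h2 : (X.card : ℝ) ≤ (q + 1) ^ Fintype.card ι * (4 * D) ^ q := by
      rw [hX, Finset.card_product, hΘ, Fintype.card_piFinset]
      simp only [Finset.card_univ, Fintype.card_fun, Fintype.card_option, Fintype.card_fin,
        Finset.card_range, Finset.prod_const]
      push_cast
      refine mul_le_mul_of_nonneg_left (pow_le_pow_left₀ (by positivity) ?_ q) (by positivity)
      have := Nat.floor_le (show 0 ≤ 2 * D + 1 by linarith)
      linarith
    calc _ ≤ ∑ x ∈ X, ((N x).card : ℝ) := h1
      _ ≤ X.card * Bd := by
          rw [← nsmul_eq_mul]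
          exact Finset.sum_le_card_nsmul _ _ _ fun x _ => hN1 x
      _ ≤ _ := mul_le_mul_of_nonneg_right h2 hBd0
  · rintro y hy ⟨χ, hχ⟩
    have h1 : ∀ a, ∃ θ : ℕ, √n / (2 * c₂) ≤ θ ∧ (θ : ℝ) ≤ 2 * D + 1 ∧ ∃ p : ι → ℤ,
        (∀ i ∈ colorClass χ a, |(p i : ℝ)| ≤ 2 * c₂ * θ / √n) ∧
        ∑ i ∈ colorClass χ a, (y i - p i / θ) ^ 2 ≤ (2 * k / θ) ^ 2 := by
      intro a
      obtain ⟨ha1, ha2, ha3⟩ := hχ a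
      refine exists_rational_of_not_unstructured hn (by rw [ha1]; exact hmn) hc₁ (by linarith)
        (by linarith) hck ha2 ?_
      rw [ha1]
      exact ha3
    choose θ hθ1 hθ2 hp using h1
    obtain ⟨y', hy'1, hy'2⟩ := hN2 (χ, θ) (fun a => (hχ a).1) hθ1 hθ2 y hy hp
    refine ⟨y', Finset.mem_biUnion.2 ⟨(χ, θ), ?_, hy'1⟩, hy'2⟩
    rw [hX, Finset.mem_product, hΘ, Fintype.mem_piFinset]
    refine ⟨Finset.mem_univ _, fun a => ?_⟩
    rw [Finset.mem_range, Nat.lt_succ_iff]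
    exact Nat.le_floor (hθ2 a)

/-- Net for arbitrary vectors: the case without blocks. -/
lemma exists_net_generic {n D k L : ℝ} (hn : 0 < n) (hι : (Fintype.card ι : ℝ) ≤ n) (hn1 : 1 ≤ n)
    (hD : 1 ≤ D) (hk : 1 ≤ k) (hL : 1 ≤ L) :
    ∃ N : Finset (ι → ℝ), (N.card : ℝ) ≤ Real.exp (2 * n) * (630 * L * D) ^ Fintype.card ι ∧
      ∀ y : ι → ℝ, l2 y ≤ L → ∃ y' ∈ N, l2 (y - y') ≤ k / (4 * D) := by
  obtain ⟨N, hN1, hN2⟩ := exists_net_structured (ι := ι) (q := 0) (m := 1) (n := n) (D := D) (k := k)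
    (L := L) (c₁ := 1) (c₂ := 1) hn hι le_rfl (by simpa using hn1) hD hk hL one_pos le_rfl hk
  refine ⟨N, by simpa using hN1, fun y hy => hN2 y hy ⟨fun _ => none, fun a => a.elim0⟩⟩

end Nets

/-! ### Structured vectors at a fixed scale -/

section Levels

variable {ι κ : Type*} [Fintype ι] [Fintype κ] [DecidableEq ι] [DecidableEq κ]
  {μ : Measure ℝ} [IsProbabilityMeasure μ] {b R : ℝ}

/-- Small ball estimate for a fixed pair: the rows outside `I` are tested with the coordinates of `z` in
`J`, the columns outside `J` with the coordinates of `y` in `I`, so that all tests involve disjoint sets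
of entries. -/
lemma measure_pair_small_le {y : ι → ℝ} {z : κ → ℝ} (u : ι → ℝ) (v : κ → ℝ) {I : Finset ι}
    {J : Finset κ} {τ ρ E : ℝ} (hτ : 0 < τ) (hρ : 0 ≤ ρ)
    (hz : ∀ i, SmallBall μ (fun e : ({i} ×ˢ J : Finset (ι × κ)) => rowForm z i e) τ ρ)
    (hy : ∀ j, SmallBall μ (fun e : (I ×ˢ {j} : Finset (ι × κ)) => colForm y j e) τ ρ) :
    (Measure.pi fun _ : ι × κ => μ)
        {x | l2 (entryMatrix x *ᵥ z - u) ^ 2 + l2 ((entryMatrix x)ᵀ *ᵥ y - v) ^ 2 ≤ E}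
      ≤ ENNReal.ofReal (Real.exp (E / (2 * τ ^ 2)) * ρ ^ ((Iᶜ).card + (Jᶜ).card)) := by
  have h := measure_sum_sq_affine_le (μ := μ) (δ := ι × κ) ((Iᶜ).disjSum (Jᶜ))
    (Sum.elim (fun i => ({i} ×ˢ J : Finset (ι × κ))) (fun j => (I ×ˢ {j} : Finset (ι × κ))))
    (Sum.elim (fun i => rowForm z i) (fun j => colForm y j)) (Sum.elim u v) (E := E) hτ hρ
    (by
      rintro (i | j) hr (i' | j') hs hrs <;>
        simp only [Finset.inl_mem_disjSum, Finset.inr_mem_disjSum, Finset.mem_compl] at hr hs <;>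
        rw [Finset.disjoint_left] <;> intro e he hes <;>
        simp only [Sum.elim_inl, Sum.elim_inr, Finset.mem_product, Finset.mem_singleton] at he hes
      · exact hrs (by rw [← he.1, ← hes.1])
      · exact hr (he.1 ▸ hes.1)
      · exact hs (hes.1 ▸ he.1)
      · exact hrs (by rw [← he.2, ← hes.2]))
    (by
      rintro (i | j) hr (i' | j') hs hrs e he <;>
        simp only [Finset.inl_mem_disjSum, Finset.inr_mem_disjSum, Finset.mem_compl] at hr hs <;>
        simp only [Sum.elim_inl, Sum.elim_inr, Finset.mem_product, Finset.mem_singleton] at he ⊢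
      · exact if_neg fun h => hrs (by rw [← h, he.1])
      · exact if_neg fun h : e.1 = i => hr (h ▸ he.1)
      · exact if_neg fun h : e.2 = j => hr (h ▸ he.2)
      · exact if_neg fun h => hrs (by rw [← h, he.2]))
    (by
      rintro (i | j) _
      · exact hz i
      · exact hy j)
  rw [Finset.card_disjSum] at h
  refine le_trans (measure_mono fun x hx => ?_) h
  rw [Set.mem_ofPred_eq] at hx ⊢
  rw [Finset.sum_disjSum]
  simp only [Sum.elim_inl, Sum.elim_inr, ← entryMatrix_mulVec, ← entryMatrix_transpose_mulVec]
  refine le_trans (add_le_add ?_ ?_) hx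
  · rw [l2_sq]
    exact Finset.sum_le_univ_sum_of_nonneg fun i => sq_nonneg _
  · rw [l2_sq]
    exact Finset.sum_le_univ_sum_of_nonneg fun i => sq_nonneg _

lemma smallBall_rowForm (hμ : IsSpreadLaw μ b R) {z : κ → ℝ} {J : Finset κ} {D g k τ : ℝ}
    (hD : 0 < D) (hg : 0 < g) (hτ : 0 < τ) (hz : Unstructured z J D g k) (i : ι) :
    SmallBall μ (fun e : ({i} ×ˢ J : Finset (ι × κ)) => rowForm z i e) τ
      (4 * τ / (√b * g) + Real.exp (-(4 * b) * k ^ 2) + 2 * Real.exp (-(τ * D / R) ^ 2)) := by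
  refine smallBall_of_unstructured hμ _ hD hg hτ fun s hs hsD => ?_
  rw [sum_rowForm_sq z i J fun t => distInt (s * t) ^ 2]
  exact hz s hs hsD

lemma smallBall_colForm (hμ : IsSpreadLaw μ b R) {y : ι → ℝ} {I : Finset ι} {D g k τ : ℝ}
    (hD : 0 < D) (hg : 0 < g) (hτ : 0 < τ) (hy : Unstructured y I D g k) (j : κ) :
    SmallBall μ (fun e : (I ×ˢ {j} : Finset (ι × κ)) => colForm y j e) τ
      (4 * τ / (√b * g) + Real.exp (-(4 * b) * k ^ 2) + 2 * Real.exp (-(τ * D / R) ^ 2)) := by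
  refine smallBall_of_unstructured hμ _ hD hg hτ fun s hs hsD => ?_
  rw [sum_colForm_sq y j I fun t => distInt (s * t) ^ 2]
  exact hy s hs hsD

/-- Approximate solutions of one half of the singular system near an exact one. -/
lemma l2_mulVec_sub_smul_le {M : Matrix ι κ ℝ} {B : Matrix ι ι ℝ}
    {y y' : ι → ℝ} {z z' : κ → ℝ} {σ σ' K L B₀ n d : ℝ} (hs : M *ᵥ z = σ • (B *ᵥ y))
    (hM : OpBound M (K * √n)) (hB : OpBound B B₀) (hB₀ : 0 ≤ B₀) (hK : 0 ≤ K)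
    (hσ : 0 < σ) (hσK : σ ≤ K * L ^ 2 * B₀ * √n) (hy : l2 (y - y') ≤ d)
    (hz : l2 (z - z') ≤ d) (hσσ : |σ - σ'| ≤ √n * d) (hy' : l2 y' ≤ 2 * L) (hd : 0 ≤ d) :
    l2 (M *ᵥ z' - σ' • (B *ᵥ y')) ≤ √n * d * (K + K * L ^ 2 * B₀ ^ 2 + 2 * L * B₀) := by
  have hdec : M *ᵥ z' - σ' • (B *ᵥ y')
      = (σ • (B *ᵥ (y - y')) + (σ - σ') • (B *ᵥ y')) - M *ᵥ (z - z') := by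
    simp only [Matrix.mulVec_sub, hs, smul_sub, sub_smul]
    abel
  rw [hdec]
  have e1 : l2 (M *ᵥ (z - z')) ≤ K * √n * d :=
    (hM _).trans (mul_le_mul_of_nonneg_left hz (by positivity))
  have e2 : l2 (σ • (B *ᵥ (y - y'))) ≤ K * L ^ 2 * B₀ * √n * (B₀ * d) := by
    rw [l2_smul, abs_of_pos hσ]
    exact mul_le_mul hσK ((hB _).trans (mul_le_mul_of_nonneg_left hy hB₀)) (l2_nonneg _)
      (by positivity)
  have e3 : l2 ((σ - σ') • (B *ᵥ y')) ≤ √n * d * (B₀ * (2 * L)) := by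
    rw [l2_smul]
    exact mul_le_mul hσσ ((hB _).trans (mul_le_mul_of_nonneg_left hy' hB₀)) (l2_nonneg _)
      (by positivity)
  calc _ ≤ (K * L ^ 2 * B₀ * √n * (B₀ * d) + √n * d * (B₀ * (2 * L))) + K * √n * d :=
        (l2_sub_le _ _).trans (add_le_add ((l2_add_le _ _).trans (add_le_add e2 e3)) e1)
    _ = _ := by ring

/-- Approximate solutions of the singular system near an exact one. -/
lemma SingularSystem.approx {M : Matrix ι κ ℝ} {B : Matrix ι ι ℝ} {B' : Matrix κ κ ℝ}
    {y y' : ι → ℝ} {z z' : κ → ℝ} {σ σ' K L B₀ n d : ℝ} (hs : SingularSystem M B B' y z σ)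
    (hM : OpBound M (K * √n)) (hB : OpBound B B₀) (hB' : OpBound B' B₀) (hB₀ : 0 ≤ B₀) (hK : 0 ≤ K)
    (hσ : 0 < σ) (hσK : σ ≤ K * L ^ 2 * B₀ * √n) (hy : l2 (y - y') ≤ d)
    (hz : l2 (z - z') ≤ d) (hσσ : |σ - σ'| ≤ √n * d) (hy' : l2 y' ≤ 2 * L) (hz' : l2 z' ≤ 2 * L)
    (hd : 0 ≤ d) :
    l2 (M *ᵥ z' - σ' • (B *ᵥ y')) ^ 2 + l2 (Mᵀ *ᵥ y' - σ' • (B' *ᵥ z')) ^ 2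
      ≤ 2 * (√n * d * (K + K * L ^ 2 * B₀ ^ 2 + 2 * L * B₀)) ^ 2 := by
  have h1 := l2_mulVec_sub_smul_le hs.left hM hB hB₀ hK hσ hσK hy hz hσσ hy' hd
  have h2 := l2_mulVec_sub_smul_le hs.right (hM.transpose (by positivity)) hB' hB₀ hK hσ hσK hz hy hσσ
    hz' hd
  have h3 := pow_le_pow_left₀ (l2_nonneg _) h1 2
  have h4 := pow_le_pow_left₀ (l2_nonneg _) h2 2
  linarith

/-- With small probability, the singular system has a solution whose left vector has all its blocks
structured at scale `2 * D` while both vectors have a block that is unstructured at scale `D`. The net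
for the left vector gains a factor `m ^ (-1/2)` for each block coordinate over the small ball bound. -/
lemma measure_level_le (hμ : IsSpreadLaw μ b R) {q m n : ℕ} {D k K L B₀ c₁ c₂ ρ₀ : ℝ}
    (hι : Fintype.card ι ≤ n) (hκ : Fintype.card κ ≤ n)
    (hm1 : 1 ≤ m) (hmn : m ≤ n) (hqn : q ≤ n) (hD : 1 ≤ D) (hk : 1 ≤ k) (hK : 1 ≤ K) (hL : 1 ≤ L)
    (hB₀ : 1 ≤ B₀) (hc₁ : 0 < c₁) (hc₂ : 1 ≤ c₂) (hck : c₂ ≤ k)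
    (hkD : k ≤ 2 * (c₁ * √(m / n)) * D) (hkD' : k ≤ D) (hρ₀ : 1 ≤ ρ₀)
    {C₄ : ℝ} (hC₄ : C₄ = K + K * L ^ 2 * B₀ ^ 2 + 2 * L * B₀)
    (hρ : 4 * (k / (4 * D) * C₄) / (√b * (c₁ * √(m / n) / 2)) + Real.exp (-(4 * b) * (k / 2) ^ 2)
      + 2 * Real.exp (-(k / (4 * D) * C₄ * D / R) ^ 2) ≤ ρ₀ / D)
    (B G : Matrix ι ι ℝ) (B' : Matrix κ κ ℝ) (hGB : G * B = 1) (hG : OpBound G B₀) (hB : OpBound B B₀)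
    (hB' : OpBound B' B₀) :
    (Measure.pi fun _ : ι × κ => μ) {x | OpBound (entryMatrix x) (K * √n) ∧ ∃ y z σ, 0 < σ ∧
        SingularSystem (entryMatrix x) B B' y z σ ∧ L⁻¹ ≤ l2 y ∧ l2 y ≤ L ∧ l2 z ≤ L ∧
        StructuredBlocks y q m n D k c₁ c₂ ∧
        (∃ I : Finset ι, I.card = m ∧ Unstructured y I D (c₁ * √(m / n)) k) ∧
        (∃ J : Finset κ, J.card = m ∧ Unstructured z J D (c₁ * √(m / n)) k)}
      ≤ ENNReal.ofReal (((q + 1) * (4 * (4 * (Real.exp 5 * (630 * c₂ * L) * (630 * L))) * ρ₀ ^ 2)) ^ n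
          * (5 * K * L ^ 2 * B₀) * D ^ (2 * m + q + 1) * (1 / √m) ^ (q * m)) := by
  classical
  have hn1 : 1 ≤ n := hm1.trans hmn
  have hn0 : (0 : ℝ) < n := by exact_mod_cast hn1
  have hn1' : (1 : ℝ) ≤ n := by exact_mod_cast hn1
  have hι' : (Fintype.card ι : ℝ) ≤ n := by exact_mod_cast hι
  have hκ' : (Fintype.card κ : ℝ) ≤ n := by exact_mod_cast hκ
  have hmn' : (m : ℝ) ≤ n := by exact_mod_cast hmn
  have hm0 : (0 : ℝ) < m := by exact_mod_cast hm1
  have hsn0 : 0 < √(n : ℝ) := Real.sqrt_pos.2 hn0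
  have hD0 : 0 < D := by linarith
  have hk0 : 0 < k := by linarith
  have hB₀0 : 0 < B₀ := by linarith
  set g := c₁ * √(m / n) with hg
  have hg0 : 0 < g := by positivity
  -- The accuracy `d` is the one allowed by `Unstructured.perturb`; the singular value is approximated by
  -- multiples of `√n d`, so that each approximate equation is tested at the radius `d C₄`.
  set d := k / (4 * D) with hd
  have hd0 : 0 < d := by positivity
  have hd1 : d ≤ 1 := by rw [hd, div_le_one (by positivity)]; linarith
  have hC₄0 : 0 < C₄ := by rw [hC₄]; positivity
  obtain ⟨N, hN1, hN2⟩ := exists_net_structured (ι := ι) (q := q) (m := m) (D := D) (k := k) (L := L)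
    (c₁ := c₁) (c₂ := c₂) hn0 hι' hm1 hmn' hD hk hL hc₁ hc₂ hck
  obtain ⟨N', hN'1, hN'2⟩ := exists_net_generic (ι := κ) (D := D) (k := k) (L := L) hn0 hκ' hn1' hD hk hL
  set T : Finset ℕ := Finset.range (⌊K * L ^ 2 * B₀ / d⌋₊ + 1) with hT
  set X : Finset ((Finset ι × Finset κ) × ((ι → ℝ) × (κ → ℝ)) × ℕ) :=
    Finset.univ ×ˢ ((N ×ˢ N') ×ˢ T) with hX
  set Ev : (Finset ι × Finset κ) × ((ι → ℝ) × (κ → ℝ)) × ℕ → Set (ι × κ → ℝ) := fun p => {x |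
    (p.1.1.card = m ∧ p.1.2.card = m ∧ Unstructured p.2.1.1 p.1.1 D (g / 2) (k / 2) ∧
      Unstructured p.2.1.2 p.1.2 D (g / 2) (k / 2)) ∧
    l2 (entryMatrix x *ᵥ p.2.1.2 - (√n * d * p.2.2 : ℝ) • (B *ᵥ p.2.1.1)) ^ 2 +
      l2 ((entryMatrix x)ᵀ *ᵥ p.2.1.1 - (√n * d * p.2.2 : ℝ) • (B' *ᵥ p.2.1.2)) ^ 2
      ≤ 2 * (√n * d * C₄) ^ 2} with hEv
  clear_value T X Ev
  set Bd := Real.exp n * (ρ₀ / D) ^ ((Fintype.card ι - m) + (Fintype.card κ - m)) with hBd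
  have hcover : {x | OpBound (entryMatrix x) (K * √n) ∧ ∃ y z σ, 0 < σ ∧
        SingularSystem (entryMatrix x) B B' y z σ ∧ L⁻¹ ≤ l2 y ∧ l2 y ≤ L ∧ l2 z ≤ L ∧
        StructuredBlocks y q m n D k c₁ c₂ ∧
        (∃ I : Finset ι, I.card = m ∧ Unstructured y I D g k) ∧
        (∃ J : Finset κ, J.card = m ∧ Unstructured z J D g k)} ⊆ ⋃ p ∈ X, Ev p := by
    rintro x ⟨hM, y, z, σ, hσ, hsys, hyL', hyL, hzL, hstr, ⟨I, hI, hIu⟩, ⟨J, hJ, hJu⟩⟩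
    obtain ⟨y', hy'N, hy'⟩ := hN2 y hyL hstr
    obtain ⟨z', hz'N, hz'⟩ := hN'2 z hzL
    have hσle := hsys.sigma_le hM hGB hG hB₀0 (by linarith) (by linarith) hσ hyL' hzL
    have hsd : 0 < √n * d := by positivity
    have hfl := Nat.floor_le (show 0 ≤ σ / (√n * d) by positivity)
    have hfl2 := Nat.lt_floor_add_one (σ / (√n * d))
    rw [le_div_iff₀ hsd] at hfl
    rw [div_lt_iff₀ hsd] at hfl2
    have hy'L : l2 y' ≤ 2 * L := by
      have h1 := l2_abs_sub_le y' y
      rw [l2_sub_comm] at h1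
      linarith
    have hz'L : l2 z' ≤ 2 * L := by
      have h1 := l2_abs_sub_le z' z
      rw [l2_sub_comm] at h1
      linarith
    simp only [Set.mem_iUnion]
    refine ⟨((I, J), (y', z'), ⌊σ / (√n * d)⌋₊), ?_, ?_⟩
    · rw [hX]
      refine Finset.mem_product.2 ⟨Finset.mem_univ _, Finset.mem_product.2
        ⟨Finset.mem_product.2 ⟨hy'N, hz'N⟩, ?_⟩⟩
      rw [hT, Finset.mem_range, Nat.lt_succ_iff]
      refine Nat.floor_le_floor ?_
      rw [div_le_div_iff₀ hsd hd0]
      have := mul_le_mul_of_nonneg_right hσle hd0.le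
      linarith
    · rw [hEv]
      refine ⟨⟨hI, hJ, hIu.perturb hD0 hg0 hk0 hkD hy', hJu.perturb hD0 hg0 hk0 hkD hz'⟩, ?_⟩
      rw [hC₄]
      refine hsys.approx hM hB hB' hB₀0.le (by linarith) hσ hσle hy' hz' ?_ hy'L hz'L hd0.le
      rw [abs_le]
      constructor <;> linarith
  have hbound : ∀ p ∈ X, (Measure.pi fun _ : ι × κ => μ) (Ev p) ≤ ENNReal.ofReal Bd := by
    intro p _
    rw [hEv]
    by_cases hp : p.1.1.card = m ∧ p.1.2.card = m ∧ Unstructured p.2.1.1 p.1.1 D (g / 2) (k / 2) ∧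
      Unstructured p.2.1.2 p.1.2 D (g / 2) (k / 2)
    · obtain ⟨hI, hJ, hIu, hJu⟩ := hp
      have hτ : 0 < d * C₄ := by positivity
      have h := measure_pair_small_le (μ := μ) (y := p.2.1.1) (z := p.2.1.2)
        ((√n * d * p.2.2 : ℝ) • (B *ᵥ p.2.1.1)) ((√n * d * p.2.2 : ℝ) • (B' *ᵥ p.2.1.2))
        (I := p.1.1) (J := p.1.2) (E := 2 * (√n * d * C₄) ^ 2) hτ
        (by have := hμ.b_pos; positivity)
        (smallBall_rowForm hμ hD0 (half_pos hg0) hτ hJu)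
        (smallBall_colForm hμ hD0 (half_pos hg0) hτ hIu)
      refine le_trans (measure_mono fun x hx => hx.2) (h.trans (ENNReal.ofReal_le_ofReal ?_))
      have e1 : 2 * (√n * d * C₄) ^ 2 / (2 * (d * C₄) ^ 2) = n := by
        have : (√n * d * C₄) ^ 2 = √(n : ℝ) ^ 2 * (d * C₄) ^ 2 := by ring
        rw [this, Real.sq_sqrt hn0.le]
        field_simp
      rw [e1, Finset.card_compl, Finset.card_compl, hI, hJ, hBd]
      refine mul_le_mul_of_nonneg_left (pow_le_pow_left₀ ?_ hρ _) (Real.exp_pos _).le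
      have := hμ.b_pos
      positivity
    · refine le_trans (measure_mono (t := ∅) fun x hx => absurd hx.1 hp) (by simp)
  have hXcard : (X.card : ℝ) ≤ 2 ^ n * 2 ^ n * (((q + 1) ^ n * (4 * D) ^ q *
        (Real.exp (2 * n) * ((630 * c₂ * L) ^ n * D ^ Fintype.card ι * (1 / √m) ^ (q * m))) *
        (Real.exp (2 * n) * ((630 * L) ^ n * D ^ Fintype.card κ))) * (5 * K * L ^ 2 * B₀ * D)) := by
    rw [hX, Finset.card_product, Finset.card_product, Finset.card_product, Finset.card_univ,
      Fintype.card_prod, Fintype.card_finset, Fintype.card_finset, hT, Finset.card_range]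
    push_cast
    have h630 : 1 ≤ 630 * L := by linarith
    have h630' : 1 ≤ 630 * c₂ * L := by
      have := one_le_mul_of_one_le_of_one_le hc₂ hL
      linarith
    have hfl := Nat.floor_le (show 0 ≤ K * L ^ 2 * B₀ / d by positivity)
    have hKLB : 1 ≤ K * L ^ 2 * B₀ :=
      one_le_mul_of_one_le_of_one_le (one_le_mul_of_one_le_of_one_le hK (one_le_pow₀ hL)) hB₀
    have e1 : (⌊K * L ^ 2 * B₀ / d⌋₊ : ℝ) + 1 ≤ 5 * K * L ^ 2 * B₀ * D := by
      have h1 : K * L ^ 2 * B₀ / d ≤ 4 * (K * L ^ 2 * B₀) * D := by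
        rw [hd, div_div_eq_mul_div, div_le_iff₀ hk0]
        have h3 : 0 ≤ 4 * (K * L ^ 2 * B₀) * D := by positivity
        have h2 := mul_le_mul_of_nonneg_left hk h3
        linarith
      have h2 : 1 ≤ K * L ^ 2 * B₀ * D := one_le_mul_of_one_le_of_one_le hKLB hD
      linarith
    have e2 : (N.card : ℝ) ≤ (q + 1) ^ n * (4 * D) ^ q *
        (Real.exp (2 * n) * ((630 * c₂ * L) ^ n * D ^ Fintype.card ι * (1 / √m) ^ (q * m))) := by
      refine hN1.trans ?_
      rw [mul_pow (630 * c₂ * L) D]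
      have h1 : ((q : ℝ) + 1) ^ Fintype.card ι ≤ (q + 1) ^ n :=
        pow_le_pow_right₀ (by linarith [(Nat.cast_nonneg q : (0 : ℝ) ≤ q)]) hι
      have h2 : (630 * c₂ * L) ^ Fintype.card ι ≤ (630 * c₂ * L) ^ n := pow_le_pow_right₀ h630' hι
      gcongr
    have e3 : (N'.card : ℝ) ≤ Real.exp (2 * n) * ((630 * L) ^ n * D ^ Fintype.card κ) := by
      refine hN'1.trans ?_
      rw [mul_pow (630 * L) D]
      have h2 : (630 * L) ^ Fintype.card κ ≤ (630 * L) ^ n := pow_le_pow_right₀ h630 hκ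
      gcongr
    have e4 : (2 : ℝ) ^ Fintype.card ι ≤ 2 ^ n := pow_le_pow_right₀ one_le_two hι
    have e5 : (2 : ℝ) ^ Fintype.card κ ≤ 2 ^ n := pow_le_pow_right₀ one_le_two hκ
    have e6 := mul_le_mul e2 e3 (Nat.cast_nonneg _) (by positivity)
    have e7 := mul_le_mul e6 e1 (by positivity) (by positivity)
    exact mul_le_mul (mul_le_mul e4 e5 (by positivity) (by positivity)) e7 (by positivity)
      (by positivity)
  have hBd' : Bd ≤ Real.exp n * (ρ₀ ^ (2 * n) *
      (D ^ (2 * m) / (D ^ Fintype.card ι * D ^ Fintype.card κ))) := by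
    rw [hBd, div_pow]
    refine mul_le_mul_of_nonneg_left ?_ (Real.exp_pos _).le
    rw [div_eq_mul_inv]
    refine mul_le_mul (pow_le_pow_right₀ hρ₀ (by omega)) ?_ (by positivity) (by positivity)
    rw [inv_eq_one_div, div_le_div_iff₀ (by positivity) (by positivity), one_mul, ← pow_add, ← pow_add]
    exact pow_le_pow_right₀ hD (by omega)
  refine (measure_mono hcover).trans ((measure_biUnion_le_ofReal _ _ _ hbound).trans
    (ENNReal.ofReal_le_ofReal ?_))
  have hBd0 : 0 ≤ Bd := by positivity
  have h4q : (4 : ℝ) ^ q ≤ 4 ^ n := pow_le_pow_right₀ (by norm_num) hqn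
  have hexp : Real.exp n * Real.exp (2 * n) * Real.exp (2 * n) = Real.exp 5 ^ n := by
    rw [← Real.exp_add, ← Real.exp_add, ← Real.exp_nat_mul]
    congr 1
    ring
  calc _ ≤ 2 ^ n * 2 ^ n * (((q + 1) ^ n * (4 * D) ^ q *
        (Real.exp (2 * n) * ((630 * c₂ * L) ^ n * D ^ Fintype.card ι * (1 / √m) ^ (q * m))) *
        (Real.exp (2 * n) * ((630 * L) ^ n * D ^ Fintype.card κ))) * (5 * K * L ^ 2 * B₀ * D)) *
        (Real.exp n * (ρ₀ ^ (2 * n) * (D ^ (2 * m) / (D ^ Fintype.card ι * D ^ Fintype.card κ)))) :=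
        mul_le_mul hXcard hBd' hBd0 (by positivity)
    _ = 4 ^ q * ((2 * 2) ^ n * ((q + 1) ^ n *
          ((Real.exp n * Real.exp (2 * n) * Real.exp (2 * n)) * (630 * c₂ * L) ^ n * (630 * L) ^ n)
          * (ρ₀ ^ 2) ^ n * (5 * K * L ^ 2 * B₀) * (D ^ (2 * m) * D ^ q * D) * (1 / √m) ^ (q * m))) := by
        rw [mul_pow 4 D q, pow_mul ρ₀ 2 n, mul_pow 2 2 n]
        field_simp
    _ ≤ 4 ^ n * ((2 * 2) ^ n * ((q + 1) ^ n *
          ((Real.exp n * Real.exp (2 * n) * Real.exp (2 * n)) * (630 * c₂ * L) ^ n * (630 * L) ^ n)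
          * (ρ₀ ^ 2) ^ n * (5 * K * L ^ 2 * B₀) * (D ^ (2 * m) * D ^ q * D) * (1 / √m) ^ (q * m))) :=
        mul_le_mul_of_nonneg_right h4q (by positivity)
    _ = _ := by
        rw [hexp, pow_add D, pow_add D, pow_one]
        generalize (1 / √(m : ℝ)) ^ (q * m) = r
        rw [show (2 * 2 : ℝ) = 4 by norm_num]
        generalize 630 * c₂ * L = A₁
        generalize 630 * L = A₂
        generalize (q : ℝ) + 1 = A₃
        generalize (4 : ℝ) = A₄
        ring

end Levels

/-! ### Existence of unstructured blocks -/

section Structure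

lemma SingularSystem.transpose {ι κ : Type*} [Fintype ι] [Fintype κ] {M : Matrix ι κ ℝ}
    {B : Matrix ι ι ℝ} {B' : Matrix κ κ ℝ} {y : ι → ℝ} {z : κ → ℝ} {σ : ℝ}
    (h : SingularSystem M B B' y z σ) : SingularSystem Mᵀ B' B z y σ :=
  ⟨h.right, by rw [Matrix.transpose_transpose]; exact h.left⟩

/-- Transposing the matrix of independent entries does not change its law. -/
lemma measure_entryMatrix_transpose {ι κ : Type*} [Fintype ι] [Fintype κ] (μ : Measure ℝ)
    [IsProbabilityMeasure μ] (P : Matrix κ ι ℝ → Prop) :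
    (Measure.pi fun _ : ι × κ => μ) {x | P (entryMatrix x)ᵀ}
      = (Measure.pi fun _ : κ × ι => μ) {x | P (entryMatrix x)} := by
  have h := measurePreserving_piCongrLeft (fun _ : κ × ι => μ) (Equiv.prodComm ι κ)
  rw [← h.measure_preimage_equiv]
  rfl

lemma Unstructured.mono {ι : Type*} [Fintype ι] {a : ι → ℝ} {I J : Finset ι} {D g g' k : ℝ}
    (h : Unstructured a I D g k) (hIJ : I ⊆ J) (hg' : 0 ≤ g') (hg : g' ≤ g) (hk : 0 ≤ k) :
    Unstructured a J D g' k := by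
  intro s hs hsD
  refine le_trans (pow_le_pow_left₀ (le_min (by positivity) hk) ?_ 2) ((h s hs hsD).trans
    (Finset.sum_le_sum_of_subset_of_nonneg hIJ fun i _ _ => sq_nonneg _))
  exact min_le_min_right _ (mul_le_mul_of_nonneg_right hg hs.le)

/-- The bound of `measure_level_le` is exponentially small when the scale is at most `x ^ (1 / α)`, with
`x` a small power of `n`. -/
lemma level_bound_le {n m q : ℕ} {x α D A C₆ C₇ c₃ : ℝ} (hn : 1 ≤ n) (hx : Real.exp 1 ≤ x)
    (hxn : x ^ 5 ≤ n) (hnx : (n : ℝ) = x ^ (104 / c₃)) (hA : 0 ≤ A) (hC₆ : 0 ≤ C₆)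
    (hAx : 2 * A * C₇ ^ 2 ≤ x) (hC₆x : C₆ ≤ x) (hc₃ : 0 < c₃) (hα0 : 0 < α) (hαx : α⁻¹ ≤ x)
    (hm1 : α * n ≤ m) (hm2 : (m : ℝ) ≤ 2 * α * n) (hqm : c₃ * n / 2 ≤ q * m) (hq : (q : ℝ) ≤ α⁻¹)
    (hD : 1 ≤ D) (hDx : D ≤ x ^ α⁻¹) :
    ((q + 1) * (A * (C₇ * x ^ 2) ^ 2)) ^ n * C₆ * D ^ (2 * m + q + 1) * (1 / √m) ^ (q * m)
      ≤ Real.exp (-(n : ℝ)) := by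
  have hx1 : 1 ≤ x := by
    have := Real.add_one_le_exp (1 : ℝ)
    linarith
  have hx0 : 0 < x := by linarith
  have hn0 : (0 : ℝ) < n := by exact_mod_cast hn
  have hn1 : (1 : ℝ) ≤ n := by exact_mod_cast hn
  have hx2 : 2 * x ^ 2 ≤ x ^ 5 := by
    have h1 : (2 : ℝ) ≤ x := by
      have := Real.add_one_le_exp (1 : ℝ)
      linarith
    have h2 : 1 ≤ x ^ 2 := one_le_pow₀ hx1
    calc 2 * x ^ 2 ≤ x * x ^ 2 := by gcongr
      _ ≤ x * x ^ 2 * x ^ 2 := le_mul_of_one_le_right (by positivity) h2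
      _ = x ^ 5 := by ring
  have hαi0 : 0 < α⁻¹ := inv_pos.2 hα0
  -- The factors are bounded by powers `x ^ (k n)`: `k = 6` for the first, `1` for `C₆`, `5` for the power of
  -- `D`, and `-13` for the gain. The total is `-1`, and `x ≥ exp 1`.
  have e1 : D ^ (2 * m + q + 1) ≤ x ^ (5 * n) := by
    calc D ^ (2 * m + q + 1) ≤ (x ^ α⁻¹) ^ (2 * m + q + 1) := pow_le_pow_left₀ (by linarith) hDx _
      _ = x ^ (α⁻¹ * (2 * m + q + 1 : ℕ)) := by rw [Real.rpow_mul_natCast hx0.le]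
      _ ≤ x ^ ((5 * n : ℕ) : ℝ) := by
          refine Real.rpow_le_rpow_of_exponent_le hx1 ?_
          push_cast
          have h1 : α⁻¹ * m ≤ 2 * n := by
            calc α⁻¹ * m ≤ α⁻¹ * (2 * α * n) := mul_le_mul_of_nonneg_left hm2 hαi0.le
              _ = 2 * n := by field_simp
          have h2 : α⁻¹ * q ≤ x * x := mul_le_mul hαx (hq.trans hαx) (Nat.cast_nonneg _) hx0.le
          have h3 : x ≤ x * x := le_mul_of_one_le_left hx0.le hx1
          linarith
      _ = x ^ (5 * n) := Real.rpow_natCast _ _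
  -- Here `x ^ (26 / c₃) = n ^ (1 / 4)`, while `m ≥ n / x ≥ √n`.
  have hsq : x ^ (26 / c₃) ≤ √m := by
    refine Real.le_sqrt_of_sq_le ?_
    have h1 : (n : ℝ) / x ≤ m := by
      refine le_trans ?_ hm1
      rw [div_le_iff₀ hx0]
      have : 1 ≤ α * x := by
        have := mul_le_mul_of_nonneg_left hαx hα0.le
        rwa [mul_inv_cancel₀ hα0.ne'] at this
      have := mul_le_mul_of_nonneg_right this hn0.le
      linarith
    refine le_trans ?_ h1
    rw [le_div_iff₀ hx0]
    have hy0 : 0 < x ^ (26 / c₃) := Real.rpow_pos_of_pos hx0 _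
    have hxy : x ≤ (x ^ (26 / c₃)) ^ 2 := by
      have h5 : (x ^ (26 / c₃)) ^ 4 = n := by
        rw [hnx, ← Real.rpow_mul_natCast hx0.le]
        congr 1
        push_cast
        ring
      have h6 : x ^ 2 ≤ ((x ^ (26 / c₃)) ^ 2) ^ 2 := by
        rw [← pow_mul, h5]
        have := sq_nonneg x
        linarith
      exact (pow_le_pow_iff_left₀ hx0.le (by positivity) two_ne_zero).1 h6
    calc (x ^ (26 / c₃)) ^ 2 * x ≤ (x ^ (26 / c₃)) ^ 2 * (x ^ (26 / c₃)) ^ 2 := by gcongr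
      _ = (n : ℝ) := by
        rw [hnx, ← pow_add, ← Real.rpow_mul_natCast hx0.le]
        congr 1
        push_cast
        ring
  have e2 : x ^ (13 * n) ≤ √(m : ℝ) ^ (q * m) := by
    calc x ^ (13 * n) = x ^ ((13 * n : ℕ) : ℝ) := (Real.rpow_natCast _ _).symm
      _ ≤ x ^ (26 / c₃ * ((q * m : ℕ) : ℝ)) := by
          refine Real.rpow_le_rpow_of_exponent_le hx1 ?_
          push_cast
          calc (13 : ℝ) * n = 26 / c₃ * (c₃ * n / 2) := by field_simp; norm_num
            _ ≤ _ := mul_le_mul_of_nonneg_left hqm (by positivity)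
      _ = (x ^ (26 / c₃)) ^ (q * m) := Real.rpow_mul_natCast hx0.le _ _
      _ ≤ _ := pow_le_pow_left₀ (Real.rpow_nonneg hx0.le _) hsq _
  have e3 : (q + 1) * (A * (C₇ * x ^ 2) ^ 2) ≤ x ^ 6 := by
    calc (q + 1) * (A * (C₇ * x ^ 2) ^ 2) ≤ (2 * x) * (A * (C₇ * x ^ 2) ^ 2) := by
          refine mul_le_mul_of_nonneg_right ?_ (by positivity)
          linarith
      _ = (2 * A * C₇ ^ 2) * x ^ 5 := by ring
      _ ≤ x * x ^ 5 := mul_le_mul_of_nonneg_right hAx (by positivity)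
      _ = x ^ 6 := by ring
  have e4 : C₆ ≤ x ^ n := hC₆x.trans (le_self_pow₀ hx1 (by omega))
  have e5 : (1 / √(m : ℝ)) ^ (q * m) ≤ 1 / x ^ (13 * n) := by
    rw [one_div_pow]
    exact one_div_le_one_div_of_le (by positivity) e2
  calc _ ≤ (x ^ 6) ^ n * x ^ n * x ^ (5 * n) * (1 / x ^ (13 * n)) := by gcongr
    _ = 1 / x ^ n := by
        have h13 : x ^ (13 * n) = (x ^ 6) ^ n * x ^ n * x ^ (5 * n) * x ^ n := by ring
        rw [h13]
        have : (x ^ 6) ^ n * x ^ n * x ^ (5 * n) ≠ 0 := by positivity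
        field_simp
    _ ≤ 1 / Real.exp n := by
        refine one_div_le_one_div_of_le (Real.exp_pos _) ?_
        rw [← Real.exp_one_pow]
        exact pow_le_pow_left₀ (Real.exp_pos _).le hx n
    _ = Real.exp (-(n : ℝ)) := by rw [Real.exp_neg, one_div]

/-- Small ball bound at the scales below `x ^ (1 / α)`, the gaussian terms being negligible. -/
lemma level_smallBall_le {x α D C₄ b R c₁ s : ℝ} (hx1 : 1 ≤ x) (hα0 : 0 < α) (hαx : α⁻¹ ≤ x)
    (hs : √α ≤ s) (hb : 0 < b) (hc₁ : 0 < c₁) (hC₄ : 0 < C₄)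
    (hlog1 : Real.log x ≤ b * x) (hlog2 : Real.log x ≤ (C₄ / (4 * R)) ^ 2 * x)
    (hD : 1 ≤ D) (hDx : D ≤ x ^ α⁻¹) :
    4 * (x / (4 * D) * C₄) / (√b * (c₁ * s / 2)) + Real.exp (-(4 * b) * (x / 2) ^ 2)
      + 2 * Real.exp (-(x / (4 * D) * C₄ * D / R) ^ 2)
      ≤ ((2 * C₄ / (√b * c₁) + 3) * x ^ 2) / D := by
  have hx0 : 0 < x := by linarith
  have hD0 : 0 < D := by linarith
  have hsα : 0 < √α := Real.sqrt_pos.2 hα0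
  have hs0 : 0 < s := hsα.trans_le hs
  have hsb : 0 < √b := Real.sqrt_pos.2 hb
  have hlog0 : 0 ≤ Real.log x := Real.log_nonneg hx1
  have key : ∀ t : ℝ, Real.log x ≤ t * x → Real.exp (-(t * x ^ 2)) ≤ x ^ 2 / D := by
    intro t ht
    have h1 : D ≤ Real.exp (t * x ^ 2) := by
      refine hDx.trans ?_
      rw [Real.rpow_def_of_pos hx0]
      refine Real.exp_le_exp.2 ?_
      calc Real.log x * α⁻¹ ≤ t * x * x := mul_le_mul ht hαx (by positivity) (hlog0.trans ht)
        _ = t * x ^ 2 := by ring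
    rw [Real.exp_neg, le_div_iff₀ hD0]
    calc (Real.exp (t * x ^ 2))⁻¹ * D ≤ (Real.exp (t * x ^ 2))⁻¹ * Real.exp (t * x ^ 2) := by gcongr
      _ = 1 := inv_mul_cancel₀ (Real.exp_pos _).ne'
      _ ≤ x ^ 2 := one_le_pow₀ hx1
  have h1 := key b hlog1
  have h2 := key _ hlog2
  have e1 : -(4 * b) * (x / 2) ^ 2 = -(b * x ^ 2) := by ring
  have e2 : -(x / (4 * D) * C₄ * D / R) ^ 2 = -((C₄ / (4 * R)) ^ 2 * x ^ 2) := by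
    have : x / (4 * D) * C₄ * D / R = C₄ / (4 * R) * x := by field_simp
    rw [this, mul_pow]
  have h3 : 4 * (x / (4 * D) * C₄) / (√b * (c₁ * s / 2)) ≤ 2 * C₄ / (√b * c₁) * x ^ 2 / D := by
    have hsx : s⁻¹ ≤ x := by
      have h4 : (√α)⁻¹ ≤ x := by
        rw [← Real.sqrt_inv]
        refine (Real.sqrt_le_sqrt hαx).trans ?_
        rw [Real.sqrt_le_left hx0.le]
        exact le_self_pow₀ hx1 two_ne_zero
      exact (inv_anti₀ hsα hs).trans h4
    calc 4 * (x / (4 * D) * C₄) / (√b * (c₁ * s / 2)) = 2 * C₄ / (√b * c₁) * (x * s⁻¹) / D := by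
          field_simp
      _ ≤ 2 * C₄ / (√b * c₁) * (x * x) / D := by gcongr
      _ = _ := by ring
  rw [e1, e2]
  calc _ ≤ 2 * C₄ / (√b * c₁) * x ^ 2 / D + x ^ 2 / D + 2 * (x ^ 2 / D) := by gcongr
    _ = _ := by ring

/-- A set of size at least `q * m` contains `q` disjoint blocks of size `m`. -/
lemma exists_coloring {ι : Type*} [Fintype ι] [DecidableEq ι] {q m : ℕ} {S : Finset ι} (h : q * m ≤ S.card) :
    ∃ χ : ι → Option (Fin q), ∀ a, (colorClass χ a).card = m ∧ colorClass χ a ⊆ S := by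
  obtain ⟨S', hS', hc⟩ := Finset.exists_subset_card_eq h
  have e : S' ≃ Fin q × Fin m := Fintype.equivOfCardEq (by simp [hc])
  refine ⟨fun i => if hi : i ∈ S' then some (e ⟨i, hi⟩).1 else none, fun a => ?_⟩
  have hmem : ∀ i, i ∈ colorClass (fun i => if hi : i ∈ S' then some (e ⟨i, hi⟩).1 else none) a ↔
      ∃ hi : i ∈ S', (e ⟨i, hi⟩).1 = a := by
    intro i
    simp only [colorClass, Finset.mem_filter, Finset.mem_univ, true_and]
    by_cases hi : i ∈ S' <;> simp [hi]
  refine ⟨?_, fun i hi => hS' ((hmem i).1 hi).1⟩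
  refine Eq.trans (Eq.symm ?_) (Finset.card_fin m)
  refine Finset.card_bij (fun c _ => (e.symm (a, c) : ι)) ?_ ?_ ?_
  · intro c _
    rw [hmem]
    exact ⟨(e.symm (a, c)).2, by simp⟩
  · intro c _ c' _ h
    have := e.symm.injective (Subtype.ext h)
    simpa using this
  · intro i hi
    obtain ⟨hi, hi2⟩ := (hmem i).1 hi
    exact ⟨(e ⟨i, hi⟩).2, Finset.mem_univ _, by rw [← hi2]; simp⟩

end Structure

/-! ### The structured event over all scales -/

section Levels

/-- Along a dyadic sequence of scales there is a last one at which both vectors have an unstructured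
block; all blocks of one of the two vectors are structured at the next scale. -/
lemma exists_level {ι κ : Type*} [Fintype ι] [Fintype κ] [DecidableEq ι] [DecidableEq κ]
    {y : ι → ℝ} {z : κ → ℝ} {S : Finset ι} {S' : Finset κ} {q m N : ℕ} {n c₁ c₂ c₃ k D₀ g' : ℝ}
    (hn : 0 < n) (hc₁ : 0 < c₁) (hc₂ : 0 < c₂) (hk : 0 ≤ k)
    (hS : c₃ * n ≤ S.card) (hS' : c₃ * n ≤ S'.card) (hq : 1 ≤ q) (hqm : (q : ℝ) * m ≤ c₃ * n)
    (hy : ∀ i ∈ S, c₁ / √n ≤ |y i| ∧ |y i| ≤ c₂ / √n)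
    (hz : ∀ i ∈ S', c₁ / √n ≤ |z i| ∧ |z i| ≤ c₂ / √n)
    (hg0 : 0 ≤ g') (hg : g' ≤ c₁ * √(m / n)) (hD : D₀ ≤ 2 ^ N * (√n / (2 * c₂)))
    (hu : ¬ Unstructured y Finset.univ D₀ g' k) :
    ∃ j < N, (2 ^ j * (√n / (2 * c₂))) ≤ D₀ ∧
      (∃ I : Finset ι, I.card = m ∧ Unstructured y I (2 ^ j * (√n / (2 * c₂))) (c₁ * √(m / n)) k) ∧
      (∃ J : Finset κ, J.card = m ∧ Unstructured z J (2 ^ j * (√n / (2 * c₂))) (c₁ * √(m / n)) k) ∧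
      (StructuredBlocks y q m n (2 ^ j * (√n / (2 * c₂))) k c₁ c₂ ∨
        StructuredBlocks z q m n (2 ^ j * (√n / (2 * c₂))) k c₁ c₂) := by
  classical
  set D : ℕ → ℝ := fun j => 2 ^ j * (√n / (2 * c₂)) with hDdef
  set P : ℕ → Prop := fun j =>
    (∃ I : Finset ι, I.card = m ∧ Unstructured y I (D j) (c₁ * √(m / n)) k) ∧
      (∃ J : Finset κ, J.card = m ∧ Unstructured z J (D j) (c₁ * √(m / n)) k) with hP
  have hqS : q * m ≤ S.card := by exact_mod_cast hqm.trans hS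
  have hqS' : q * m ≤ S'.card := by exact_mod_cast hqm.trans hS'
  have hmq : m ≤ q * m := Nat.le_mul_of_pos_left m hq
  -- At the lowest scale there is no wraparound, so spread blocks are unstructured because of their size.
  have hP0 : P 0 := by
    obtain ⟨I, hI, hIc⟩ := Finset.exists_subset_card_eq (hmq.trans hqS)
    obtain ⟨J, hJ, hJc⟩ := Finset.exists_subset_card_eq (hmq.trans hqS')
    have h1 := unstructured_of_spread hn hc₁ hc₂ hk (fun i hi => hy i (hI hi))
    have h2 := unstructured_of_spread hn hc₁ hc₂ hk (fun i hi => hz i (hJ hi))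
    rw [hIc] at h1
    rw [hJc] at h2
    exact ⟨⟨I, hIc, h1.anti (by simp [hDdef])⟩, ⟨J, hJc, h2.anti (by simp [hDdef])⟩⟩
  have hPD : ∀ j, D₀ ≤ D j → ¬ P j := by
    rintro j hj ⟨⟨I, _, hI⟩, _⟩
    exact hu ((hI.anti hj).mono (Finset.subset_univ _) hg0 hg hk)
  have hex : ∃ j, ¬ P j := ⟨N, hPD N hD⟩
  have hfind := Nat.find_spec hex
  have hpos : Nat.find hex ≠ 0 := fun h => by rw [h] at hfind; exact hfind hP0
  obtain ⟨j, hj⟩ := Nat.exists_eq_succ_of_ne_zero hpos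
  have hjN : j < N := by
    have := Nat.find_min' hex (hPD N hD)
    omega
  have hPj : P j := not_not.1 (Nat.find_min hex (show j < Nat.find hex by omega))
  have hPj1 : ¬ P (j + 1) := by rw [hj] at hfind; exact hfind
  have hDj : D (j + 1) = 2 * D j := by simp only [hDdef]; ring
  refine ⟨j, hjN, (lt_of_not_ge fun h => hPD j h hPj).le, hPj.1, hPj.2, ?_⟩
  simp only [hP, hDj] at hPj1
  rcases not_and_or.1 hPj1 with h | h
  · left
    obtain ⟨χ, hχ⟩ := exists_coloring hqS
    refine ⟨χ, fun a => ⟨(hχ a).1, fun i hi => hy i ((hχ a).2 hi), fun hun => h ⟨_, (hχ a).1, hun⟩⟩⟩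
  · right
    obtain ⟨χ, hχ⟩ := exists_coloring hqS'
    refine ⟨χ, fun a => ⟨(hχ a).1, fun i hi => hz i ((hχ a).2 hi), fun hun => h ⟨_, (hχ a).1, hun⟩⟩⟩

/-- Block size and number of blocks. -/
lemma exists_block_sizes {n : ℕ} {α c₃ : ℝ} (hn : 1 ≤ n) (hc₃ : 0 < c₃) (hc₃1 : c₃ ≤ 1) (hα : 0 < α)
    (hαn : 1 ≤ α * n) (hαc : α ≤ c₃ / 104) :
    ∃ m q : ℕ, 1 ≤ m ∧ m ≤ n ∧ α * n ≤ m ∧ (m : ℝ) ≤ 2 * α * n ∧ 1 ≤ q ∧ q ≤ n ∧ (q : ℝ) ≤ α⁻¹ ∧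
      (q : ℝ) * m ≤ c₃ * n ∧ c₃ * n / 2 ≤ q * m := by
  have hn0 : (0 : ℝ) < n := by exact_mod_cast hn
  set m := ⌈α * n⌉₊ with hm
  have hm1 : α * n ≤ m := Nat.le_ceil _
  have hm2 : (m : ℝ) < α * n + 1 := Nat.ceil_lt_add_one (by positivity)
  have hm3 : (1 : ℝ) ≤ m := hαn.trans hm1
  have hm0 : (0 : ℝ) < m := by linarith
  have hmul := mul_le_mul_of_nonneg_right hαc hn0.le
  have hmc : (m : ℝ) ≤ c₃ * n / 52 := by linarith
  have hcn : c₃ * n ≤ n := by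
    have := mul_le_mul_of_nonneg_right hc₃1 hn0.le
    linarith
  have hcn0 : 0 < c₃ * n := by positivity
  set q := ⌊c₃ * n / m⌋₊ with hq
  have hq1 : (q : ℝ) ≤ c₃ * n / m := Nat.floor_le (by positivity)
  have hq2 : c₃ * n / m < q + 1 := Nat.lt_floor_add_one _
  have hq3 : (q : ℝ) * m ≤ c₃ * n := (le_div_iff₀ hm0).1 hq1
  rw [div_lt_iff₀ hm0] at hq2
  refine ⟨m, q, by exact_mod_cast hm3, ?_, hm1, by linarith, ?_, ?_, ?_, hq3, by linarith⟩
  · exact_mod_cast (show (m : ℝ) ≤ n by linarith)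
  · refine Nat.one_le_iff_ne_zero.2 fun h => ?_
    rw [h] at hq2
    push_cast at hq2
    linarith
  · have h1 : (q : ℝ) ≤ q * m := le_mul_of_one_le_right (Nat.cast_nonneg _) hm3
    exact_mod_cast (show (q : ℝ) ≤ n by linarith)
  · rw [le_inv_comm₀ (by
      have h1 : 0 ≤ (q : ℝ) := Nat.cast_nonneg _
      refine lt_of_le_of_ne h1 fun h => ?_
      rw [← h] at hq2
      linarith) hα]
    have h1 : (q : ℝ) * (α * n) ≤ n := by
      have := mul_le_mul_of_nonneg_left hm1 (Nat.cast_nonneg (α := ℝ) q)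
      linarith
    have hq0 : (0 : ℝ) < q := by
      refine lt_of_le_of_ne (Nat.cast_nonneg _) fun h => ?_
      rw [← h] at hq2
      linarith
    rw [le_inv_comm₀ hα hq0, ← one_div, le_div_iff₀ hα]
    refine le_of_mul_le_mul_right ?_ hn0
    linarith

set_option maxHeartbeats 1000000 in
/-- Apart from an event of exponentially small probability, the left vectors of singular systems are
unstructured up to the scale `n ^ (β / α)`. -/
theorem measure_structured_le {b R c₀ K L B₀ : ℝ} (hb : 0 < b) (hR : 1 ≤ R) (hc₀ : 0 < c₀)
    (hK : 1 ≤ K) (hL : 1 ≤ L) (hB₀ : 1 ≤ B₀) :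
    ∃ c₁ β c : ℝ, ∃ n₀ : ℕ, 0 < c₁ ∧ 0 < β ∧ β ≤ 1 ∧ 0 < c ∧ ∀ n : ℕ, n₀ ≤ n →
      ∀ (ι κ : Type) [Fintype ι] [Fintype κ] [DecidableEq ι] [DecidableEq κ],
      c₀ * n ≤ Fintype.card ι → c₀ * n ≤ Fintype.card κ → Fintype.card ι ≤ n → Fintype.card κ ≤ n →
      ∀ (μ : Measure ℝ) [IsProbabilityMeasure μ], IsSpreadLaw μ b R →
      ∀ (B G : Matrix ι ι ℝ) (B' G' : Matrix κ κ ℝ), G * B = 1 → OpBound G B₀ → OpBound B B₀ →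
        G' * B' = 1 → OpBound G' B₀ → OpBound B' B₀ →
      ∀ α : ℝ, (n : ℝ) ^ (-β) ≤ α → α ≤ β →
      (Measure.pi fun _ : ι × κ => μ) {x | OpBound (entryMatrix x) (K * √n) ∧ ∃ y z σ, 0 < σ ∧
        SingularSystem (entryMatrix x) B B' y z σ ∧ L⁻¹ ≤ l2 y ∧ l2 y ≤ L ∧ L⁻¹ ≤ l2 z ∧ l2 z ≤ L ∧
        ¬ Unstructured y Finset.univ ((n : ℝ) ^ (β / α)) (c₁ * √α) ((n : ℝ) ^ β)}
      ≤ ENNReal.ofReal (4 * n * Real.exp (-c * n)) := by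
  obtain ⟨η, ε, c, n₁, hη0, hη1, hε0, hε1, hc0, hsparse⟩ :=
    measure_nearSparse_le hb hR hc₀ hK hL hB₀
  have hsη0 : 0 < √η := Real.sqrt_pos.2 hη0
  have hsη1 : √η ≤ 1 := Real.sqrt_le_one.2 hη1
  -- Vectors that are not nearly sparse have at least `c₃ n` coordinates of size between `c₁ / √n` and
  -- `c₂ / √n` (`exists_spread`). With `x = n ^ β`, the choice of `β` means `n = x ^ (104 / c₃)`, which is
  -- what `level_bound_le` requires.
  set c₁ := ε / 2 with hc₁
  set c₂ := L / √η with hc₂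
  set c₃ := ε ^ 2 / (2 * c₂ ^ 2) with hc₃
  set β := c₃ / 104 with hβ
  have hc₁0 : 0 < c₁ := by positivity
  have hc₂1 : 1 ≤ c₂ := by rw [hc₂, le_div_iff₀ hsη0]; linarith
  have hc₂0 : 0 < c₂ := by linarith
  have hc₃0 : 0 < c₃ := by positivity
  have hc₃1 : c₃ ≤ 1 := by
    rw [hc₃, div_le_one (by positivity)]
    have h1 : ε ^ 2 ≤ 1 := pow_le_one₀ hε0.le hε1
    have h2 : 1 ≤ c₂ ^ 2 := one_le_pow₀ hc₂1
    linarith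
  have hβ0 : 0 < β := by positivity
  have hβ1 : β ≤ 1 / 104 := by rw [hβ]; linarith
  set C₄ := K + K * L ^ 2 * B₀ ^ 2 + 2 * L * B₀ with hC₄
  have hC₄0 : 0 < C₄ := by positivity
  set C₆ := 5 * K * L ^ 2 * B₀ with hC₆
  have hC₆0 : 0 < C₆ := by positivity
  set C₇ := 2 * C₄ / (√b * c₁) + 3 with hC₇
  have hsb : 0 < √b := Real.sqrt_pos.2 hb
  have hC₇3 : 3 ≤ C₇ := by
    have : 0 ≤ 2 * C₄ / (√b * c₁) := by positivity
    linarith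
  set A := 4 * (4 * (Real.exp 5 * (630 * c₂ * L) * (630 * L))) with hA
  have hA0 : 0 < A := by positivity
  have hlarge : ∀ᶠ x : ℝ in Filter.atTop, Real.exp 1 ≤ x ∧ 2 * A * C₇ ^ 2 ≤ x ∧ C₆ ≤ x ∧ c₂ ≤ x ∧
      Real.log x ≤ b * x ∧ Real.log x ≤ (C₄ / (4 * R)) ^ 2 * x ∧ (c₂ / c₁) ^ 2 ≤ x ∧
      4 * c₂ ^ 2 ≤ x := by
    have hlog : ∀ t : ℝ, 0 < t → ∀ᶠ x : ℝ in Filter.atTop, Real.log x ≤ t * x := by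
      intro t ht
      filter_upwards [Real.isLittleO_log_id_atTop.bound ht, Filter.eventually_ge_atTop 1] with x hx hx1
      rw [Real.norm_of_nonneg (Real.log_nonneg hx1), id, Real.norm_of_nonneg (by linarith)] at hx
      exact hx
    have hR0 : 0 < R := by linarith
    filter_upwards [Filter.eventually_ge_atTop (Real.exp 1), Filter.eventually_ge_atTop (2 * A * C₇ ^ 2),
      Filter.eventually_ge_atTop C₆, Filter.eventually_ge_atTop c₂, hlog b hb,
      hlog ((C₄ / (4 * R)) ^ 2) (by positivity), Filter.eventually_ge_atTop ((c₂ / c₁) ^ 2),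
      Filter.eventually_ge_atTop (4 * c₂ ^ 2)] with x h1 h2 h3 h4 h5 h6 h7 h8
    exact ⟨h1, h2, h3, h4, h5, h6, h7, h8⟩
  have hlim : Filter.Tendsto (fun n : ℕ => (n : ℝ) ^ β) Filter.atTop Filter.atTop :=
    (tendsto_rpow_atTop hβ0).comp tendsto_natCast_atTop_atTop
  obtain ⟨n₂, hn₂⟩ := Filter.eventually_atTop.1 (hlim.eventually hlarge)
  refine ⟨c₁, β, min c 1, max (max n₁ n₂) 1, hc₁0, hβ0, by linarith, lt_min hc0 one_pos, ?_⟩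
  intro n hn ι κ _ _ _ _ hι hκ hιn hκn μ _ hμ B G B' G' hGB hG hB hGB' hG' hB' α hα1 hα2
  obtain ⟨hx1, hx2, hx3, hx4, hx5, hx6, hx7, hx8⟩ :=
    hn₂ n (le_trans (le_trans (le_max_right _ _) (le_max_left _ _)) hn)
  have hn1 : 1 ≤ n := (le_max_right _ _).trans hn
  have hnn₁ : n₁ ≤ n := le_trans (le_trans (le_max_left _ _) (le_max_left _ _)) hn
  have hn0 : (0 : ℝ) < n := by exact_mod_cast hn1
  have hn1' : (1 : ℝ) ≤ n := by exact_mod_cast hn1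
  have hnβ : (n : ℝ) ^ (-β) = ((n : ℝ) ^ β)⁻¹ := Real.rpow_neg hn0.le _
  have hnx : (n : ℝ) = ((n : ℝ) ^ β) ^ (104 / c₃) := by
    rw [← Real.rpow_mul hn0.le, hβ]
    rw [show c₃ / 104 * (104 / c₃) = 1 by field_simp, Real.rpow_one]
  have hD₀ : (n : ℝ) ^ (β / α) = ((n : ℝ) ^ β) ^ α⁻¹ := by
    rw [← Real.rpow_mul hn0.le, div_eq_mul_inv]
  have hxn : ((n : ℝ) ^ β) ^ 5 ≤ n := by
    rw [← Real.rpow_mul_natCast hn0.le]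
    calc (n : ℝ) ^ (β * (5 : ℕ)) ≤ (n : ℝ) ^ (1 : ℝ) :=
          Real.rpow_le_rpow_of_exponent_le hn1' (by push_cast; linarith)
      _ = n := Real.rpow_one _
  rw [hnβ] at hα1
  rw [hD₀]
  generalize (n : ℝ) ^ β = x at *
  have hx1' : 1 ≤ x := by
    have := Real.add_one_le_exp (1 : ℝ)
    linarith
  have hx2' : 2 ≤ x := by
    have := Real.add_one_le_exp (1 : ℝ)
    linarith
  have hx0 : 0 < x := by linarith
  have hα0 : 0 < α := (inv_pos.2 hx0).trans_le hα1
  have hαx : α⁻¹ ≤ x := inv_le_of_inv_le₀ hx0 hα1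
  have hx25 : ∀ j : ℕ, j ≤ 5 → x ^ j ≤ n := fun j hj => (pow_le_pow_right₀ hx1' hj).trans hxn
  have hαn : 1 ≤ α * n := by
    calc (1 : ℝ) = x⁻¹ * x := (inv_mul_cancel₀ hx0.ne').symm
      _ ≤ α * n := mul_le_mul hα1 (by simpa using hx25 1 (by norm_num)) hx0.le hα0.le
  obtain ⟨m, q, hm1, hmn, hm2, hm3, hq1, hqn, hq2, hqm1, hqm2⟩ :=
    exists_block_sizes hn1 hc₃0 hc₃1 hα0 hαn hα2
  have hsα : √α ≤ √(m / n) := Real.sqrt_le_sqrt (by rw [le_div_iff₀ hn0]; exact hm2)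
  have hsn0 : 0 < √(n : ℝ) := Real.sqrt_pos.2 hn0
  set D : ℕ → ℝ := fun j => 2 ^ j * (√n / (2 * c₂)) with hD
  have hDge : ∀ j, √n / (2 * c₂) ≤ D j := fun j =>
    le_mul_of_one_le_left (by positivity) (one_le_pow₀ one_le_two)
  have hxD : x ≤ √n / (2 * c₂) := by
    rw [le_div_iff₀ (by positivity)]
    refine Real.le_sqrt_of_sq_le ?_
    calc (x * (2 * c₂)) ^ 2 = 4 * c₂ ^ 2 * x ^ 2 := by ring
      _ ≤ x * x ^ 2 := by gcongr
      _ = x ^ 3 := by ring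
      _ ≤ n := hx25 3 (by norm_num)
  have hxgD : x ≤ 2 * (c₁ * √(m / n)) * (√n / (2 * c₂)) := by
    have h1 : x ^ 2 * (c₂ / c₁) ≤ √n := by
      refine Real.le_sqrt_of_sq_le ?_
      calc (x ^ 2 * (c₂ / c₁)) ^ 2 = (c₂ / c₁) ^ 2 * x ^ 4 := by ring
        _ ≤ x * x ^ 4 := by gcongr
        _ = x ^ 5 := by ring
        _ ≤ n := hxn
    have h2 : x⁻¹ ≤ √(m / n) := by
      refine le_trans ?_ hsα
      refine Real.le_sqrt_of_sq_le (le_trans ?_ hα1)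
      rw [sq]
      exact mul_le_of_le_one_left (by positivity) (inv_le_one_of_one_le₀ hx1')
    calc x = 2 * (c₁ * x⁻¹) * (x ^ 2 * (c₂ / c₁) / (2 * c₂)) := by field_simp
      _ ≤ _ := by gcongr
  have hDN : x ^ α⁻¹ ≤ 2 ^ n * (√n / (2 * c₂)) := by
    have h1 : x ^ α⁻¹ ≤ 2 ^ n := by
      have hlogx : Real.log x ≤ x := (Real.log_le_sub_one_of_pos hx0).trans (by linarith)
      have hlogx0 : 0 ≤ Real.log x := Real.log_nonneg hx1'
      have h2 : x * x * 2 ≤ n := by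
        calc x * x * 2 ≤ x * x * x := by gcongr
          _ = x ^ 3 := by ring
          _ ≤ n := hx25 3 (by norm_num)
      have hl2 := Real.log_two_gt_d9
      have hn2 : (1 : ℝ) / 2 * n ≤ Real.log 2 * n := by gcongr; linarith
      rw [Real.rpow_def_of_pos hx0, ← Real.rpow_natCast 2 n, Real.rpow_def_of_pos two_pos]
      refine Real.exp_le_exp.2 ?_
      have h3 : Real.log x * α⁻¹ ≤ x * x := mul_le_mul hlogx hαx (by positivity) hx0.le
      linarith
    refine h1.trans (le_mul_of_one_le_right (by positivity) (hx1'.trans hxD))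
  clear_value D
  -- `Lev j` and `Lev' j` are the events that all blocks of `y`, respectively `z`, are structured beyond the
  -- scale `D j`; `Sp` and `Sp'` are the events that `z`, respectively `y`, is nearly sparse. The system is
  -- symmetric, so the primed events are estimated through the transposed matrix.
  set Lev : ℕ → Set (ι × κ → ℝ) := fun j => {x' | OpBound (entryMatrix x') (K * √n) ∧ ∃ y z σ, 0 < σ ∧
        SingularSystem (entryMatrix x') B B' y z σ ∧ L⁻¹ ≤ l2 y ∧ l2 y ≤ L ∧ l2 z ≤ L ∧
        StructuredBlocks y q m n (D j) x c₁ c₂ ∧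
        (∃ I : Finset ι, I.card = m ∧ Unstructured y I (D j) (c₁ * √(m / n)) x) ∧
        (∃ J : Finset κ, J.card = m ∧ Unstructured z J (D j) (c₁ * √(m / n)) x)} with hLev
  set Lev' : ℕ → Set (ι × κ → ℝ) := fun j => {x' | OpBound (entryMatrix x')ᵀ (K * √n) ∧
      ∃ z y σ, 0 < σ ∧ SingularSystem (entryMatrix x')ᵀ B' B z y σ ∧ L⁻¹ ≤ l2 z ∧ l2 z ≤ L ∧ l2 y ≤ L ∧
        StructuredBlocks z q m n (D j) x c₁ c₂ ∧
        (∃ J : Finset κ, J.card = m ∧ Unstructured z J (D j) (c₁ * √(m / n)) x) ∧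
        (∃ I : Finset ι, I.card = m ∧ Unstructured y I (D j) (c₁ * √(m / n)) x)} with hLev'
  set Sp : Set (ι × κ → ℝ) := {x' | OpBound (entryMatrix x') (K * √n) ∧ ∃ y z σ, 0 < σ ∧
        SingularSystem (entryMatrix x') B B' y z σ ∧ L⁻¹ ≤ l2 y ∧ L⁻¹ ≤ l2 z ∧ l2 z ≤ L ∧
        NearSparse z (η * n) ε} with hSp
  set Sp' : Set (ι × κ → ℝ) := {x' | OpBound (entryMatrix x')ᵀ (K * √n) ∧ ∃ z y σ, 0 < σ ∧
        SingularSystem (entryMatrix x')ᵀ B' B z y σ ∧ L⁻¹ ≤ l2 z ∧ L⁻¹ ≤ l2 y ∧ l2 y ≤ L ∧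
        NearSparse y (η * n) ε} with hSp'
  have hSpb : (Measure.pi fun _ : ι × κ => μ) Sp ≤ ENNReal.ofReal (Real.exp (-c * n)) :=
    hsparse n hnn₁ ι κ hι hκ hκn μ hμ B G B' hGB hG hB hB'
  have hSpb' : (Measure.pi fun _ : ι × κ => μ) Sp' ≤ ENNReal.ofReal (Real.exp (-c * n)) := by
    rw [hSp', measure_entryMatrix_transpose μ fun M => OpBound M (K * √n) ∧ ∃ z y σ, 0 < σ ∧
        SingularSystem M B' B z y σ ∧ L⁻¹ ≤ l2 z ∧ L⁻¹ ≤ l2 y ∧ l2 y ≤ L ∧ NearSparse y (η * n) ε]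
    exact hsparse n hnn₁ κ ι hκ hι hιn μ hμ B' G' B hGB' hG' hB' hB
  have hρ : ∀ j, D j ≤ x ^ α⁻¹ → 4 * (x / (4 * D j) * C₄) / (√b * (c₁ * √(m / n) / 2)) +
      Real.exp (-(4 * b) * (x / 2) ^ 2) + 2 * Real.exp (-(x / (4 * D j) * C₄ * D j / R) ^ 2) ≤
      C₇ * x ^ 2 / D j := fun j hj =>
    level_smallBall_le hx1' hα0 hαx hsα hb hc₁0 hC₄0 hx5 hx6 (hx1'.trans (hxD.trans (hDge j))) hj
  have hρ1 : 1 ≤ C₇ * x ^ 2 := one_le_mul_of_one_le_of_one_le (by linarith) (one_le_pow₀ hx1')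
  have hgD : ∀ j, x ≤ 2 * (c₁ * √(m / n)) * D j := fun j => hxgD.trans (by gcongr; exact hDge j)
  have hLevb : ∀ j, D j ≤ x ^ α⁻¹ →
      (Measure.pi fun _ : ι × κ => μ) (Lev j) ≤ ENNReal.ofReal (Real.exp (-(n : ℝ))) := by
    intro j hj
    have h1D : 1 ≤ D j := hx1'.trans (hxD.trans (hDge j))
    refine (measure_level_le hμ hιn hκn hm1 hmn hqn h1D hx1' hK hL hB₀
      hc₁0 hc₂1 hx4 (hgD j) (hxD.trans (hDge j)) hρ1 hC₄ (hρ j hj) B G B' hGB hG hB hB').trans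
      (ENNReal.ofReal_le_ofReal ?_)
    exact level_bound_le hn1 hx1 hxn hnx hA0.le hC₆0.le hx2 hx3 hc₃0 hα0 hαx hm2 hm3 hqm2 hq2 h1D hj
  have hLevb' : ∀ j, D j ≤ x ^ α⁻¹ →
      (Measure.pi fun _ : ι × κ => μ) (Lev' j) ≤ ENNReal.ofReal (Real.exp (-(n : ℝ))) := by
    intro j hj
    have h1D : 1 ≤ D j := hx1'.trans (hxD.trans (hDge j))
    rw [hLev']
    rw [measure_entryMatrix_transpose μ fun M => OpBound M (K * √n) ∧
      ∃ z y σ, 0 < σ ∧ SingularSystem M B' B z y σ ∧ L⁻¹ ≤ l2 z ∧ l2 z ≤ L ∧ l2 y ≤ L ∧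
        StructuredBlocks z q m n (D j) x c₁ c₂ ∧
        (∃ J : Finset κ, J.card = m ∧ Unstructured z J (D j) (c₁ * √(m / n)) x) ∧
        (∃ I : Finset ι, I.card = m ∧ Unstructured y I (D j) (c₁ * √(m / n)) x)]
    refine (measure_level_le hμ hκn hιn hm1 hmn hqn h1D hx1' hK hL hB₀
      hc₁0 hc₂1 hx4 (hgD j) (hxD.trans (hDge j)) hρ1 hC₄ (hρ j hj) B' G' B hGB' hG' hB' hB).trans
      (ENNReal.ofReal_le_ofReal ?_)
    exact level_bound_le hn1 hx1 hxn hnx hA0.le hC₆0.le hx2 hx3 hc₃0 hα0 hαx hm2 hm3 hqm2 hq2 h1D hj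
  set J := (Finset.range n).filter fun j => D j ≤ x ^ α⁻¹ with hJ
  have hcover : {x' | OpBound (entryMatrix x') (K * √n) ∧ ∃ y z σ, 0 < σ ∧
        SingularSystem (entryMatrix x') B B' y z σ ∧ L⁻¹ ≤ l2 y ∧ l2 y ≤ L ∧ L⁻¹ ≤ l2 z ∧ l2 z ≤ L ∧
        ¬ Unstructured y Finset.univ (x ^ α⁻¹) (c₁ * √α) x} ⊆
      (Sp ∪ Sp') ∪ ((⋃ j ∈ J, Lev j) ∪ ⋃ j ∈ J, Lev' j) := by
    rintro x' ⟨hM, y, z, σ, hσ, hsys, hy1, hy2, hz1, hz2, hu⟩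
    have hKn : 0 ≤ K * √n := by positivity
    by_cases h1 : NearSparse z (η * n) ε
    · exact Or.inl (Or.inl ⟨hM, y, z, σ, hσ, hsys, hy1, hz1, hz2, h1⟩)
    by_cases h2 : NearSparse y (η * n) ε
    · exact Or.inl (Or.inr ⟨hM.transpose hKn, z, y, σ, hσ, hsys.transpose, hz1, hy1, hy2, h2⟩)
    obtain ⟨S', hS'1, hS'2⟩ := exists_spread hn0 (by exact_mod_cast hκn) hη0 hε0 (by linarith) hz2 h1
    obtain ⟨S, hS1, hS2⟩ := exists_spread hn0 (by exact_mod_cast hιn) hη0 hε0 (by linarith) hy2 h2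
    obtain ⟨j, hjn, hjD, hI, hJ', hor⟩ := exists_level hn0 hc₁0 hc₂0 hx0.le hS1 hS'1 hq1 hqm1 hS2 hS'2
      (by positivity) (mul_le_mul_of_nonneg_left hsα hc₁0.le) hDN hu
    have hDj : D j = 2 ^ j * (√n / (2 * c₂)) := by rw [hD]
    rw [← hDj] at hjD hI hJ' hor
    have hjJ : j ∈ J := Finset.mem_filter.2 ⟨Finset.mem_range.2 hjn, hjD⟩
    right
    rcases hor with h | h
    · left
      exact Set.mem_biUnion hjJ ⟨hM, y, z, σ, hσ, hsys, hy1, hy2, hz2, h, hI, hJ'⟩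
    · right
      exact Set.mem_biUnion hjJ ⟨hM.transpose hKn, z, y, σ, hσ, hsys.transpose, hz1, hz2, hy2, h, hJ', hI⟩
  have hJc : (J.card : ℝ) ≤ n := by
    have := (Finset.card_filter_le (Finset.range n) fun j => D j ≤ x ^ α⁻¹).trans_eq
      (Finset.card_range n)
    exact_mod_cast this
  have hU := measure_biUnion_le_ofReal (ν := Measure.pi fun _ : ι × κ => μ) J Lev _
    (fun j hj => hLevb j (Finset.mem_filter.1 hj).2)
  have hU' := measure_biUnion_le_ofReal (ν := Measure.pi fun _ : ι × κ => μ) J Lev' _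
    (fun j hj => hLevb' j (Finset.mem_filter.1 hj).2)
  refine (measure_mono hcover).trans ((measure_union_le _ _).trans ((add_le_add
    ((measure_union_le _ _).trans (add_le_add hSpb hSpb'))
    ((measure_union_le _ _).trans (add_le_add hU hU'))).trans ?_))
  rw [← ENNReal.ofReal_add (by positivity) (by positivity),
    ← ENNReal.ofReal_add (by positivity) (by positivity),
    ← ENNReal.ofReal_add (by positivity) (by positivity)]
  refine ENNReal.ofReal_le_ofReal ?_
  have f1 : Real.exp (-c * n) ≤ Real.exp (-min c 1 * n) := by
    refine Real.exp_le_exp.2 ?_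
    have := mul_le_mul_of_nonneg_right (min_le_left c 1) hn0.le
    linarith
  have f2 : Real.exp (-(n : ℝ)) ≤ Real.exp (-min c 1 * n) := by
    refine Real.exp_le_exp.2 ?_
    have := mul_le_mul_of_nonneg_right (min_le_right c 1) hn0.le
    linarith
  have f3 : Real.exp (-c * n) ≤ n * Real.exp (-min c 1 * n) :=
    f1.trans (le_mul_of_one_le_left (Real.exp_pos _).le hn1')
  have f4 : J.card * Real.exp (-(n : ℝ)) ≤ n * Real.exp (-min c 1 * n) :=
    mul_le_mul hJc f2 (Real.exp_pos _).le hn0.le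
  linarith

end Levels

/-! ### Variational bounds for singular values -/

section Variational

open Module

variable {E F : Type*} [NormedAddCommGroup E] [InnerProductSpace ℝ E] [FiniteDimensional ℝ E]
  [NormedAddCommGroup F] [InnerProductSpace ℝ F] [FiniteDimensional ℝ F]

lemma norm_sq_apply_eq_sum (T : E →ₗ[ℝ] F) (v : E) :
    ‖T v‖ ^ 2 = ∑ k : Fin (finrank ℝ E), T.singularValues k ^ 2 *
      (T.isSymmetric_adjoint_comp_self.eigenvectorBasis rfl).repr v k ^ 2 := by
  have h1 : ‖T v‖ ^ 2 = inner ℝ ((LinearMap.adjoint T ∘ₗ T) v) v := by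
    rw [LinearMap.comp_apply, LinearMap.adjoint_inner_left, real_inner_self_eq_norm_sq]
  rw [h1, ← (T.isSymmetric_adjoint_comp_self.eigenvectorBasis rfl).repr.inner_map_map]
  rw [PiLp.inner_apply]
  refine Finset.sum_congr rfl fun k _ => ?_
  rw [LinearMap.IsSymmetric.eigenvectorBasis_apply_self_apply, T.sq_singularValues_fin rfl k]
  simp
  ring

/-- On some subspace of dimension `i + 1` the map expands at least by its singular value of index `i`. -/
lemma exists_finrank_eq_forall_le_norm (T : E →ₗ[ℝ] F) {i : ℕ} (hi : i < finrank ℝ E) :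
    ∃ U : Submodule ℝ E, finrank ℝ U = i + 1 ∧ ∀ v ∈ U, T.singularValues i * ‖v‖ ≤ ‖T v‖ := by
  set b := T.isSymmetric_adjoint_comp_self.eigenvectorBasis rfl with hb
  set f : Fin (i + 1) → E := fun k => b (Fin.castLE hi k) with hf
  have hli : LinearIndependent ℝ f :=
    b.orthonormal.linearIndependent.comp _ (Fin.castLE_injective hi)
  refine ⟨Submodule.span ℝ (Set.range f), by rw [finrank_span_eq_card hli, Fintype.card_fin], ?_⟩
  intro v hv
  have h0 : ∀ k : Fin (finrank ℝ E), i < k → b.repr v k = 0 := by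
    intro k hk
    induction hv using Submodule.span_induction with
    | mem x hx =>
      obtain ⟨l, rfl⟩ := hx
      rw [hf, b.repr_self, PiLp.single_apply, if_neg]
      intro h
      have := congrArg Fin.val h
      simp at this
      omega
    | zero => simp
    | add x y _ _ hx hy => rw [map_add, PiLp.add_apply, hx, hy, add_zero]
    | smul a x _ hx => rw [map_smul, PiLp.smul_apply, hx, smul_zero]
  refine le_of_sq_le_sq ?_ (norm_nonneg _)
  rw [mul_pow, norm_sq_apply_eq_sum, ← b.repr.norm_map v, EuclideanSpace.norm_sq_eq, Finset.mul_sum]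
  refine Finset.sum_le_sum fun k _ => ?_
  rw [Real.norm_eq_abs, sq_abs]
  by_cases hk : i < (k : ℕ)
  · rw [h0 k hk]
    simp
  · refine mul_le_mul_of_nonneg_right ?_ (sq_nonneg _)
    exact pow_le_pow_left₀ (T.singularValues_nonneg i) (T.singularValues_antitone (not_lt.1 hk)) 2

/-- Outside of `i` dimensions the map expands at most by its singular value of index `i`. -/
lemma exists_linearMap_forall_norm_le (T : E →ₗ[ℝ] F) {i : ℕ} (hi : i < finrank ℝ E) :
    ∃ φ : E →ₗ[ℝ] (Fin i → ℝ), ∀ v, φ v = 0 → ‖T v‖ ≤ T.singularValues i * ‖v‖ := by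
  set b := T.isSymmetric_adjoint_comp_self.eigenvectorBasis rfl with hb
  refine ⟨LinearMap.pi fun k => b.toBasis.coord (Fin.castLE hi.le k), fun v hv => ?_⟩
  refine le_of_sq_le_sq ?_ (mul_nonneg (T.singularValues_nonneg i) (norm_nonneg _))
  rw [mul_pow, norm_sq_apply_eq_sum, ← b.repr.norm_map v, EuclideanSpace.norm_sq_eq, Finset.mul_sum]
  refine Finset.sum_le_sum fun k _ => ?_
  rw [Real.norm_eq_abs, sq_abs]
  by_cases hk : i ≤ (k : ℕ)
  · refine mul_le_mul_of_nonneg_right ?_ (sq_nonneg _)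
    exact pow_le_pow_left₀ (T.singularValues_nonneg k) (T.singularValues_antitone hk) 2
  · have h1 := congrFun hv ⟨k, not_le.1 hk⟩
    have h2 : b.repr v k = 0 := by simpa using h1
    rw [h2]
    simp

/-- Comparison of singular values of two maps that are close on the kernel of `ψ`, up to a contraction
between the domains. -/
lemma singularValues_le_add {E' F' W : Type*} [NormedAddCommGroup E'] [InnerProductSpace ℝ E']
    [FiniteDimensional ℝ E'] [NormedAddCommGroup F'] [InnerProductSpace ℝ F'] [FiniteDimensional ℝ F']
    [AddCommGroup W] [Module ℝ W] [FiniteDimensional ℝ W]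
    (T : E →ₗ[ℝ] F) (T' : E' →ₗ[ℝ] F') (Q : E →ₗ[ℝ] E') (ψ : E →ₗ[ℝ] W) {i i' : ℕ} {C : ℝ}
    (hQ : ∀ v, ‖Q v‖ ≤ ‖v‖) (hTT' : ∀ v, ψ v = 0 → ‖T v‖ ≤ ‖T' (Q v)‖ + C * ‖v‖)
    (hi : i < finrank ℝ E') (hi' : i' < finrank ℝ E) (h : i + finrank ℝ W < i' + 1) :
    T.singularValues i' ≤ T'.singularValues i + C := by
  obtain ⟨U, hU, hU2⟩ := exists_finrank_eq_forall_le_norm T hi'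
  obtain ⟨φ, hφ⟩ := exists_linearMap_forall_norm_le T' hi
  set Φ : U →ₗ[ℝ] (Fin i → ℝ) × W := ((φ ∘ₗ Q).prod ψ) ∘ₗ U.subtype with hΦ
  have hker : LinearMap.ker Φ ≠ ⊥ := LinearMap.ker_ne_bot_of_finrank_lt (by
    rw [finrank_prod, hU, finrank_fin_fun]; exact h)
  obtain ⟨⟨v, hvU⟩, hv, hv0⟩ := Submodule.exists_mem_ne_zero_of_ne_bot hker
  rw [LinearMap.mem_ker, hΦ, LinearMap.comp_apply, LinearMap.prod_apply] at hv
  have hv1 : φ (Q v) = 0 := congrArg Prod.fst hv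
  have hv2 : ψ v = 0 := congrArg Prod.snd hv
  have hv0' : v ≠ 0 := fun h => hv0 (Subtype.ext h)
  have hvp : 0 < ‖v‖ := norm_pos_iff.2 hv0'
  refine le_of_mul_le_mul_right ?_ hvp
  calc T.singularValues i' * ‖v‖ ≤ ‖T v‖ := hU2 v hvU
    _ ≤ ‖T' (Q v)‖ + C * ‖v‖ := hTT' v hv2
    _ ≤ T'.singularValues i * ‖v‖ + C * ‖v‖ := by
        gcongr
        exact (hφ _ hv1).trans (mul_le_mul_of_nonneg_left (hQ v) (T'.singularValues_nonneg i))
    _ = _ := by ring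

end Variational

/-! ### Singular values of matrices -/

section MatrixSingularValues

variable {ι κ : Type*} [Fintype ι] [Fintype κ] [DecidableEq ι] [DecidableEq κ]

/-- The singular values, in decreasing order, of a real matrix with arbitrary finite index types. -/
noncomputable def singVal (A : Matrix ι κ ℝ) (i : ℕ) : ℝ := (Matrix.toEuclideanLin A).singularValues i

lemma singVal_nonneg (A : Matrix ι κ ℝ) (i : ℕ) : 0 ≤ singVal A i :=
  LinearMap.singularValues_nonneg _ i

lemma norm_toEuclideanLin (A : Matrix ι κ ℝ) (v : EuclideanSpace ℝ κ) :
    ‖Matrix.toEuclideanLin A v‖ = l2 (A *ᵥ v.ofLp) := rfl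

lemma opBound_norm (A : Matrix ι κ ℝ) : OpBound A ‖A‖ := fun v =>
  Matrix.l2_opNorm_mulVec A (WithLp.toLp 2 v)

lemma singVal_le_add (A B : Matrix ι κ ℝ) (i : ℕ) : singVal A i ≤ singVal B i + ‖A - B‖ := by
  by_cases hi : i < Fintype.card κ
  · refine singularValues_le_add (W := Fin 0 → ℝ) (Matrix.toEuclideanLin A) (Matrix.toEuclideanLin B)
      LinearMap.id 0 (fun v => le_rfl) (fun v _ => ?_) ?_ ?_ ?_
    · have h1 : A *ᵥ v.ofLp = B *ᵥ v.ofLp + (A - B) *ᵥ v.ofLp := by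
        rw [Matrix.sub_mulVec]; abel
      rw [LinearMap.id_apply, norm_toEuclideanLin, norm_toEuclideanLin, h1]
      exact (l2_add_le _ _).trans (add_le_add le_rfl (opBound_norm (A - B) _))
    · simpa using hi
    · simpa using hi
    · simp
  · have h1 : singVal A i = 0 := LinearMap.singularValues_of_finrank_le _ (by simpa using hi)
    rw [h1]
    exact add_nonneg (singVal_nonneg B i) (norm_nonneg _)

lemma continuous_singVal (i : ℕ) : Continuous fun A : Matrix ι κ ℝ => singVal A i := by
  have h : LipschitzWith 1 fun A : Matrix ι κ ℝ => singVal A i := by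
    refine LipschitzWith.of_le_add fun A B => ?_
    rw [dist_eq_norm]
    exact singVal_le_add A B i
  exact h.continuous

/-- Right singular vectors. -/
lemma exists_transpose_mulVec_eq (A : Matrix ι κ ℝ) {i : ℕ} (hi : i < Fintype.card κ) :
    ∃ v : κ → ℝ, l2 v = 1 ∧ Aᵀ *ᵥ (A *ᵥ v) = singVal A i ^ 2 • v := by
  have h := (Matrix.toEuclideanLin A).hasEigenvalue_adjoint_comp_self_sq_singularValues
    (n := i) (by simpa using hi)
  obtain ⟨v, hv⟩ := h.exists_hasEigenvector
  have hv1 := hv.apply_eq_smul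
  rw [← Matrix.toEuclideanLin_conjTranspose_eq_adjoint, Matrix.conjTranspose_eq_transpose_of_trivial] at hv1
  have hv2 : Aᵀ *ᵥ (A *ᵥ v.ofLp) = singVal A i ^ 2 • v.ofLp := congrArg WithLp.ofLp hv1
  have hv0 : 0 < l2 v.ofLp := by
    have : l2 v.ofLp = ‖v‖ := rfl
    rw [this]
    exact norm_pos_iff.2 hv.2
  refine ⟨(l2 v.ofLp)⁻¹ • v.ofLp, ?_, ?_⟩
  · rw [l2_smul, abs_of_pos (inv_pos.2 hv0), inv_mul_cancel₀ hv0.ne']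
  · rw [Matrix.mulVec_smul, Matrix.mulVec_smul, hv2, smul_comm]

lemma l2_mulVec_sq (A : Matrix ι κ ℝ) (v : κ → ℝ) : l2 (A *ᵥ v) ^ 2 = v ⬝ᵥ (Aᵀ *ᵥ (A *ᵥ v)) := by
  rw [l2_sq_eq_dotProduct, Matrix.dotProduct_mulVec, ← Matrix.mulVec_transpose, dotProduct_comm]

/-- The image of a unit right singular vector has norm the singular value. -/
lemma l2_mulVec_eq {A : Matrix ι κ ℝ} {v : κ → ℝ} {σ : ℝ} (hσ : 0 ≤ σ) (hv : l2 v = 1)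
    (h : Aᵀ *ᵥ (A *ᵥ v) = σ ^ 2 • v) : l2 (A *ᵥ v) = σ := by
  have h1 := l2_mulVec_sq A v
  rw [h, dotProduct_smul, ← l2_sq_eq_dotProduct, hv, smul_eq_mul, one_pow, mul_one] at h1
  exact (pow_left_inj₀ (l2_nonneg _) hσ two_ne_zero).1 h1

/-- Left singular vectors. -/
lemma exists_mulVec_transpose_eq (A : Matrix ι κ ℝ) {i : ℕ} (hi : i < Fintype.card κ)
    (hσ : 0 < singVal A i) :
    ∃ w : ι → ℝ, l2 w = 1 ∧ A *ᵥ (Aᵀ *ᵥ w) = singVal A i ^ 2 • w := by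
  obtain ⟨v, hv, hAv⟩ := exists_transpose_mulVec_eq A hi
  refine ⟨(singVal A i)⁻¹ • (A *ᵥ v), ?_, ?_⟩
  · rw [l2_smul, l2_mulVec_eq hσ.le hv hAv, abs_of_pos (inv_pos.2 hσ), inv_mul_cancel₀ hσ.ne']
  · rw [Matrix.mulVec_smul, Matrix.mulVec_smul, hAv, Matrix.mulVec_smul, smul_comm]

lemma singVal_pos_of_mulVec_ne_zero {A : Matrix ι κ ℝ} (hA : ∀ v, A *ᵥ v = 0 → v = 0) {i : ℕ}
    (hi : i < Fintype.card κ) : 0 < singVal A i := by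
  refine (singVal_nonneg A i).lt_of_ne fun h0 => ?_
  obtain ⟨v, hv, hAv⟩ := exists_transpose_mulVec_eq A hi
  rw [← h0] at hAv
  have h1 := l2_mulVec_eq le_rfl hv hAv
  rw [hA v (l2_eq_zero.1 h1), l2_zero] at hv
  exact zero_ne_one hv

lemma eq_zero_of_singVal_pos {A : Matrix ι κ ℝ} (h : singVal A (Fintype.card κ - 1) ≠ 0) (v : κ → ℝ)
    (hv : A *ᵥ v = 0) : v = 0 := by
  have hinj : Function.Injective (Matrix.toEuclideanLin A) := by
    rw [LinearMap.injective_iff_forall_lt_finrank_singularValues_pos]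
    intro i hi
    rw [finrank_euclideanSpace] at hi
    exact ((singVal_nonneg A _).lt_of_ne h.symm).trans_le
      (LinearMap.singularValues_antitone _ (by omega))
  have h1 : Matrix.toEuclideanLin A (WithLp.toLp 2 v) = 0 := by
    rw [Matrix.toLpLin_toLp, Matrix.toLin'_apply, hv]
    rfl
  have h2 := hinj (h1.trans (map_zero _).symm)
  simpa using congrArg WithLp.ofLp h2

/-- The matrix without its column `j`. -/
def dropCol (A : Matrix ι κ ℝ) (j : κ) : Matrix ι {k // k ≠ j} ℝ := A.submatrix id Subtype.val

lemma sum_ne_eq (f : κ → ℝ) (j : κ) : ∑ k : {k // k ≠ j}, f k = ∑ k, f k - f j := by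
  rw [← Finset.sum_subtype (Finset.univ.erase j) (by simp) f, Finset.sum_erase_eq_sub (Finset.mem_univ j)]

lemma dropCol_mulVec (A : Matrix ι κ ℝ) (j : κ) (v : κ → ℝ) :
    dropCol A j *ᵥ (fun k => v k.1) = A *ᵥ v - v j • A.col j := by
  funext a
  simp only [Matrix.mulVec, dotProduct, dropCol, Matrix.submatrix_apply, id, Pi.sub_apply, Pi.smul_apply,
    smul_eq_mul, Matrix.col_apply]
  rw [sum_ne_eq (fun k => A a k * v k) j]
  ring

lemma dropCol_transpose_mulVec (A : Matrix ι κ ℝ) (j : κ) (w : ι → ℝ) :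
    (dropCol A j)ᵀ *ᵥ w = fun k => (Aᵀ *ᵥ w) k.1 := rfl

lemma l2_subtype_le (j : κ) (v : κ → ℝ) : l2 (fun k : {k // k ≠ j} => v k) ≤ l2 v := by
  refine l2_le_of_sq_le (l2_nonneg v) ?_
  rw [l2_sq, sum_ne_eq (fun k => v k ^ 2) j]
  linarith [sq_nonneg (v j)]

/-- Interlacing, lower half: removing a column lowers the index of a singular value by at most one. -/
lemma singVal_succ_le_dropCol (A : Matrix ι κ ℝ) (j : κ) {i : ℕ} (hi : i + 1 < Fintype.card κ) :
    singVal A (i + 1) ≤ singVal (dropCol A j) i := by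
  have hc : Fintype.card {k // k ≠ j} = Fintype.card κ - 1 := by
    rw [Fintype.card_subtype_compl, Fintype.card_subtype_eq]
  have h := singularValues_le_add (W := ℝ) (Matrix.toEuclideanLin A)
    (Matrix.toEuclideanLin (dropCol A j))
    ((WithLp.linearEquiv 2 ℝ ({k // k ≠ j} → ℝ)).symm.toLinearMap ∘ₗ
      LinearMap.funLeft ℝ ℝ (Subtype.val : {k // k ≠ j} → κ) ∘ₗ
        (WithLp.linearEquiv 2 ℝ (κ → ℝ)).toLinearMap)
    (LinearMap.proj j ∘ₗ (WithLp.linearEquiv 2 ℝ (κ → ℝ)).toLinearMap) (i := i) (i' := i + 1) (C := 0)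
    (fun v => l2_subtype_le j v.ofLp) (fun v hv => ?_)
    (by rw [finrank_euclideanSpace, hc]; omega) (by rw [finrank_euclideanSpace]; exact hi) (by simp)
  · rw [add_zero] at h
    exact h
  · have hv' : v.ofLp j = 0 := hv
    have h1 := dropCol_mulVec A j v.ofLp
    rw [hv', zero_smul, sub_zero] at h1
    rw [zero_mul, add_zero, norm_toEuclideanLin, norm_toEuclideanLin, ← h1]
    rfl

/-- Interlacing, upper half: removing a column does not increase the singular values. -/
lemma singVal_dropCol_le (A : Matrix ι κ ℝ) (j : κ) {i : ℕ} (hi : i + 1 < Fintype.card κ) :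
    singVal (dropCol A j) i ≤ singVal A i := by
  have hc : Fintype.card {k // k ≠ j} = Fintype.card κ - 1 := by
    rw [Fintype.card_subtype_compl, Fintype.card_subtype_eq]
  have hext : ∀ v : {k // k ≠ j} → ℝ,
      (fun k : {k // k ≠ j} => Function.extend Subtype.val v 0 (k : κ)) = v := fun v =>
    funext fun k => Subtype.val_injective.extend_apply v 0 k
  have hext0 : ∀ v : {k // k ≠ j} → ℝ, Function.extend Subtype.val v (0 : κ → ℝ) j = 0 := fun v =>
    Function.extend_apply' _ _ _ fun ⟨k, hk⟩ => k.2 hk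
  have h := singularValues_le_add (W := Fin 0 → ℝ) (Matrix.toEuclideanLin (dropCol A j))
    (Matrix.toEuclideanLin A)
    ((WithLp.linearEquiv 2 ℝ (κ → ℝ)).symm.toLinearMap ∘ₗ
      Function.ExtendByZero.linearMap ℝ (Subtype.val : {k // k ≠ j} → κ) ∘ₗ
        (WithLp.linearEquiv 2 ℝ ({k // k ≠ j} → ℝ)).toLinearMap)
    0 (i := i) (i' := i) (C := 0)
    (fun v => ?_) (fun v hv => ?_)
    (by rw [finrank_euclideanSpace]; omega) (by rw [finrank_euclideanSpace, hc]; omega) (by simp)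
  · rw [add_zero] at h
    exact h
  · refine l2_le_of_sq_le (norm_nonneg _) ?_
    have h1 := sum_ne_eq (fun k => Function.extend Subtype.val v.ofLp (0 : κ → ℝ) k ^ 2) j
    have h2 : ∑ k : {k // k ≠ j}, Function.extend Subtype.val v.ofLp (0 : κ → ℝ) k ^ 2
        = ∑ k, v.ofLp k ^ 2 :=
      Finset.sum_congr rfl fun k _ => by rw [congrFun (hext v.ofLp) k]
    simp only [hext0] at h1
    rw [EuclideanSpace.real_norm_sq_eq, ← h2, h1]
    exact le_of_eq (by simp)
  · rw [zero_mul, add_zero, norm_toEuclideanLin, norm_toEuclideanLin]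
    have h1 := dropCol_mulVec A j (Function.extend Subtype.val v.ofLp 0)
    rw [hext, hext0, zero_smul, sub_zero] at h1
    rw [h1]
    rfl

/-- The left singular vectors of the matrix without column `j` are almost orthogonal to that column
when the coordinate `j` of a right singular vector is large and the two singular values are close. -/
lemma abs_mul_abs_dotProduct_col_le {A : Matrix ι κ ℝ} {j : κ} {v : κ → ℝ} {w : ι → ℝ} {σ σ' : ℝ}
    (hσ : 0 < σ) (hv : l2 v = 1) (hw : l2 w = 1) (hAv : Aᵀ *ᵥ (A *ᵥ v) = σ ^ 2 • v)
    (hAw : dropCol A j *ᵥ ((dropCol A j)ᵀ *ᵥ w) = σ' ^ 2 • w) :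
    σ * (|v j| * |w ⬝ᵥ A.col j|) ≤ |σ' ^ 2 - σ ^ 2| := by
  have hu := l2_mulVec_eq hσ.le hv hAv
  set u := A *ᵥ v with hudef
  have h1 : dropCol A j *ᵥ ((dropCol A j)ᵀ *ᵥ u) = σ ^ 2 • u - (σ ^ 2 * v j) • A.col j := by
    rw [dropCol_transpose_mulVec, dropCol_mulVec, hAv, Matrix.mulVec_smul, Pi.smul_apply, smul_eq_mul]
  have h2 : w ⬝ᵥ (dropCol A j *ᵥ ((dropCol A j)ᵀ *ᵥ u))
      = (dropCol A j *ᵥ ((dropCol A j)ᵀ *ᵥ w)) ⬝ᵥ u := by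
    rw [Matrix.dotProduct_mulVec, ← Matrix.mulVec_transpose, Matrix.mulVec_transpose _ u,
      dotProduct_comm, ← Matrix.dotProduct_mulVec, dotProduct_comm]
  rw [h1, hAw, dotProduct_sub, dotProduct_smul, dotProduct_smul, smul_dotProduct, smul_eq_mul,
    smul_eq_mul, smul_eq_mul] at h2
  have h3 : σ ^ 2 * (v j * (w ⬝ᵥ A.col j)) = -((σ' ^ 2 - σ ^ 2) * (w ⬝ᵥ u)) := by linarith
  have h4 : σ ^ 2 * (|v j| * |w ⬝ᵥ A.col j|) = |σ' ^ 2 - σ ^ 2| * |w ⬝ᵥ u| := by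
    have := congrArg abs h3
    rwa [abs_mul, abs_mul, abs_neg, abs_mul, abs_of_pos (by positivity : 0 < σ ^ 2)] at this
  have h5 := abs_dotProduct_le w u
  rw [hw, hu, one_mul] at h5
  have h6 := mul_le_mul_of_nonneg_left h5 (abs_nonneg (σ' ^ 2 - σ ^ 2))
  refine le_of_mul_le_mul_right ?_ hσ
  calc σ * (|v j| * |w ⬝ᵥ A.col j|) * σ = σ ^ 2 * (|v j| * |w ⬝ᵥ A.col j|) := by ring
    _ ≤ _ := h4.trans_le h6

end MatrixSingularValues

/-! ### The square root of a positive definite matrix -/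

section SquareRoot

variable {ι κ : Type*} [Fintype ι] [Fintype κ] [DecidableEq ι] [DecidableEq κ]
  {S : Matrix ι ι ℝ} {L : ℝ}

lemma sqrt_mul_sqrt (hS : S.PosDef) : CFC.sqrt S * CFC.sqrt S = S :=
  CFC.sqrt_mul_sqrt_self S hS.posSemidef.nonneg

lemma transpose_sqrt (S : Matrix ι ι ℝ) : (CFC.sqrt S)ᵀ = CFC.sqrt S := by
  have h : (CFC.sqrt S).PosSemidef := Matrix.nonneg_iff_posSemidef.1 (CFC.sqrt_nonneg S)
  have := h.isHermitian
  rwa [Matrix.IsHermitian, Matrix.conjTranspose_eq_transpose_of_trivial] at this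

lemma l2_sqrt_mulVec_sq (hS : S.PosDef) (v : ι → ℝ) : l2 (CFC.sqrt S *ᵥ v) ^ 2 = v ⬝ᵥ (S *ᵥ v) := by
  rw [l2_mulVec_sq, transpose_sqrt, Matrix.mulVec_mulVec, sqrt_mul_sqrt hS]

lemma dotProduct_mulVec_le (h : ‖S‖ ≤ L ^ 2) (v : ι → ℝ) :
    v ⬝ᵥ (S *ᵥ v) ≤ (L * l2 v) ^ 2 := by
  calc v ⬝ᵥ (S *ᵥ v) ≤ l2 v * l2 (S *ᵥ v) := (le_abs_self _).trans (abs_dotProduct_le _ _)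
    _ ≤ l2 v * (L ^ 2 * l2 v) :=
        mul_le_mul_of_nonneg_left ((opBound_norm S).mono h v) (l2_nonneg v)
    _ = _ := by ring

lemma opBound_sqrt (hS : S.PosDef) (hL : 0 ≤ L) (h : ‖S‖ ≤ L ^ 2) : OpBound (CFC.sqrt S) L := by
  intro v
  have h1 := dotProduct_mulVec_le h v
  rw [← l2_sqrt_mulVec_sq hS] at h1
  exact le_of_sq_le_sq h1 (mul_nonneg hL (l2_nonneg v))

lemma posDef_mul_inv (hS : S.PosDef) : S * S⁻¹ = 1 :=
  Matrix.mul_nonsing_inv S ((Matrix.isUnit_iff_isUnit_det S).1 hS.isUnit)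

lemma posDef_inv_mul (hS : S.PosDef) : S⁻¹ * S = 1 :=
  Matrix.nonsing_inv_mul S ((Matrix.isUnit_iff_isUnit_det S).1 hS.isUnit)

lemma le_l2_sqrt_mulVec (hS : S.PosDef) (hL : 0 ≤ L) (h : ‖S⁻¹‖ ≤ L ^ 2) (v : ι → ℝ) :
    l2 v ≤ L * l2 (CFC.sqrt S *ᵥ v) := by
  set T := CFC.sqrt S with hT
  set r := S⁻¹ *ᵥ v with hr
  have hv : T *ᵥ (T *ᵥ r) = v := by
    rw [Matrix.mulVec_mulVec, sqrt_mul_sqrt hS, hr, Matrix.mulVec_mulVec, posDef_mul_inv hS,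
      Matrix.one_mulVec]
  have h1 : l2 (T *ᵥ r) ≤ L * l2 v := by
    have h2 := l2_sqrt_mulVec_sq hS r
    have h3 : S *ᵥ r = v := by rw [hr, Matrix.mulVec_mulVec, posDef_mul_inv hS, Matrix.one_mulVec]
    rw [h3, dotProduct_comm, hr] at h2
    exact le_of_sq_le_sq (h2.trans_le (dotProduct_mulVec_le h v)) (mul_nonneg hL (l2_nonneg v))
  have h4 : l2 v ^ 2 = (T *ᵥ v) ⬝ᵥ (T *ᵥ r) := by
    conv_lhs => rw [l2_sq_eq_dotProduct]
    nth_rewrite 2 [← hv]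
    rw [Matrix.dotProduct_mulVec, ← Matrix.mulVec_transpose, transpose_sqrt]
  have h5 := (le_abs_self _).trans (abs_dotProduct_le (T *ᵥ v) (T *ᵥ r))
  rw [← h4] at h5
  rcases (l2_nonneg v).eq_or_lt with h0 | h0
  · rw [← h0]
    exact mul_nonneg hL (l2_nonneg _)
  · refine le_of_mul_le_mul_right ?_ h0
    calc l2 v * l2 v = l2 v ^ 2 := (sq _).symm
      _ ≤ l2 (T *ᵥ v) * l2 (T *ᵥ r) := h5
      _ ≤ l2 (T *ᵥ v) * (L * l2 v) := mul_le_mul_of_nonneg_left h1 (l2_nonneg _)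
      _ = _ := by ring

lemma inv_mulVec_sqrt_mulVec_sqrt (hS : S.PosDef) (v : ι → ℝ) :
    S⁻¹ *ᵥ (CFC.sqrt S *ᵥ (CFC.sqrt S *ᵥ v)) = v := by
  rw [Matrix.mulVec_mulVec _ (CFC.sqrt S), sqrt_mul_sqrt hS, Matrix.mulVec_mulVec, posDef_inv_mul hS,
    Matrix.one_mulVec]

/-- Singular system of a right singular vector of `Σ^{1/2} M`. -/
lemma singularSystem_of_right (hS : S.PosDef) {M : Matrix ι κ ℝ} {v : κ → ℝ} {σ : ℝ} (hσ : 0 < σ)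
    (h : (CFC.sqrt S * M)ᵀ *ᵥ ((CFC.sqrt S * M) *ᵥ v) = σ ^ 2 • v) :
    SingularSystem M S⁻¹ 1 (CFC.sqrt S *ᵥ (σ⁻¹ • ((CFC.sqrt S * M) *ᵥ v))) v σ := by
  refine ⟨?_, ?_⟩
  · rw [Matrix.mulVec_smul, Matrix.mulVec_smul, smul_smul, mul_inv_cancel₀ hσ.ne', one_smul,
      ← Matrix.mulVec_mulVec, inv_mulVec_sqrt_mulVec_sqrt hS]
  · rw [Matrix.one_mulVec, Matrix.mulVec_smul, Matrix.mulVec_smul]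
    rw [Matrix.transpose_mul, transpose_sqrt, ← Matrix.mulVec_mulVec _ Mᵀ] at h
    rw [h, smul_smul]
    congr 1
    field_simp

/-- Singular system of a left singular vector of `Σ^{1/2} M`. -/
lemma singularSystem_of_left (hS : S.PosDef) {M : Matrix ι κ ℝ} {w : ι → ℝ} {σ : ℝ} (hσ : 0 < σ)
    (h : (CFC.sqrt S * M) *ᵥ ((CFC.sqrt S * M)ᵀ *ᵥ w) = σ ^ 2 • w) :
    SingularSystem M S⁻¹ 1 (CFC.sqrt S *ᵥ w) (σ⁻¹ • ((CFC.sqrt S * M)ᵀ *ᵥ w)) σ := by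
  refine ⟨?_, ?_⟩
  · have h1 := congrArg (fun u => S⁻¹ *ᵥ (CFC.sqrt S *ᵥ u)) h
    simp only [Matrix.mulVec_smul] at h1
    rw [← Matrix.mulVec_mulVec _ (CFC.sqrt S) M, inv_mulVec_sqrt_mulVec_sqrt hS] at h1
    rw [Matrix.mulVec_smul, h1, smul_smul]
    congr 1
    field_simp
  · rw [Matrix.one_mulVec, smul_smul, mul_inv_cancel₀ hσ.ne', one_smul, Matrix.transpose_mul,
      transpose_sqrt, Matrix.mulVec_mulVec]

end SquareRoot

/-! ### The law of the entries -/

section Law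

/-- Laws with mean zero, variance one and bounded fourth moment are uniformly spread. With `D` the
squared difference of two independent samples, `E D = 2` and `E D ^ 2` is bounded, while
`D ≤ 1 + R ^ 2 * 1_W + D ^ 2 / R ^ 2` where `W` is the event that `1 ≤ D ≤ R ^ 2`. -/
lemma exists_isSpreadLaw (m₄ : ℝ) :
    ∃ b R : ℝ, 0 < b ∧ 1 ≤ R ∧ ∀ (μ : Measure ℝ) [IsProbabilityMeasure μ], MemLp id 4 μ →
      ∫ x, x ∂μ = 0 → ∫ x, x ^ 2 ∂μ = 1 → ∫ x, x ^ 4 ∂μ ≤ m₄ → IsSpreadLaw μ b R := by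
  set R : ℝ := 32 * (|m₄| + 1) with hR
  have hR1 : 1 ≤ R := by
    have := abs_nonneg m₄
    linarith
  have hR0 : 0 < R := by linarith
  refine ⟨1 / (2 * R ^ 2), R, by positivity, hR1, fun μ _ hL h1 h2 h4 => ⟨by positivity, hR1, ?_⟩⟩
  have i4 : Integrable (fun x : ℝ => x ^ 4) μ := by
    have := hL.integrable_norm_pow (by norm_num)
    refine this.congr (Filter.Eventually.of_forall fun x => ?_)
    simpa using Even.pow_abs (by decide : Even 4) x
  have i2 : Integrable (fun x : ℝ => x ^ 2) μ := by
    have := (hL.mono_exponent (p := 2) (by norm_num)).integrable_sq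
    exact this
  have i1 : Integrable (fun x : ℝ => x) μ := by
    have := hL.integrable (by norm_num)
    exact this
  have i22 : Integrable (fun q : ℝ × ℝ => q.1 ^ 2 + q.2 ^ 2) (μ.prod μ) :=
    (i2.comp_fst μ).add (i2.comp_snd μ)
  have i11 : Integrable (fun q : ℝ × ℝ => 2 * (q.1 * q.2)) (μ.prod μ) := (i1.mul_prod i1).const_mul 2
  have hsq : ∫ q : ℝ × ℝ, (q.1 - q.2) ^ 2 ∂μ.prod μ = 2 := by
    have e : ∀ q : ℝ × ℝ, (q.1 - q.2) ^ 2 = (q.1 ^ 2 + q.2 ^ 2) - 2 * (q.1 * q.2) := fun q => by ring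
    simp_rw [e]
    rw [integral_sub i22 i11,
      integral_add (i2.comp_fst μ) (i2.comp_snd μ), integral_const_mul,
      integral_prod_mul (fun x : ℝ => x) (fun x : ℝ => x), h1,
      integral_fun_fst (fun x : ℝ => x ^ 2), integral_fun_snd (fun x : ℝ => x ^ 2), h2]
    simp
    norm_num
  have hW : MeasurableSet (pairWindow R) := measurableSet_pairWindow R
  have iW : Integrable (fun q : ℝ × ℝ => R ^ 2 * (pairWindow R).indicator 1 q) (μ.prod μ) :=
    ((integrable_const (1 : ℝ)).indicator hW).const_mul _
  have i44 : Integrable (fun q : ℝ × ℝ => 8 / R ^ 2 * (q.1 ^ 4 + q.2 ^ 4)) (μ.prod μ) :=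
    ((i4.comp_fst μ).add (i4.comp_snd μ)).const_mul _
  have i1W : Integrable (fun q : ℝ × ℝ => 1 + R ^ 2 * (pairWindow R).indicator 1 q) (μ.prod μ) :=
    (integrable_const (1 : ℝ)).add iW
  have hpt : ∀ q : ℝ × ℝ, (q.1 - q.2) ^ 2
      ≤ (1 + R ^ 2 * (pairWindow R).indicator 1 q) + 8 / R ^ 2 * (q.1 ^ 4 + q.2 ^ 4) := by
    intro q
    have h8 : 0 ≤ 8 / R ^ 2 * (q.1 ^ 4 + q.2 ^ 4) := by positivity
    have hind : 0 ≤ R ^ 2 * (pairWindow R).indicator (1 : ℝ × ℝ → ℝ) q :=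
      mul_nonneg (by positivity) (Set.indicator_nonneg (fun _ _ => zero_le_one) _)
    rcases lt_or_ge |q.1 - q.2| 1 with h | h
    · have : (q.1 - q.2) ^ 2 ≤ 1 := by
        rw [← sq_abs]
        exact pow_le_one₀ (abs_nonneg _) h.le
      linarith
    rcases le_or_gt |q.1 - q.2| R with h' | h'
    · rw [Set.indicator_of_mem (show q ∈ pairWindow R from ⟨h, h'⟩)]
      have : (q.1 - q.2) ^ 2 ≤ R ^ 2 := by
        rw [← sq_abs]
        exact pow_le_pow_left₀ (abs_nonneg _) h' 2
      rw [Pi.one_apply]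
      linarith
    · have e1 : (q.1 - q.2) ^ 2 ≤ (q.1 - q.2) ^ 4 / R ^ 2 := by
        rw [le_div_iff₀ (by positivity)]
        have : R ^ 2 ≤ (q.1 - q.2) ^ 2 := by
          rw [← sq_abs (q.1 - q.2)]
          exact pow_le_pow_left₀ hR0.le h'.le 2
        calc (q.1 - q.2) ^ 2 * R ^ 2 ≤ (q.1 - q.2) ^ 2 * (q.1 - q.2) ^ 2 := by gcongr
          _ = _ := by ring
      have e2 : (q.1 - q.2) ^ 4 ≤ 8 * (q.1 ^ 4 + q.2 ^ 4) := by
        nlinarith [sq_nonneg (q.1 + q.2), sq_nonneg (q.1 - q.2), sq_nonneg (q.1 ^ 2 - q.2 ^ 2),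
          sq_nonneg (q.1 ^ 2 + q.2 ^ 2 + 2 * (q.1 * q.2)), sq_nonneg (q.1 * q.2),
          mul_nonneg (sq_nonneg (q.1 + q.2)) (sq_nonneg (q.1 - q.2)),
          mul_nonneg (sq_nonneg (q.1 + q.2)) (add_nonneg (sq_nonneg q.1) (sq_nonneg q.2))]
      have e3 : (q.1 - q.2) ^ 4 / R ^ 2 ≤ 8 / R ^ 2 * (q.1 ^ 4 + q.2 ^ 4) := by
        rw [div_mul_eq_mul_div]
        gcongr
      linarith
  have hint := integral_mono (by
      have : Integrable (fun q : ℝ × ℝ => (q.1 ^ 2 + q.2 ^ 2) - 2 * (q.1 * q.2)) (μ.prod μ) :=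
        i22.sub i11
      exact this.congr (Filter.Eventually.of_forall fun q => by ring))
    (i1W.add i44) hpt
  rw [hsq] at hint
  have hadd : ∫ q : ℝ × ℝ, (1 + R ^ 2 * (pairWindow R).indicator 1 q) + 8 / R ^ 2 * (q.1 ^ 4 + q.2 ^ 4)
      ∂μ.prod μ = 1 + R ^ 2 * (μ.prod μ).real (pairWindow R) + 8 / R ^ 2 * (2 * ∫ x, x ^ 4 ∂μ) := by
    rw [integral_add i1W i44, integral_add (integrable_const (1 : ℝ)) iW,
      integral_const_mul, integral_indicator_one hW, integral_const_mul,
      integral_add (i4.comp_fst μ) (i4.comp_snd μ),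
      integral_fun_fst (fun x : ℝ => x ^ 4), integral_fun_snd (fun x : ℝ => x ^ 4)]
    simp only [integral_const, probReal_univ, one_smul]
    ring
  have hint' : (2 : ℝ) ≤ 1 + R ^ 2 * (μ.prod μ).real (pairWindow R)
      + 8 / R ^ 2 * (2 * ∫ x, x ^ 4 ∂μ) := hint.trans_eq hadd
  have h16 : 8 / R ^ 2 * (2 * ∫ x, x ^ 4 ∂μ) ≤ 1 / 2 := by
    rw [div_mul_eq_mul_div, div_le_iff₀ (by positivity)]
    have e1 : 32 * m₄ ≤ R := by
      have := le_abs_self m₄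
      linarith
    have e2 : R ≤ R ^ 2 := le_self_pow₀ hR1 two_ne_zero
    linarith
  rw [div_le_iff₀ (by positivity)]
  linarith

/-- Reindexing independent variables with the same law along an injection. -/
lemma map_pi_comp_injective {δ δ' : Type*} [Fintype δ] [Fintype δ'] (μ : Measure ℝ)
    [IsProbabilityMeasure μ] {f : δ' → δ} (hf : Function.Injective f) :
    (Measure.pi fun _ : δ => μ).map (fun x e => x (f e)) = Measure.pi fun _ : δ' => μ := by
  have h1 : iIndepFun (fun (e : δ) (x : δ → ℝ) => x e) (Measure.pi fun _ : δ => μ) :=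
    iIndepFun_pi (X := fun _ => id) (fun _ => aemeasurable_id)
  have h2 := (h1.precomp hf).map_fun_eq_pi_map (fun e => (measurable_pi_apply _).aemeasurable)
  rw [h2]
  congr 1
  funext e
  exact (measurePreserving_eval (fun _ : δ => μ) (f e)).map_eq

/-- The matrix without column `j` again has independent entries with law `μ`. -/
lemma measure_dropCol_le {ι κ : Type*} [Fintype ι] [Fintype κ] [DecidableEq κ] (μ : Measure ℝ)
    [IsProbabilityMeasure μ] (j : κ) (P : Matrix ι {k // k ≠ j} ℝ → Prop) :
    (Measure.pi fun _ : ι × κ => μ) {x | P (dropCol (entryMatrix x) j)}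
      ≤ (Measure.pi fun _ : ι × {k // k ≠ j} => μ) {x | P (entryMatrix x)} := by
  have hf : Function.Injective (Prod.map id Subtype.val : ι × {k // k ≠ j} → ι × κ) :=
    Function.injective_id.prodMap Subtype.val_injective
  rw [← map_pi_comp_injective μ hf]
  exact Measure.le_map_apply
    (measurable_pi_lambda (fun (x : ι × κ → ℝ) (e : ι × {k // k ≠ j}) => x (Prod.map id Subtype.val e))
      fun e => measurable_pi_apply _).aemeasurable {x | P (entryMatrix x)}

/-- The law of all entries of the random matrix. -/
lemma HasIIDEntries.map_eq {Ω₀ Ω : Type*} [MeasurableSpace Ω₀] [MeasurableSpace Ω] {P₀ : Measure Ω₀}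
    {ξ : Ω₀ → ℝ} {P : Measure Ω} [IsProbabilityMeasure P] {n p : ℕ} {M : Ω → Matrix (Fin n) (Fin p) ℝ}
    (h : HasIIDEntries P₀ ξ P M) :
    AEMeasurable (fun ω (e : Fin n × Fin p) => M ω e.1 e.2) P ∧
      P.map (fun ω (e : Fin n × Fin p) => M ω e.1 e.2) = Measure.pi fun _ => P₀.map ξ := by
  have hm : ∀ e : Fin n × Fin p, AEMeasurable (fun ω => M ω e.1 e.2) P := fun e =>
    (h.identDistrib e.1 e.2).aemeasurable_fst
  refine ⟨aemeasurable_pi_lambda _ hm, ?_⟩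
  rw [h.indep.map_fun_eq_pi_map hm]
  congr 1
  funext e
  exact (h.identDistrib e.1 e.2).map_eq

end Law

/-! ### Small inner products with a column -/

section Column

variable {ι κ : Type*} [Fintype ι] [Fintype κ] [DecidableEq ι] [DecidableEq κ]

lemma isCompact_l2_le : IsCompact {w : ι → ℝ | l2 w ≤ 1} := by
  refine Metric.isCompact_of_isClosed_isBounded (isClosed_le continuous_l2 continuous_const) ?_
  refine (Metric.isBounded_closedBall (x := (0 : ι → ℝ)) (r := 1)).subset fun w hw => ?_
  rw [mem_closedBall_zero_iff, pi_norm_le_iff_of_nonneg zero_le_one]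
  exact fun i => (abs_le_l2 w i).trans hw

lemma isClosed_exists_mem {X : Type*} [TopologicalSpace X] {Γ : Set (X × (ι → ℝ))} (hΓ : IsClosed Γ)
    (hb : ∀ p ∈ Γ, l2 p.2 ≤ 1) : IsClosed {x | ∃ w, (x, w) ∈ Γ} := by
  have : CompactSpace {w : ι → ℝ // l2 w ≤ 1} := isCompact_iff_compactSpace.1 isCompact_l2_le
  have h1 : IsClosed ((fun p : X × {w : ι → ℝ // l2 w ≤ 1} => (p.1, p.2.1)) ⁻¹' Γ) :=
    hΓ.preimage (continuous_fst.prodMk (continuous_subtype_val.comp continuous_snd))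
  have h2 : {x | ∃ w, (x, w) ∈ Γ}
      = Prod.fst '' ((fun p : X × {w : ι → ℝ // l2 w ≤ 1} => (p.1, p.2.1)) ⁻¹' Γ) := by
    refine Set.Subset.antisymm (fun x hx => ?_) (fun x hx => ?_)
    · obtain ⟨w, hw⟩ := hx
      have hl : l2 w ≤ 1 := hb (x, w) hw
      let w' : {w : ι → ℝ // l2 w ≤ 1} := ⟨w, hl⟩
      exact ⟨(x, w'), hw, rfl⟩
    · obtain ⟨p, hp, hpx⟩ := hx
      rw [← hpx]
      exact ⟨p.2.1, Set.mem_preimage.1 hp⟩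
  rw [h2]
  exact isClosedMap_fst_of_compactSpace _ h1

variable {μ : Measure ℝ} [IsProbabilityMeasure μ]

/-- Let `Γ x` be a closed relation between the matrix and unit vectors that does not involve column `j`.
The probability that `Γ x` contains a vector with small ball property, while all vectors of `Γ x` are
nearly orthogonal to column `j`, is controlled by the small ball function. Quantifying over all vectors
of `Γ x` makes a measurable choice of a vector unnecessary. -/
lemma measure_forall_abs_dotProduct_col_le (T : Matrix ι ι ℝ) (j : κ) {Γ : Set ((ι × κ → ℝ) × (ι → ℝ))}
    (hΓ : IsClosed Γ) (hb : ∀ p ∈ Γ, l2 p.2 ≤ 1) {U : Set (ι → ℝ)} (hU : IsClosed U) {t ρ : ℝ} (ht : 0 < t)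
    (hdep : ∀ x u w, (Function.updateFinset x (Finset.univ ×ˢ {j}) u, w) ∈ Γ ↔ (x, w) ∈ Γ)
    (hρ : ∀ w ∈ U, SmallBall μ (fun e : (Finset.univ ×ˢ {j} : Finset (ι × κ)) => colForm (T *ᵥ w) j e) t ρ) :
    MeasurableSet {x | (∃ w ∈ U, (x, w) ∈ Γ) ∧
        ∀ w, (x, w) ∈ Γ → |(T *ᵥ w) ⬝ᵥ (entryMatrix x).col j| ≤ t} ∧
    (Measure.pi fun _ : ι × κ => μ) {x | (∃ w ∈ U, (x, w) ∈ Γ) ∧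
        ∀ w, (x, w) ∈ Γ → |(T *ᵥ w) ⬝ᵥ (entryMatrix x).col j| ≤ t}
      ≤ ENNReal.ofReal (Real.exp (1 / 2) * ρ) := by
  set F := {x | (∃ w ∈ U, (x, w) ∈ Γ) ∧
        ∀ w, (x, w) ∈ Γ → |(T *ᵥ w) ⬝ᵥ (entryMatrix x).col j| ≤ t} with hF
  have hcont : Continuous fun p : (ι × κ → ℝ) × (ι → ℝ) => |(T *ᵥ p.2) ⬝ᵥ (entryMatrix p.1).col j| := by
    unfold entryMatrix
    simp only [Matrix.mulVec, dotProduct, Matrix.col_apply, Matrix.of_apply]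
    fun_prop
  have hmeas : MeasurableSet F := by
    have h1 : IsClosed {x | ∃ w, (x, w) ∈ Γ ∩ Prod.snd ⁻¹' U} :=
      isClosed_exists_mem (hΓ.inter (hU.preimage continuous_snd)) fun p hp => hb p hp.1
    have h2 : ∀ k : ℕ, IsClosed {x | ∃ w, (x, w) ∈ Γ ∩
        {p | t + 1 / ((k : ℝ) + 1) ≤ |(T *ᵥ p.2) ⬝ᵥ (entryMatrix p.1).col j|}} := fun k =>
      isClosed_exists_mem (hΓ.inter (isClosed_le continuous_const hcont)) fun p hp => hb p hp.1
    -- The strict inequality in the negation of the second condition is a countable union of closed ones.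
    have h3 : F = {x | ∃ w, (x, w) ∈ Γ ∩ Prod.snd ⁻¹' U} ∩ (⋃ k : ℕ, {x | ∃ w, (x, w) ∈ Γ ∩
        {p | t + 1 / ((k : ℝ) + 1) ≤ |(T *ᵥ p.2) ⬝ᵥ (entryMatrix p.1).col j|}})ᶜ := by
      ext x
      constructor
      · rintro ⟨⟨w, hwU, hw⟩, hall⟩
        refine ⟨⟨w, hw, hwU⟩, fun h => ?_⟩
        obtain ⟨k, w', hw', hk⟩ := Set.mem_iUnion.1 h
        have h4 : t + 1 / ((k : ℝ) + 1) ≤ |(T *ᵥ w') ⬝ᵥ (entryMatrix x).col j| := hk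
        have h5 := hall w' hw'
        have h6 : 0 < 1 / ((k : ℝ) + 1) := by positivity
        linarith
      · rintro ⟨⟨w, hw, hwU⟩, hnot⟩
        refine ⟨⟨w, hwU, hw⟩, fun w' hw' => ?_⟩
        by_contra hlt
        obtain ⟨k, hk⟩ := exists_nat_one_div_lt (sub_pos.2 (not_le.1 hlt))
        refine hnot (Set.mem_iUnion.2 ⟨k, w', hw', ?_⟩)
        rw [Set.mem_ofPred_eq]
        linarith
    rw [h3]
    exact h1.measurableSet.inter (MeasurableSet.iUnion fun k => (h2 k).measurableSet).compl
  refine ⟨hmeas, ?_⟩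
  have hm1 : Measurable (F.indicator (1 : (ι × κ → ℝ) → ENNReal)) := measurable_one.indicator hmeas
  have h := lintegral_prod_le_pow (μ := μ) ({()} : Finset Unit) (fun _ => Finset.univ ×ˢ {j})
    (fun _ => F.indicator (1 : (ι × κ → ℝ) → ENNReal)) (ENNReal.ofReal (Real.exp (1 / 2) * ρ))
    (fun _ _ => hm1) (fun r _ s _ hrs => absurd (Subsingleton.elim r s) hrs)
    (fun r _ s _ hrs => absurd (Subsingleton.elim r s) hrs) (fun _ _ x => by
      -- `Γ` does not involve column `j`, so one vector `w` serves for all values of that column.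
      by_cases hx : ∃ w ∈ U, (x, w) ∈ Γ
      · obtain ⟨w, hwU, hw⟩ := hx
        have hcol : ∀ x : ι × κ → ℝ, (T *ᵥ w) ⬝ᵥ (entryMatrix x).col j
            = ∑ e, colForm (T *ᵥ w) j e * x e := fun x => by
          rw [← entryMatrix_transpose_mulVec, dotProduct_comm]
          rfl
        have hle := lmarginal_exp_le (hρ w hwU)
          (ℓ := fun x => (T *ᵥ w) ⬝ᵥ (entryMatrix x).col j) x
          ⟨_, fun u => by rw [hcol, sum_mul_updateFinset]⟩
        rw [ENNReal.ofReal_mul (Real.exp_pos _).le]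
        refine le_trans ?_ (mul_le_mul_right hle _)
        rw [lmarginal, lmarginal, ← lintegral_const_mul' _ _ ENNReal.ofReal_ne_top]
        refine lintegral_mono fun u => ?_
        by_cases hu : Function.updateFinset x (Finset.univ ×ˢ {j}) u ∈ F
        · rw [Set.indicator_of_mem hu, Pi.one_apply, ← ENNReal.ofReal_mul (Real.exp_pos _).le,
            ← Real.exp_add]
          have h1 := hu.2 w ((hdep x u w).2 hw)
          rw [← ENNReal.ofReal_one]
          refine ENNReal.ofReal_le_ofReal (Real.one_le_exp ?_)
          have h2 : ((T *ᵥ w) ⬝ᵥ (entryMatrix (Function.updateFinset x (Finset.univ ×ˢ {j}) u)).col j) ^ 2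
              / (2 * t ^ 2) ≤ 1 / 2 := by
            rw [div_le_iff₀ (by positivity), ← sq_abs]
            have := pow_le_pow_left₀ (abs_nonneg _) h1 2
            linarith
          rw [neg_div]
          linarith
        · rw [Set.indicator_of_notMem hu]
          exact zero_le
      · rw [lmarginal]
        refine le_trans (le_of_eq ?_) zero_le
        rw [lintegral_eq_zero_of_ae_eq_zero]
        refine Filter.Eventually.of_forall fun u => Set.indicator_of_notMem (fun hu => hx ?_) _
        obtain ⟨⟨w, hwU, hw⟩, _⟩ := hu
        exact ⟨w, hwU, (hdep x u w).1 hw⟩)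
  simpa [lintegral_indicator_one hmeas] using h

end Column

/-! ### Reduction of the gap event to small inner products -/

section Gap

variable {ι κ : Type*} [Fintype ι] [Fintype κ] [DecidableEq ι] [DecidableEq κ]

lemma isClosed_unstructured (I : Finset ι) (D g k : ℝ) : IsClosed {a : ι → ℝ | Unstructured a I D g k} := by
  have h : {a : ι → ℝ | Unstructured a I D g k} = ⋂ s : ℝ, ⋂ _ : 0 < s, ⋂ _ : s ≤ D,
      {a : ι → ℝ | (min (g * s) k) ^ 2 ≤ ∑ i ∈ I, distInt (s * a i) ^ 2} := by
    ext a
    simp only [Set.mem_iInter]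
    rfl
  rw [h]
  refine isClosed_iInter fun s => isClosed_iInter fun _ => isClosed_iInter fun _ => ?_
  refine isClosed_le continuous_const (continuous_finsetSum _ fun i _ => ?_)
  exact (continuous_distInt.comp (by fun_prop)).pow 2

/-- The pairs of a matrix `M` (given by its entries) and a unit left singular vector of `T * M` without
its column `j`, for the singular value of index `i`. -/
def leftSingularPairs (T : Matrix ι ι ℝ) (j : κ) (i : ℕ) : Set ((ι × κ → ℝ) × (ι → ℝ)) :=
  {p | l2 p.2 = 1 ∧ (T * dropCol (entryMatrix p.1) j) *ᵥ ((T * dropCol (entryMatrix p.1) j)ᵀ *ᵥ p.2)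
    = singVal (T * dropCol (entryMatrix p.1) j) i ^ 2 • p.2}

lemma isClosed_leftSingularPairs (T : Matrix ι ι ℝ) (j : κ) (i : ℕ) :
    IsClosed (leftSingularPairs T j i) := by
  have hN : Continuous fun p : (ι × κ → ℝ) × (ι → ℝ) => T * dropCol (entryMatrix p.1) j := by
    refine Continuous.matrix_mul continuous_const ?_
    refine Continuous.matrix_submatrix ?_ _ _
    exact continuous_matrix fun a k => (continuous_apply (a, k)).comp continuous_fst
  refine IsClosed.inter (isClosed_eq (continuous_l2.comp continuous_snd) continuous_const)
    (isClosed_eq ?_ ?_)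
  · exact hN.matrix_mulVec (hN.matrix_transpose.matrix_mulVec continuous_snd)
  · exact (((continuous_singVal i).comp hN).pow 2).smul continuous_snd

lemma mem_leftSingularPairs_updateFinset (T : Matrix ι ι ℝ) (j : κ) (i : ℕ) (x : ι × κ → ℝ)
    (u : (Finset.univ ×ˢ {j} : Finset (ι × κ)) → ℝ) (w : ι → ℝ) :
    (Function.updateFinset x (Finset.univ ×ˢ {j}) u, w) ∈ leftSingularPairs T j i ↔
      (x, w) ∈ leftSingularPairs T j i := by
  have h : dropCol (entryMatrix (Function.updateFinset x (Finset.univ ×ˢ {j}) u)) j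
      = dropCol (entryMatrix x) j := by
    ext a k
    exact updateFinset_apply_of_notMem x u (by simpa [eq_comm] using k.2)
  unfold leftSingularPairs
  rw [Set.mem_ofPred_eq, Set.mem_ofPred_eq, h]

/-- Column `j` is nearly orthogonal to all left singular vectors of the matrix without column `j`, one of
which is unstructured. -/
def nearOrthogonalEvent (T : Matrix ι ι ℝ) (j : κ) (i : ℕ) (D g k t : ℝ) : Set (ι × κ → ℝ) :=
  {x | (∃ w ∈ {w | Unstructured (T *ᵥ w) Finset.univ D g k}, (x, w) ∈ leftSingularPairs T j i) ∧
    ∀ w, (x, w) ∈ leftSingularPairs T j i → |(T *ᵥ w) ⬝ᵥ (entryMatrix x).col j| ≤ t}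

lemma measure_nearOrthogonalEvent_le {μ : Measure ℝ} [IsProbabilityMeasure μ] {b R D g k t : ℝ}
    (hμ : IsSpreadLaw μ b R) (T : Matrix ι ι ℝ) (j : κ) (i : ℕ) (hD : 0 < D) (hg : 0 < g) (ht : 0 < t) :
    MeasurableSet (nearOrthogonalEvent T j i D g k t) ∧
    (Measure.pi fun _ : ι × κ => μ) (nearOrthogonalEvent T j i D g k t) ≤ ENNReal.ofReal (Real.exp (1 / 2) *
      (4 * t / (√b * g) + Real.exp (-(4 * b) * k ^ 2) + 2 * Real.exp (-(t * D / R) ^ 2))) := by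
  refine measure_forall_abs_dotProduct_col_le T j (isClosed_leftSingularPairs T j i) (fun p hp => hp.1.le)
    ((isClosed_unstructured Finset.univ D g k).preimage (by fun_prop)) ht
    (fun x u w => mem_leftSingularPairs_updateFinset T j i x u w) fun w hw => ?_
  exact smallBall_colForm hμ hD hg ht hw j

lemma OpBound.dropCol {M : Matrix ι κ ℝ} {B : ℝ} (hM : OpBound M B) (hB : 0 ≤ B) (j : κ) :
    OpBound (dropCol M j) B := by
  have h := hM.transpose hB
  have h1 : OpBound (_root_.dropCol M j)ᵀ B := fun w => by
    rw [dropCol_transpose_mulVec]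
    exact (l2_subtype_le j _).trans (h w)
  have h2 := h1.transpose hB
  rwa [Matrix.transpose_transpose] at h2

/-- A small gap forces one of three rare events: a nearly sparse right singular vector, a structured left
singular vector of a matrix with one column removed, or many columns nearly orthogonal to such a
vector. -/
lemma gap_cover {S : Matrix ι ι ℝ} {K L n η ε D g k δ : ℝ} {i : ℕ} (hS : S.PosDef) (hK : 0 ≤ K) (hL : 1 ≤ L)
    (hSL : ‖S‖ ≤ L ^ 2) (hSL' : ‖S⁻¹‖ ≤ L ^ 2) (hn : 0 < n) (hκ : (Fintype.card κ : ℝ) ≤ n) (hη : 0 < η)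
    (hε : 0 < ε) (hi : i + 1 < Fintype.card κ) {x : ι × κ → ℝ} (hM : OpBound (entryMatrix x) (K * √n))
    (hσ : singVal (entryMatrix x) (Fintype.card κ - 1) ≠ 0)
    (hgap : singVal (CFC.sqrt S * entryMatrix x) i ^ 2 - singVal (CFC.sqrt S * entryMatrix x) (i + 1) ^ 2
      ≤ singVal (CFC.sqrt S * entryMatrix x) (i + 1) * (δ / √n)) :
    (∃ y z σ, 0 < σ ∧ SingularSystem (entryMatrix x) S⁻¹ 1 y z σ ∧ L⁻¹ ≤ l2 y ∧ L⁻¹ ≤ l2 z ∧ l2 z ≤ L ∧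
      NearSparse z (η * n) ε) ∨
    (∃ j, OpBound (dropCol (entryMatrix x) j) (K * √n) ∧ ∃ y z σ, 0 < σ ∧
      SingularSystem (dropCol (entryMatrix x) j) S⁻¹ 1 y z σ ∧ L⁻¹ ≤ l2 y ∧ l2 y ≤ L ∧ L⁻¹ ≤ l2 z ∧
      l2 z ≤ L ∧ ¬ Unstructured y Finset.univ D g k) ∨
    ∃ J : Finset κ, ε ^ 2 / (2 * (L / √η) ^ 2) * n ≤ J.card ∧
      ∀ j ∈ J, x ∈ nearOrthogonalEvent (CFC.sqrt S) j i D g k (δ / (ε / 2)) := by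
  have hL0 : 0 < L := by linarith
  have hLi : L⁻¹ ≤ 1 := inv_le_one_of_one_le₀ hL
  have hsn : 0 < √n := Real.sqrt_pos.2 hn
  have hTn : ∀ w, l2 w = 1 → L⁻¹ ≤ l2 (CFC.sqrt S *ᵥ w) ∧ l2 (CFC.sqrt S *ᵥ w) ≤ L := by
    intro w hw
    have h1 := le_l2_sqrt_mulVec hS hL0.le hSL' w
    have h2 := opBound_sqrt hS hL0.le hSL w
    rw [hw] at h1 h2
    refine ⟨?_, by linarith⟩
    rw [inv_le_iff_one_le_mul₀ hL0]
    linarith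
  set M := entryMatrix x with hMdef
  set T := CFC.sqrt S with hT
  -- The hypothesis on the last singular value makes `M` injective, hence all singular values in question
  -- positive.
  have hAker : ∀ v, (T * M) *ᵥ v = 0 → v = 0 := by
    intro v hv
    refine eq_zero_of_singVal_pos hσ v ?_
    rw [← Matrix.mulVec_mulVec] at hv
    have h1 := le_l2_sqrt_mulVec hS hL0.le hSL' (M *ᵥ v)
    rw [← hT, hv, l2_zero, mul_zero] at h1
    exact l2_eq_zero.1 (le_antisymm h1 (l2_nonneg _))
  have hσ0 : 0 < singVal (T * M) (i + 1) := singVal_pos_of_mulVec_ne_zero hAker hi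
  obtain ⟨v, hv, hAv⟩ := exists_transpose_mulVec_eq (T * M) hi
  have hsys := singularSystem_of_right hS hσ0 hAv
  have hy := hTn ((singVal (T * M) (i + 1))⁻¹ • ((T * M) *ᵥ v)) (by
    rw [l2_smul, l2_mulVec_eq hσ0.le hv hAv, abs_of_pos (inv_pos.2 hσ0), inv_mul_cancel₀ hσ0.ne'])
  by_cases hsp : NearSparse v (η * n) ε
  · exact Or.inl ⟨_, v, _, hσ0, hsys, hy.1, by rw [hv]; exact hLi, by rw [hv]; exact hL, hsp⟩
  right
  obtain ⟨J, hJ, hJ2⟩ := exists_spread hn hκ hη hε hL0 (by rw [hv]; exact hL) hsp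
  rw [or_iff_not_imp_left]
  intro hbad
  push Not at hbad
  refine ⟨J, hJ, fun j hj => ?_⟩
  have hint1 : singVal (T * M) (i + 1) ≤ singVal (T * dropCol M j) i := singVal_succ_le_dropCol (T * M) j hi
  have hint2 : singVal (T * dropCol M j) i ≤ singVal (T * M) i := singVal_dropCol_le (T * M) j hi
  have hσ'0 := hσ0.trans_le hint1
  have hc : Fintype.card {k // k ≠ j} = Fintype.card κ - 1 := by
    rw [Fintype.card_subtype_compl, Fintype.card_subtype_eq]
  obtain ⟨w, hw, hAw⟩ := exists_mulVec_transpose_eq (T * dropCol M j) (by rw [hc]; omega) hσ'0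
  refine ⟨⟨w, ?_, hw, hAw⟩, ?_⟩
  · have hz : l2 ((singVal (T * dropCol M j) i)⁻¹ • ((T * dropCol M j)ᵀ *ᵥ w)) = 1 := by
      have h1 : l2 ((T * dropCol M j)ᵀ *ᵥ w) = singVal (T * dropCol M j) i :=
        l2_mulVec_eq hσ'0.le hw (by rw [Matrix.transpose_transpose]; exact hAw)
      rw [l2_smul, h1, abs_of_pos (inv_pos.2 hσ'0), inv_mul_cancel₀ hσ'0.ne']
    have hTw := hTn w hw
    exact hbad j (hM.dropCol (by positivity) j) _ _ _ hσ'0 (singularSystem_of_left hS hσ'0 hAw) hTw.1 hTw.2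
      (by rw [hz]; exact hLi) (by rw [hz]; exact hL)
  · rintro w ⟨hw, hAw⟩
    have h1 := abs_mul_abs_dotProduct_col_le hσ0 hv hw hAv (j := j) hAw
    have h2 : |singVal (T * dropCol M j) i ^ 2 - singVal (T * M) (i + 1) ^ 2|
        ≤ singVal (T * M) (i + 1) * (δ / √n) := by
      rw [abs_of_nonneg (sub_nonneg.2 (pow_le_pow_left₀ hσ0.le hint1 2))]
      have := pow_le_pow_left₀ hσ'0.le hint2 2
      linarith
    have h3 : |v j| * |w ⬝ᵥ (T * M).col j| ≤ δ / √n := le_of_mul_le_mul_left (h1.trans h2) hσ0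
    have h4 : (T *ᵥ w) ⬝ᵥ M.col j = w ⬝ᵥ (T * M).col j := by
      have h5 : (T * M).col j = T *ᵥ M.col j := by
        funext a
        rfl
      rw [h5, Matrix.dotProduct_mulVec, ← Matrix.mulVec_transpose, transpose_sqrt]
    rw [h4, le_div_iff₀ (by positivity)]
    have h6 := mul_le_mul_of_nonneg_right (hJ2 j hj).1 (abs_nonneg (w ⬝ᵥ (T * M).col j))
    have h7 := mul_le_mul_of_nonneg_right (h6.trans h3) hsn.le
    calc |w ⬝ᵥ (T * M).col j| * (ε / 2) = ε / 2 / √n * |w ⬝ᵥ (T * M).col j| * √n := by field_simp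
      _ ≤ δ / √n * √n := h7
      _ = δ := by field_simp

/-- Markov's inequality for the number of events that occur. -/
lemma measure_le_card_le {X : Type*} [MeasurableSpace X] (ν : Measure X) {F : κ → Set X} {B c : ℝ}
    (hF : ∀ j, MeasurableSet (F j)) (hB : ∀ j, ν (F j) ≤ ENNReal.ofReal B) (hc : 0 < c) :
    ν {x | ∃ J : Finset κ, c ≤ J.card ∧ ∀ j ∈ J, x ∈ F j} ≤ ENNReal.ofReal (Fintype.card κ * B / c) := by
  have hm : Measurable fun x => ∑ j, (F j).indicator (1 : X → ENNReal) x :=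
    Finset.measurable_sum _ fun j _ => measurable_one.indicator (hF j)
  have h1 := mul_meas_ge_le_lintegral (μ := ν) hm (ENNReal.ofReal c)
  have h2 : ∫⁻ x, ∑ j, (F j).indicator (1 : X → ENNReal) x ∂ν ≤ ENNReal.ofReal (Fintype.card κ * B) := by
    rw [lintegral_finsetSum _ fun j _ => measurable_one.indicator (hF j)]
    simp_rw [lintegral_indicator_one (hF _)]
    refine (Finset.sum_le_card_nsmul _ _ _ fun j _ => hB j).trans ?_
    rw [nsmul_eq_mul, ENNReal.ofReal_mul (Nat.cast_nonneg _), ENNReal.ofReal_natCast, Finset.card_univ]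
  rw [ENNReal.ofReal_div_of_pos hc, ENNReal.le_div_iff_mul_le (Or.inl (by simpa using hc))
    (Or.inl ENNReal.ofReal_ne_top), mul_comm]
  refine le_trans (mul_le_mul_right (measure_mono ?_) _) (h1.trans h2)
  rintro x ⟨J, hJ, hJF⟩
  rw [Set.mem_ofPred_eq]
  calc ENNReal.ofReal c ≤ ENNReal.ofReal J.card := ENNReal.ofReal_le_ofReal hJ
    _ = ∑ j ∈ J, (F j).indicator (1 : X → ENNReal) x := by
        rw [Finset.sum_congr rfl fun j hj => Set.indicator_of_mem (hJF j hj) _]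
        simp
    _ ≤ _ := Finset.sum_le_sum_of_subset (Finset.subset_univ J)

end Gap

/-! ### Numerical estimates -/

section Numerics

/-- The admissible `δ` are at least `exp (-u ^ 2)` with `u` a power of `n`. -/
lemma exp_neg_sq_le {n : ℕ} {c α δ : ℝ} (hn : 1 ≤ n) (hc : 0 ≤ c) (hα : (n : ℝ) ^ (-c) ≤ α)
    (hδ : (n : ℝ) ^ (-c / α) ≤ δ) : Real.exp (-((n : ℝ) ^ c) ^ 2) ≤ δ := by
  have hn1 : (1 : ℝ) ≤ n := by exact_mod_cast hn
  have hn0 : (0 : ℝ) < n := by linarith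
  refine le_trans ?_ hδ
  have h1 : (n : ℝ) ^ (-c / α) = ((n : ℝ) ^ c) ^ (-α⁻¹) := by
    rw [← Real.rpow_mul hn0.le]
    congr 1
    ring
  rw [h1]
  rw [Real.rpow_neg hn0.le] at hα
  have hu1 : 1 ≤ (n : ℝ) ^ c := Real.one_le_rpow hn1 hc
  generalize (n : ℝ) ^ c = u at *
  have hu0 : 0 < u := by linarith
  have hα0 : 0 < α := (inv_pos.2 hu0).trans_le hα
  have hαu : α⁻¹ ≤ u := inv_le_of_inv_le₀ hu0 hα
  rw [Real.rpow_def_of_pos hu0, Real.exp_le_exp]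
  have hlog : Real.log u ≤ u := (Real.log_le_sub_one_of_pos hu0).trans (by linarith)
  have := mul_le_mul hlog hαu (inv_pos.2 hα0).le hu0.le
  linarith

/-- All exceptional probabilities are negligible with respect to `δ`. -/
lemma exists_forall_error_le {b R s β e : ℝ} (hb : 0 < b) (hR : 0 < R) (hs : 0 < s) (hβ0 : 0 < β)
    (hβ1 : β ≤ 1) (he : 0 < e) :
    ∃ n₀ : ℕ, ∀ n : ℕ, n₀ ≤ n → ∀ α δ : ℝ, (n : ℝ) ^ (-(β / 4)) ≤ α → α ≤ β / 4 →
      (n : ℝ) ^ (-(β / 4) / α) ≤ δ →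
      4 * (n : ℝ) ^ 2 * Real.exp (-e * n) ≤ δ ∧ Real.exp (-(4 * b) * ((n : ℝ) ^ β) ^ 2) ≤ δ ∧
        Real.exp (-(δ / s * (n : ℝ) ^ (β / α) / R) ^ 2) ≤ δ := by
  have hlim : Filter.Tendsto (fun n : ℕ => (n : ℝ) ^ (β / 4)) Filter.atTop Filter.atTop :=
    (tendsto_rpow_atTop (by positivity)).comp tendsto_natCast_atTop_atTop
  obtain ⟨n₁, hn₁⟩ := Filter.eventually_atTop.1 ((hlim.eventually_ge_atTop (max (1 / (4 * b)) (s * R))).and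
    (tendsto_natCast_atTop_atTop.eventually_ge_atTop (max (192 / e ^ 3) (4 / e ^ 2))))
  refine ⟨max n₁ 1, fun n hn α δ hα hα2 hδ => ?_⟩
  obtain ⟨hu, hn2⟩ := hn₁ n ((le_max_left _ _).trans hn)
  have hn1 : 1 ≤ n := (le_max_right _ _).trans hn
  have hn1' : (1 : ℝ) ≤ n := by exact_mod_cast hn1
  have hn0 : (0 : ℝ) < n := by linarith
  -- In terms of `u = n ^ (β / 4)`: `δ ≥ exp (-u ^ 2)`, and `δ D ≥ u ^ (3 / α)` for `D = n ^ (β / α)`.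
  have hexp := exp_neg_sq_le hn1 (by positivity) hα hδ
  have hδu : ((n : ℝ) ^ (β / 4)) ^ (-α⁻¹) ≤ δ := by
    refine le_trans (le_of_eq ?_) hδ
    rw [← Real.rpow_mul hn0.le]
    congr 1
    ring
  have hDu : (n : ℝ) ^ (β / α) = ((n : ℝ) ^ (β / 4)) ^ (4 * α⁻¹) := by
    rw [← Real.rpow_mul hn0.le]
    congr 1
    ring
  have hku : (n : ℝ) ^ β = ((n : ℝ) ^ (β / 4)) ^ 4 := by
    rw [← Real.rpow_mul_natCast hn0.le]
    congr 1
    push_cast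
    ring
  have hun : ((n : ℝ) ^ (β / 4)) ^ 4 ≤ n := by
    rw [← hku]
    calc (n : ℝ) ^ β ≤ (n : ℝ) ^ (1 : ℝ) := Real.rpow_le_rpow_of_exponent_le hn1' hβ1
      _ = n := Real.rpow_one _
  have hu1 : 1 ≤ (n : ℝ) ^ (β / 4) := Real.one_le_rpow hn1' (by positivity)
  have hα0 : 0 < α := (Real.rpow_pos_of_pos hn0 _).trans_le hα
  rw [hDu, hku]
  clear hDu hku
  generalize (n : ℝ) ^ (β / 4) = u at *
  have hu0 : 0 < u := by linarith
  have hub : 1 / (4 * b) ≤ u := (le_max_left _ _).trans hu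
  have hus : s * R ≤ u := (le_max_right _ _).trans hu
  have hne3 : 192 / e ^ 3 ≤ n := (le_max_left _ _).trans hn2
  have hne2 : 4 / e ^ 2 ≤ n := (le_max_right _ _).trans hn2
  refine ⟨le_trans ?_ hexp, le_trans (Real.exp_le_exp.2 ?_) hexp, le_trans (Real.exp_le_exp.2 ?_) hexp⟩
  · have h1 : 4 * (n : ℝ) ^ 2 ≤ Real.exp (e * n / 2) := by
      refine le_trans ?_ (Real.pow_div_factorial_le_exp (e * n / 2) (by positivity) 3)
      rw [div_le_iff₀ (by positivity)] at hne3
      have h2 := mul_le_mul_of_nonneg_right hne3 (sq_nonneg (n : ℝ))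
      have h3 : (e * n / 2) ^ 3 / (Nat.factorial 3 : ℝ) = (n * e ^ 3) * n ^ 2 / 48 := by
        norm_num [Nat.factorial]
        ring
      rw [h3]
      linarith
    have h4 : u ^ 2 ≤ e * n / 2 := by
      have h5 : (u ^ 2) ^ 2 ≤ (e * n / 2) ^ 2 := by
        rw [div_le_iff₀ (by positivity)] at hne2
        have h6 := mul_le_mul_of_nonneg_right hne2 hn0.le
        calc (u ^ 2) ^ 2 = u ^ 4 := by ring
          _ ≤ (n : ℝ) := hun
          _ ≤ (e * n / 2) ^ 2 := by linarith
      exact le_of_sq_le_sq h5 (by positivity)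
    calc 4 * (n : ℝ) ^ 2 * Real.exp (-e * n) ≤ Real.exp (e * n / 2) * Real.exp (-e * n) := by gcongr
      _ = Real.exp (-(e * n / 2)) := by rw [← Real.exp_add]; congr 1; ring
      _ ≤ Real.exp (-u ^ 2) := Real.exp_le_exp.2 (by linarith)
  · rw [div_le_iff₀ (by positivity)] at hub
    have h1 : 1 ≤ u ^ 5 := one_le_pow₀ hu1
    have h2 : u ^ 2 ≤ (u * (4 * b)) * u ^ 5 * u ^ 2 :=
      le_mul_of_one_le_left (by positivity) (one_le_mul_of_one_le_of_one_le hub h1)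
    linarith
  · have h1 : u ^ 3 ≤ δ * u ^ (4 * α⁻¹) := by
      have hαi : 1 ≤ α⁻¹ := (one_le_inv₀ hα0).2 (by linarith)
      calc u ^ 3 = u ^ (3 : ℝ) := (Real.rpow_natCast u 3).symm.trans (by norm_num)
        _ ≤ u ^ (-α⁻¹ + 4 * α⁻¹) := Real.rpow_le_rpow_of_exponent_le hu1 (by linarith)
        _ = u ^ (-α⁻¹) * u ^ (4 * α⁻¹) := Real.rpow_add hu0 _ _
        _ ≤ _ := by gcongr
    have h2 : u ≤ δ / s * u ^ (4 * α⁻¹) / R := by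
      rw [div_mul_eq_mul_div, div_div, le_div_iff₀ (by positivity)]
      refine le_trans ?_ h1
      have h3 : u * (s * R) ≤ u * u := mul_le_mul_of_nonneg_left hus hu0.le
      have h4 : u * u ≤ u * (u * u) := le_mul_of_one_le_left (by positivity) hu1
      calc u * (s * R) ≤ u * (u * u) := h3.trans h4
        _ = u ^ 3 := by ring
    have := pow_le_pow_left₀ hu0.le h2 2
    linarith

end Numerics

/-! ### The gap bound -/

section Main

lemma opBound_one {ι : Type*} [Fintype ι] [DecidableEq ι] {L : ℝ} (hL : 1 ≤ L) :
    OpBound (1 : Matrix ι ι ℝ) (L ^ 2) := fun v => by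
  rw [Matrix.one_mulVec]
  exact le_mul_of_one_le_left (l2_nonneg v) (one_le_pow₀ hL)

/-- The gap bound for matrices with independent entries of a uniformly spread law. -/
theorem measure_gap_le {b R c₀ K L : ℝ} (hb : 0 < b) (hR : 1 ≤ R) (hc₀ : 0 < c₀) (hK : 1 ≤ K)
    (hL : 1 ≤ L) :
    ∃ c C : ℝ, ∃ n₀ : ℕ, 0 < c ∧ c ≤ 1 ∧ 0 < C ∧ ∀ n : ℕ, n₀ ≤ n → ∀ p : ℕ, c₀ * n ≤ p → p ≤ n →
      ∀ (μ : Measure ℝ) [IsProbabilityMeasure μ], IsSpreadLaw μ b R →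
      ∀ S : Matrix (Fin n) (Fin n) ℝ, S.PosDef → ‖S‖ ≤ L ^ 2 → ‖S⁻¹‖ ≤ L ^ 2 →
      ∀ α δ : ℝ, (n : ℝ) ^ (-c) ≤ α → α ≤ c → (n : ℝ) ^ (-c / α) ≤ δ → ∀ i : ℕ, i + 1 < p →
      (Measure.pi fun _ : Fin n × Fin p => μ) {x | OpBound (entryMatrix x) (K * √n) ∧
        singVal (entryMatrix x) (p - 1) ≠ 0 ∧
        singVal (CFC.sqrt S * entryMatrix x) i ^ 2 - singVal (CFC.sqrt S * entryMatrix x) (i + 1) ^ 2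
          ≤ singVal (CFC.sqrt S * entryMatrix x) (i + 1) * (δ / √n)} ≤ ENNReal.ofReal (C * (δ / √α)) := by
  have hL2 : 1 ≤ L ^ 2 := one_le_pow₀ hL
  have hL0 : 0 < L := by linarith
  have hR0 : 0 < R := by linarith
  obtain ⟨η, ε, e₁, n₁, hη0, _, hε0, _, he₁, hsparse⟩ := measure_nearSparse_le hb hR hc₀ hK hL hL2
  -- The constant is halved since the matrices with one column removed have `p - 1 ≥ p / 2` columns.
  obtain ⟨c₁, β, e₂, n₂, hc₁, hβ0, hβ1, he₂, hstr⟩ := measure_structured_le hb hR (half_pos hc₀) hK hL hL2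
  set e := min e₁ e₂ with he
  have he0 : 0 < e := lt_min he₁ he₂
  set s := ε / 2 with hs
  have hs0 : 0 < s := half_pos hε0
  set c₃ := ε ^ 2 / (2 * (L / √η) ^ 2) with hc₃
  have hsη : 0 < √η := Real.sqrt_pos.2 hη0
  have hc₃0 : 0 < c₃ := by positivity
  have hsb : 0 < √b := Real.sqrt_pos.2 hb
  obtain ⟨n₃, hn₃⟩ := exists_forall_error_le hb hR0 hs0 hβ0 hβ1 he0
  -- Each of the two rare events contributes at most `δ`, and the Markov inequality contributes the rest.
  set C := 2 + Real.exp (1 / 2) * (4 / (s * √b * c₁) + 3) / c₃ with hC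
  refine ⟨β / 4, C, max (max n₁ n₂) (max n₃ 1), by positivity, by linarith, by positivity, ?_⟩
  intro n hn p hp hpn μ _ hμ S hS hSL hSL' α δ hα hα2 hδ i hi
  have hnn₁ : n₁ ≤ n := ((le_max_left _ _).trans (le_max_left _ _)).trans hn
  have hnn₂ : n₂ ≤ n := ((le_max_right _ _).trans (le_max_left _ _)).trans hn
  have hnn₃ : n₃ ≤ n := ((le_max_left _ _).trans (le_max_right _ _)).trans hn
  have hn1 : 1 ≤ n := ((le_max_right _ _).trans (le_max_right _ _)).trans hn
  have hn1' : (1 : ℝ) ≤ n := by exact_mod_cast hn1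
  have hn0 : (0 : ℝ) < n := by linarith
  have hpn' : (p : ℝ) ≤ n := by exact_mod_cast hpn
  obtain ⟨er1, er2, er3⟩ := hn₃ n hnn₃ α δ hα hα2 hδ
  have hα0 : 0 < α := (Real.rpow_pos_of_pos hn0 _).trans_le hα
  have hδ0 : 0 < δ := (Real.rpow_pos_of_pos hn0 _).trans_le hδ
  have hsα : 0 < √α := Real.sqrt_pos.2 hα0
  have hsα1 : √α ≤ 1 := Real.sqrt_le_one.2 (by linarith)
  have hαβ : (n : ℝ) ^ (-β) ≤ α :=
    le_trans (Real.rpow_le_rpow_of_exponent_le hn1' (by linarith)) hα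
  have hG : S * S⁻¹ = 1 := posDef_mul_inv hS
  have hSb : OpBound S (L ^ 2) := (opBound_norm S).mono hSL
  have hSb' : OpBound S⁻¹ (L ^ 2) := (opBound_norm S⁻¹).mono hSL'
  have hp2 : (2 : ℝ) ≤ p := by
    have : 2 ≤ p := by omega
    exact_mod_cast this
  set D := (n : ℝ) ^ (β / α) with hD
  set k := (n : ℝ) ^ β with hk
  set g := c₁ * √α with hg
  have hD0 : 0 < D := Real.rpow_pos_of_pos hn0 _
  have hg0 : 0 < g := by positivity
  set ν := Measure.pi fun _ : Fin n × Fin p => μ with hν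
  set Sp : Set (Fin n × Fin p → ℝ) := {x | OpBound (entryMatrix x) (K * √n) ∧ ∃ y z σ, 0 < σ ∧
    SingularSystem (entryMatrix x) S⁻¹ 1 y z σ ∧ L⁻¹ ≤ l2 y ∧ L⁻¹ ≤ l2 z ∧ l2 z ≤ L ∧
      NearSparse z (η * n) ε} with hSp
  set Bad : Fin p → Set (Fin n × Fin p → ℝ) := fun j => {x | OpBound (dropCol (entryMatrix x) j) (K * √n) ∧
    ∃ y z σ, 0 < σ ∧ SingularSystem (dropCol (entryMatrix x) j) S⁻¹ 1 y z σ ∧ L⁻¹ ≤ l2 y ∧ l2 y ≤ L ∧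
      L⁻¹ ≤ l2 z ∧ l2 z ≤ L ∧ ¬ Unstructured y Finset.univ D g k} with hBad
  set F : Fin p → Set (Fin n × Fin p → ℝ) := fun j =>
    nearOrthogonalEvent (CFC.sqrt S) j i D g k (δ / s) with hF
  have hSpb : ν Sp ≤ ENNReal.ofReal δ := by
    refine (hsparse n hnn₁ (Fin n) (Fin p) (by simpa using hp.trans hpn') (by simpa using hp)
      (by simpa using hpn) μ hμ S⁻¹ S 1 hG hSb hSb' (opBound_one hL)).trans (ENNReal.ofReal_le_ofReal ?_)
    refine le_trans ?_ er1
    have h1 : Real.exp (-e₁ * n) ≤ Real.exp (-e * n) := by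
      have := mul_le_mul_of_nonneg_right (min_le_left e₁ e₂) hn0.le
      exact Real.exp_le_exp.2 (by linarith)
    have h2 : 1 ≤ (n : ℝ) ^ 2 := one_le_pow₀ hn1'
    exact h1.trans (le_mul_of_one_le_left (Real.exp_pos _).le (by linarith))
  have hBadj : ∀ j, ν (Bad j) ≤ ENNReal.ofReal (4 * n * Real.exp (-e * n)) := by
    intro j
    have hc : (Fintype.card {l : Fin p // l ≠ j} : ℝ) = p - 1 := by
      rw [Fintype.card_subtype_compl, Fintype.card_subtype_eq, Fintype.card_fin, Nat.cast_sub (by omega)]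
      simp
    refine (measure_dropCol_le μ j fun M => OpBound M (K * √n) ∧ ∃ y z σ, 0 < σ ∧
      SingularSystem M S⁻¹ 1 y z σ ∧ L⁻¹ ≤ l2 y ∧ l2 y ≤ L ∧ L⁻¹ ≤ l2 z ∧ l2 z ≤ L ∧
        ¬ Unstructured y Finset.univ D g k).trans ?_
    refine (hstr n hnn₂ (Fin n) {l : Fin p // l ≠ j} ?_ ?_ (by simp) ?_ μ hμ S⁻¹ S 1 1 hG hSb hSb'
      (one_mul 1) (opBound_one hL) (opBound_one hL) α hαβ (by linarith)).trans (ENNReal.ofReal_le_ofReal ?_)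
    · rw [Fintype.card_fin]
      linarith
    · rw [hc]
      linarith
    · have : (Fintype.card {l : Fin p // l ≠ j} : ℝ) ≤ n := by rw [hc]; linarith
      exact_mod_cast this
    · have h1 : Real.exp (-e₂ * n) ≤ Real.exp (-e * n) := by
        have := mul_le_mul_of_nonneg_right (min_le_right e₁ e₂) hn0.le
        exact Real.exp_le_exp.2 (by linarith)
      gcongr
  have hBadb : ν (⋃ j ∈ (Finset.univ : Finset (Fin p)), Bad j) ≤ ENNReal.ofReal δ := by
    refine (measure_biUnion_le_ofReal Finset.univ Bad _ fun j _ => hBadj j).trans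
      (ENNReal.ofReal_le_ofReal (le_trans ?_ er1))
    rw [Finset.card_univ, Fintype.card_fin]
    calc (p : ℝ) * (4 * n * Real.exp (-e * n)) ≤ n * (4 * n * Real.exp (-e * n)) := by gcongr
      _ = _ := by ring
  have hFb := measure_le_card_le ν (F := F) (c := c₃ * n)
    (fun j => (measure_nearOrthogonalEvent_le hμ (CFC.sqrt S) j i hD0 hg0 (div_pos hδ0 hs0)).1)
    (fun j => (measure_nearOrthogonalEvent_le hμ (CFC.sqrt S) j i hD0 hg0 (div_pos hδ0 hs0)).2)
    (by positivity)
  have hcover : {x | OpBound (entryMatrix x) (K * √n) ∧ singVal (entryMatrix x) (p - 1) ≠ 0 ∧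
        singVal (CFC.sqrt S * entryMatrix x) i ^ 2 - singVal (CFC.sqrt S * entryMatrix x) (i + 1) ^ 2
          ≤ singVal (CFC.sqrt S * entryMatrix x) (i + 1) * (δ / √n)} ⊆
      (Sp ∪ ⋃ j ∈ (Finset.univ : Finset (Fin p)), Bad j) ∪
        {x | ∃ J : Finset (Fin p), c₃ * n ≤ J.card ∧ ∀ j ∈ J, x ∈ F j} := by
    rintro x ⟨hM, hσ, hgap⟩
    rcases gap_cover (D := D) (g := g) (k := k) hS (by linarith) hL hSL hSL' hn0 (by simpa using hpn') hη0
      hε0 (by simpa using hi) hM (by simpa using hσ) hgap with h | ⟨j, h⟩ | h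
    · exact Or.inl (Or.inl ⟨hM, h⟩)
    · exact Or.inl (Or.inr (Set.mem_biUnion (Finset.mem_univ j) h))
    · exact Or.inr h
  refine (measure_mono hcover).trans ((measure_union_le _ _).trans ((add_le_add
    ((measure_union_le _ _).trans (add_le_add hSpb hBadb)) hFb).trans ?_))
  rw [← ENNReal.ofReal_add hδ0.le hδ0.le, ← ENNReal.ofReal_add (by positivity) (by positivity)]
  refine ENNReal.ofReal_le_ofReal ?_
  have hδα : δ ≤ δ / √α := by
    rw [le_div_iff₀ hsα]
    exact mul_le_of_le_one_right hδ0.le hsα1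
  have hρ : 4 * (δ / s) / (√b * g) + Real.exp (-(4 * b) * k ^ 2) + 2 * Real.exp (-(δ / s * D / R) ^ 2)
      ≤ (4 / (s * √b * c₁) + 3) * (δ / √α) := by
    have h1 : 4 * (δ / s) / (√b * g) = 4 / (s * √b * c₁) * (δ / √α) := by
      rw [hg]
      field_simp
    rw [h1]
    linarith
  have hfin : (Fintype.card (Fin p) : ℝ) * (Real.exp (1 / 2) * (4 * (δ / s) / (√b * g) +
      Real.exp (-(4 * b) * k ^ 2) + 2 * Real.exp (-(δ / s * D / R) ^ 2))) / (c₃ * n)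
      ≤ Real.exp (1 / 2) * (4 / (s * √b * c₁) + 3) / c₃ * (δ / √α) := by
    rw [Fintype.card_fin, div_le_iff₀ (by positivity)]
    calc _ ≤ (n : ℝ) * (Real.exp (1 / 2) * ((4 / (s * √b * c₁) + 3) * (δ / √α))) := by gcongr
      _ = _ := by field_simp
  rw [hC, add_mul]
  linarith

end Main

theorem theorem1p1 (c₀ K L m₄ : ℝ) (hc₀ : 0 < c₀) (hK : 1 ≤ K) (hL : 1 ≤ L) :
    ∃ c C : ℝ, 0 < c ∧ 0 < C ∧
      ∀ {Ω₀ Ω : Type*} [MeasurableSpace Ω₀] [MeasurableSpace Ω]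
        (P₀ : Measure Ω₀) [IsProbabilityMeasure P₀] (P : Measure Ω) [IsProbabilityMeasure P]
        (ξ : Ω₀ → ℝ), MemLp ξ 4 P₀ → ∫ x, ξ x ∂P₀ = 0 → variance ξ P₀ = 1 →
          ∫ x, ξ x ^ 4 ∂P₀ ≤ m₄ →
        ∀ (n p : ℕ), c₀ * (n : ℝ) ≤ (p : ℝ) → p ≤ n →
        ∀ (M : Ω → Matrix (Fin n) (Fin p) ℝ), HasIIDEntries P₀ ξ P M →
        ∀ (S : Matrix (Fin n) (Fin n) ℝ), S.PosDef → ‖S‖ ≤ L ^ 2 → ‖S⁻¹‖ ≤ L ^ 2 →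
        ∀ (α δ : ℝ), (n : ℝ) ^ (-c) ≤ α → α ≤ c → (n : ℝ) ^ (-c / α) ≤ δ →
        ∀ (i : ℕ), i + 1 < p →
          P.real ({ω | matrixSingularValue (CFC.sqrt S * M ω) i ^ 2
                      - matrixSingularValue (CFC.sqrt S * M ω) (i + 1) ^ 2
                    ≤ matrixSingularValue (CFC.sqrt S * M ω) (i + 1) * (δ * (n : ℝ) ^ (-(1 / 2) : ℝ))}
                  ∩ goodEvent M K)
            ≤ C * (δ / √α) := by
  obtain ⟨b, R, hb, hR, hspread⟩ := exists_isSpreadLaw m₄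
  obtain ⟨c, C, n₀, hc0, hc1, hC0, hmain⟩ := measure_gap_le hb hR hc₀ hK hL
  refine ⟨c, max C (Real.exp (((n₀ : ℝ) ^ c) ^ 2)), hc0, lt_max_of_lt_left hC0, ?_⟩
  intro Ω₀ Ω _ _ P₀ _ P _ ξ hξ hmean hvar h4 n p hp hpn M hM S hS hSL hSL' α δ hα hαc hδ i hi
  have hn1 : 1 ≤ n := by omega
  have hn1' : (1 : ℝ) ≤ n := by exact_mod_cast hn1
  have hn0 : (0 : ℝ) < n := by linarith
  have hα0 : 0 < α := (Real.rpow_pos_of_pos hn0 _).trans_le hα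
  have hδ0 : 0 < δ := (Real.rpow_pos_of_pos hn0 _).trans_le hδ
  have hsα : 0 < √α := Real.sqrt_pos.2 hα0
  rcases le_or_gt n₀ n with hn | hn
  · -- The common law of the entries inherits the moment assumptions.
    have hξm : AEMeasurable ξ P₀ := hξ.aestronglyMeasurable.aemeasurable
    have : IsProbabilityMeasure (P₀.map ξ) := Measure.isProbabilityMeasure_map hξm
    have hμ : IsSpreadLaw (P₀.map ξ) b R := by
      refine hspread (P₀.map ξ) ?_ ?_ ?_ ?_
      · rw [memLp_map_measure_iff (by fun_prop) hξm]
        exact hξ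
      · rw [integral_map hξm (by fun_prop)]
        exact hmean
      · rw [integral_map hξm (by fun_prop), ← hvar, variance_of_integral_eq_zero hξm hmean]
      · rw [integral_map hξm (by fun_prop)]
        exact h4
    obtain ⟨hMm, hMl⟩ := hM.map_eq
    have hle := hmain n hn p hp hpn (P₀.map ξ) hμ S hS hSL hSL' α δ hα hαc hδ i hi
    rw [← hMl] at hle
    have hle2 := (Measure.le_map_apply hMm _).trans hle
    refine le_trans ?_ (mul_le_mul_of_nonneg_right (le_max_left C _) (by positivity))
    refine ENNReal.toReal_le_of_le_ofReal (by positivity) (le_trans (measure_mono ?_) hle2)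
    rintro ω ⟨hgap, hnorm, hσ⟩
    refine ⟨(opBound_norm (M ω)).mono hnorm, hσ, ?_⟩
    have hsq : (n : ℝ) ^ (-(1 / 2) : ℝ) = (√(n : ℝ))⁻¹ := by
      rw [Real.rpow_neg hn0.le, ← Real.sqrt_eq_rpow]
    rw [Set.mem_ofPred_eq, hsq, ← div_eq_mul_inv] at hgap
    exact hgap
  · -- For bounded `n` the lower bounds on `α` and `δ` keep `δ` away from `0`, and a large constant suffices.
    have hα1 : √α ≤ 1 := Real.sqrt_le_one.2 (hαc.trans hc1)
    have h1 := exp_neg_sq_le hn1 hc0.le hα hδ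
    have h2 : ((n : ℝ) ^ c) ^ 2 ≤ ((n₀ : ℝ) ^ c) ^ 2 := by
      have : (n : ℝ) ≤ n₀ := by exact_mod_cast hn.le
      gcongr
    have h3 : δ ≤ δ / √α := by
      rw [le_div_iff₀ hsα]
      exact mul_le_of_le_one_right hδ0.le hα1
    calc _ ≤ (1 : ℝ) := measureReal_le_one
      _ = Real.exp (((n₀ : ℝ) ^ c) ^ 2) * Real.exp (-((n₀ : ℝ) ^ c) ^ 2) := by
          rw [← Real.exp_add, add_neg_cancel, Real.exp_zero]
      _ ≤ max C (Real.exp (((n₀ : ℝ) ^ c) ^ 2)) * (δ / √α) := by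
          refine mul_le_mul (le_max_right _ _) ?_ (Real.exp_pos _).le (by positivity)
          exact ((Real.exp_le_exp.2 (neg_le_neg h2)).trans h1).trans h3
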